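/- Consider the alphabet $\{a,\vartriangleleft,\vartriangleright,\#\}$. An encoding of a finite binary relation $R\subseteq\mathbb N\times\mathbb N$ is any word $\prod_{i=1}^{t}\vartriangleleft a^{x_i}\# a^{y_i}\vartriangleright$ with $t\ge 0$ and $\{(x_i,y_i): 1\le i\le t\}=R$ (arbitrary order, repetitions allowed). The relation $R$ defines the finite simple undirected graph $G_R$ whose vertices are all the numbers that occur in the pairs of $R$ and whose edges are the sets $\{u,v\}$ with $u\neq v$ and $(u,v)\in R$ or $(v,u)\in R$. An encoding of a graph $G$ is an encoding of any relation $R$ with $G_R=G$. For a set $\mathcal G$ of finite simple graphs with vertices in $\mathbb N$, let $\langle\mathcal G\rangle$ be the language of all encodings of all graphs in $\mathcal G$. For a language $F$ (the filter), let $\mathrm{NRR}(F)$ be the language of descriptions of nondeterministic finite automata $\mathcal A$ (given by the initial state, the accepting states and the list of transitions, $\varepsilon$-transitions being allowed) such that $F\cap L(\mathcal A)\neq\varnothing$. For languages $A$, $B$ over finite alphabets, write $A\le_{m}^{P}B$ if there is a function $f$ computable in polynomial time such that $x\in A\iff f(x)\in B$ for every word $x$; write $A\le_{dtt}^{PSPACE}B$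 if there is a function computable in polynomial space (the length of the output, which is written on a write-only tape, is not counted and may be exponential) that maps every word $x$ to a finite, possibly empty, list of words $q_1,\dots,q_s$ such that $x\in A$ if and only if $q_i\in B$ for at least one $i$. Theorem. For every nonempty language $X\subseteq\{0,1\}^*$ there exists a set $\mathcal G_X$ of finite simple graphs with vertices in $\mathbb N$, closed under isomorphism, such that \[ X\ \le_{m}^{P}\ \mathrm{NRR}(\langle\mathcal G_X\rangle)\ \le_{dtt}^{PSPACE}\ X . \] -/

import Mathlib

/-! ### Polynomial time and polynomial space functions, and reductions

The machine model is Mathlib's `Turing.FinTM2` (finitely many stacks, finite control), the model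
behind `Turing.TM2ComputableInPolyTime`. -/

/-- The statement never inspects the stack `k`: it may push symbols on `k`, but it neither peeks at
`k` nor pops from it. -/
def Turing.TM2.Stmt.WriteOnly {K : Type} {Γ : K → Type} {Λ σ : Type} (k : K) :
    Turing.TM2.Stmt Γ Λ σ → Prop
  | .push _ _ q => WriteOnly k q
  | .peek k' _ q => k' ≠ k ∧ WriteOnly k q
  | .pop k' _ q => k' ≠ k ∧ WriteOnly k q
  | .load _ q => WriteOnly k q
  | .branch _ q₁ q₂ => WriteOnly k q₁ ∧ WriteOnly k q₂
  | .goto _ => True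
  | .halt => True

/-- The space used by a configuration: the number of symbols on all the stacks except for the
output stack. (The input stack is counted.) -/
def Turing.FinTM2.space (tm : Turing.FinTM2) (c : tm.Cfg) : ℕ :=
  letI := tm.kFin
  ∑ k ∈ Finset.univ.erase tm.k₁, (c.stk k).length

/-- A machine with a write-only output stack, and a proof that it computes `f` in polynomial space,
the output not being counted; so the output may be exponentially long. -/
structure Turing.TM2ComputableInPolySpace {α β αΓ βΓ : Type} (ea : α → List αΓ)
    (eb : β → List βΓ) (f : α → β) extends Turing.TM2Computable ea eb f where
  /-- all the stack alphabets are finite -/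
  finite_alphabets : ∀ k, Finite (tm.Γ k)
  /-- the output stack is not the input stack -/
  input_ne_output : tm.k₀ ≠ tm.k₁
  /-- the output stack is write-only -/
  writeOnly : ∀ l, Turing.TM2.Stmt.WriteOnly tm.k₁ (tm.m l)
  /-- the polynomial that bounds the space -/
  bound : Polynomial ℕ
  /-- every configuration of the computation on the input `a` respects the bound -/
  space_le : ∀ (a : α) (c : tm.Cfg),
    Turing.TM2.Reaches tm.m
      (Turing.initList tm (List.map inputAlphabet.invFun (ea a))) c →
    tm.space c ≤ bound.eval (ea a).length

/-- `A` is many-one reducible to `B` by a function computable in polynomial time. -/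
def PolyTimeManyOneReducible {α β : Type} (A : Language α) (B : Language β) : Prop :=
  ∃ f : List α → List β,
    Nonempty (Turing.TM2ComputableInPolyTime (id : List α → List α) (id : List β → List β) f) ∧
    ∀ x, x ∈ A ↔ f x ∈ B

/-- A finite list of words is written as a single word, `none` terminating each of the words. -/
def encodeWordList {β : Type} (qs : List (List β)) : List (Option β) :=
  qs.flatMap fun q => q.map some ++ [none]

/-- `A` is disjunctive truth table reducible to `B` in polynomial space: a function computable in
polynomial space maps every word `x` to a finite list of queries such that `x ∈ A` if and only if at
least one of the queries belongs to `B`. -/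
def PolySpaceDttReducible {α β : Type} (A : Language α) (B : Language β) : Prop :=
  ∃ f : List α → List (List β),
    Nonempty (Turing.TM2ComputableInPolySpace (id : List α → List α) encodeWordList f) ∧
    ∀ x, x ∈ A ↔ ∃ q ∈ f x, q ∈ B

/-! ### Descriptions of automata and regular realizability -/

/-- A description of a nondeterministic finite automaton over `α`: an initial state, the list of
accepting states and the list of transitions `(p, s, q)`, where `s = none` is an ε-transition. The
states are the (finitely many) numbers that occur in the description. -/
structure Automaton (α : Type) where
  start : ℕ
  accept : List ℕ
  transitions : List (ℕ × Option α × ℕ)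

/-- The automaton as an automaton of Mathlib; the numbers which do not occur in the description are
isolated states and do not affect the language. -/
def Automaton.toεNFA {α : Type} (A : Automaton α) : εNFA α ℕ where
  step p s := {q | (p, s, q) ∈ A.transitions}
  start := {A.start}
  accept := {q | q ∈ A.accept}

/-- The language `L(A)` recognized by `A`. -/
def Automaton.language {α : Type} (A : Automaton α) : Language α :=
  A.toεNFA.accepts

/-- The alphabet in which automata over `α` are written down. -/
inductive AutomatonSymbol (α : Type) where
  | tally
  | accept
  | transition
  | label (s : Option α)
  deriving DecidableEq

/-- An automaton as a word. States are written in unary. The word begins with the initial state;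
then follow the accepting states, each preceded by the marker `accept`, and the transitions, each
preceded by the marker `transition`, with the label between the two states. -/
def Automaton.encode {α : Type} (A : Automaton α) : List (AutomatonSymbol α) :=
  List.replicate A.start .tally ++
    A.accept.flatMap (fun q => .accept :: List.replicate q .tally) ++
    A.transitions.flatMap (fun t =>
      .transition :: (List.replicate t.1 .tally ++ .label t.2.1 :: List.replicate t.2.2 .tally))

/-- The nondeterministic regular realizability problem with the filter `F`: the language of the
descriptions of automata `A` such that `F ∩ L(A)` is not empty. -/
def NRR {α : Type} (F : Language α) : Language (AutomatonSymbol α) :=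
  {w | ∃ A : Automaton α, A.encode = w ∧ ∃ u, u ∈ F ∧ u ∈ A.language}

/-! ### Encodings of finite binary relations and of graphs -/

/-- The four letters `a`, `◁`, `▷`, `#`. -/
inductive Letter where
  | a
  | left
  | right
  | hash
  deriving DecidableEq

/-- The block `◁ aˣ # aʸ ▷` of the pair `(x, y)`. -/
def block (p : ℕ × ℕ) : List Letter :=
  .left :: (List.replicate p.1 .a ++ .hash :: (List.replicate p.2 .a ++ [.right]))

/-- The word `w` is an encoding of the finite binary relation `R`: it is a concatenation of blocks
of the elements of `R`, each element occurring at least once, in any order. -/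
def IsEncoding (w : List Letter) (R : Finset (ℕ × ℕ)) : Prop :=
  ∃ xs : List (ℕ × ℕ), xs.toFinset = R ∧ w = xs.flatMap block

/-- A finite simple undirected graph whose vertices are natural numbers. -/
structure NatGraph where
  verts : Finset ℕ
  graph : SimpleGraph verts

/-- The graph of a finite binary relation `R`. Its vertices are all the numbers that occur in the
pairs of `R`; distinct vertices `u`, `v` are adjacent if `(u, v) ∈ R` or `(v, u) ∈ R`. -/
def graphOf (R : Finset (ℕ × ℕ)) : NatGraph where
  verts := R.image Prod.fst ∪ R.image Prod.snd
  graph := SimpleGraph.fromRel fun u v => ((u : ℕ), (v : ℕ)) ∈ R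

/-- The set of graphs is closed under isomorphism. -/
def IsoClosed (𝒢 : Set NatGraph) : Prop :=
  ∀ G H : NatGraph, G ∈ 𝒢 → Nonempty (G.graph ≃g H.graph) → H ∈ 𝒢

/-- The language of all the encodings of all the graphs in `𝒢`. -/
def graphLanguage (𝒢 : Set NatGraph) : Language Letter :=
  {w | ∃ R : Finset (ℕ × ℕ), graphOf R ∈ 𝒢 ∧ IsEncoding w R}

/-! ### Structured stack programs and their compilation to `Turing.FinTM2` -/

/-! The coding. A binary word with letters b_i is coded by the set of the numbers 2i + 2 + b_i. They
are all at least 2, and they determine the word (`wordDegs_injective`). The class `degGraphs X`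
consists of the graphs whose degree set codes a word of X and of all the graphs with a vertex of
degree one. The degree set is an isomorphism invariant, so the class is closed under isomorphism.

Hardness. The disjoint union of cliques with 2i + 3 + b_i vertices has exactly the degree set that
codes the word (`Cliques.degs_pairs`). A word is mapped to an automaton that accepts one single
encoding of this graph. No vertex has degree one, so the automaton is a positive instance if and
only if the word belongs to X (`Cliques.mem_iff_encode_mem_NRR`).

Upper bound. Let n be the length of the description of an automaton A. States are written in unary,
so no state on a run from the initial state exceeds n. If A accepts an encoding in which some number
exceeds n, pumping makes this occurrence larger than all the other numbers of the encoding. It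
becomes a new vertex of degree one, and the instance is positive (`exists_one_mem_degs`). This is
the purpose of the graphs with a vertex of degree one: the degree set need not be known when large
numbers occur. If all the numbers are at most n, then so are all the degrees, and a coded word has
length at most n.

Short runs suffice to see which cases occur. A runs in parallel with a parser that has counters
saturated at n + 1 and collects the pairs it has read. A path need not repeat a configuration, and
the collected set only grows, so along the path its cardinality can stand for it; this leaves
polynomially many steps (`exists_isRun`, `mem_NRR_degGraphs_iff`). The queries are the words coded
by the degree sets of short runs with small numbers, and a fixed element of X if some short run
reads a large number or produces a vertex of degree one. The set X enters the program only through
this fixed element.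

Machines. Both functions are written in a small structured language of stack programs, whose
compilation to `Turing.FinTM2` is proved correct once (`Cmd.Exec.steps`). For the upper bound the
queries are defined by formulas with quantifiers over strings of polynomial length, and a generic
program decides such formulas by exhaustive search (`Cmd.Run.evalProg`). There only the heights of
the stacks are bounded, not the time. The program for the union of cliques consists of nested loops
with explicit time bounds. -/

/-- The finite memory of a stack program: a symbol register and two flags. -/
abbrev Reg (G : Type) := Option G × Bool × Bool

/-- Structured programs acting on stacks over `G` indexed by `I` and on a write-only output stack
over `O`. -/
inductive Cmd (I G O : Type) : Type
  | push (i : I) (f : Reg G → G)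
  | pushOut (f : Reg G → O)
  | pop (i : I)
  | load (f : Reg G → Reg G)
  | seq (c d : Cmd I G O)
  | ite (p : Reg G → Bool) (c d : Cmd I G O)
  | loop (p : Reg G → Bool) (c : Cmd I G O)

/-- The state of a stack program. -/
structure Store (I G O : Type) where
  reg : Reg G
  stk : I → List G
  out : List O

namespace Cmd

variable {I G O : Type}

/-- The alphabets of the stacks of the compiled machine. -/
abbrev Alph (I G O : Type) : Option I → Type
  | none => O
  | some _ => G

/-- The labels of the compiled program. -/
def Lbl : Cmd I G O → Type
  | .push _ _ | .pushOut _ | .pop _ | .load _ => Unit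
  | .seq c d => Lbl c ⊕ Lbl d
  | .ite _ c d => Option (Lbl c ⊕ Lbl d)
  | .loop _ c => Option (Lbl c)

/-- The label at which the compiled program starts. -/
def entry : (c : Cmd I G O) → Lbl c
  | .push _ _ | .pushOut _ | .pop _ | .load _ => ()
  | .seq c _ => Sum.inl (entry c)
  | .ite _ _ _ => none
  | .loop _ _ => none

noncomputable instance fintypeLbl : (c : Cmd I G O) → Fintype (Lbl c)
  | .push _ _ | .pushOut _ | .pop _ | .load _ => inferInstanceAs (Fintype Unit)
  | .seq c d => by
      letI := fintypeLbl c; letI := fintypeLbl d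
      exact inferInstanceAs (Fintype (Lbl c ⊕ Lbl d))
  | .ite _ c d => by
      letI := fintypeLbl c; letI := fintypeLbl d
      exact inferInstanceAs (Fintype (Option (Lbl c ⊕ Lbl d)))
  | .loop _ c => by
      letI := fintypeLbl c
      exact inferInstanceAs (Fintype (Option (Lbl c)))

/-- Jump to a label, or halt. -/
def jump {Λ : Type} : Option Λ → Turing.TM2.Stmt (Alph I G O) Λ (Reg G)
  | none => .halt
  | some l => .goto fun _ => l

/-- The compiled program. -/
def code {Λ : Type} : (c : Cmd I G O) → (Lbl c → Λ) → Option Λ → Lbl c →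
    Turing.TM2.Stmt (Alph I G O) Λ (Reg G)
  | .push i f, _, e, _ => .push (some i) f (jump e)
  | .pushOut f, _, e, _ => .push none f (jump e)
  | .pop i, _, e, _ => .pop (some i) (fun r o => (o, r.2)) (jump e)
  | .load f, _, e, _ => .load f (jump e)
  | .seq c d, emb, e, l =>
      match l with
      | Sum.inl l => code c (fun l => emb (Sum.inl l)) (some (emb (Sum.inr (entry d)))) l
      | Sum.inr l => code d (fun l => emb (Sum.inr l)) e l
  | .ite p c d, emb, e, l =>
      match l with
      | none => .branch p (.goto fun _ => emb (some (Sum.inl (entry c))))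
          (.goto fun _ => emb (some (Sum.inr (entry d))))
      | some (Sum.inl l) => code c (fun l => emb (some (Sum.inl l))) e l
      | some (Sum.inr l) => code d (fun l => emb (some (Sum.inr l))) e l
  | .loop p c, emb, e, l =>
      match l with
      | none => .branch p (.goto fun _ => emb (some (entry c))) (jump e)
      | some l => code c (fun l => emb (some l)) (some (emb none)) l

/-- The output stack is `none`, while every pop of the compiled code acts on a stack `some i`; only
`pushOut` mentions `none`. -/
theorem writeOnly_code {Λ : Type} (c : Cmd I G O)
    (emb : Lbl c → Λ) (e : Option Λ) (l : Lbl c) :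
    Turing.TM2.Stmt.WriteOnly none (code c emb e l) := by
  have hj : ∀ e : Option Λ, Turing.TM2.Stmt.WriteOnly none
      (jump e : Turing.TM2.Stmt (Alph I G O) Λ (Reg G)) := by
    intro e; cases e <;> trivial
  induction c generalizing e with
  | push i f => exact hj e
  | pushOut f => exact hj e
  | pop i => exact ⟨by simp, hj e⟩
  | load f => exact hj e
  | seq c d ihc ihd =>
    cases l with
    | inl l => exact ihc _ _ l
    | inr l => exact ihd _ _ l
  | ite p c d ihc ihd =>
    cases l with
    | none => exact ⟨trivial, trivial⟩
    | some l =>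
      cases l with
      | inl l => exact ihc _ _ l
      | inr l => exact ihd _ _ l
  | loop p c ih =>
    cases l with
    | none => exact ⟨trivial, hj e⟩
    | some l => exact ih _ _ l

/-! ### Big-step semantics and correctness of the compilation -/

variable [DecidableEq I]

/-- Big-step semantics: `Exec b c n s s'` means that `c` takes `s` to `s'` in `n` steps and never
pushes a stack (other than the output) beyond the height `b`. -/
inductive Exec (b : ℕ∞) : Cmd I G O → ℕ → Store I G O → Store I G O → Prop
  | push {i f s} : ((s.stk i).length + 1 : ℕ) ≤ b →
      Exec b (.push i f) 1 s ⟨s.reg, Function.update s.stk i (f s.reg :: s.stk i), s.out⟩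
  | pushOut {f s} : Exec b (.pushOut f) 1 s ⟨s.reg, s.stk, f s.reg :: s.out⟩
  | pop {i s} : Exec b (.pop i) 1 s
      ⟨((s.stk i).head?, s.reg.2), Function.update s.stk i (s.stk i).tail, s.out⟩
  | load {f s} : Exec b (.load f) 1 s ⟨f s.reg, s.stk, s.out⟩
  | seq {c d m n s s' s''} : Exec b c m s s' → Exec b d n s' s'' → Exec b (.seq c d) (m + n) s s''
  | iteTrue {p c d n s s'} : p s.reg = true → Exec b c n s s' → Exec b (.ite p c d) (n + 1) s s'
  | iteFalse {p c d n s s'} : p s.reg = false → Exec b d n s s' → Exec b (.ite p c d) (n + 1) s s'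
  | loopStop {p c s} : p s.reg = false → Exec b (.loop p c) 1 s s
  | loopStep {p c m n s s' s''} : p s.reg = true → Exec b c m s s' → Exec b (.loop p c) n s' s'' →
      Exec b (.loop p c) (m + n + 1) s s''

/-- The stacks of the compiled machine. -/
def mkStk (S : I → List G) (o : List O) : (k : Option I) → List (Alph I G O k)
  | none => o
  | some i => S i

theorem mkStk_update (S : I → List G) (o : List O) (i : I) (l : List G) :
    mkStk (Function.update S i l) o = Function.update (mkStk S o) (some i) l := by
  funext k
  cases k with
  | none => exact (Function.update_of_ne (β := fun k => List (Alph I G O k))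
      (Option.some_ne_none i).symm l (mkStk S o)).symm
  | some j =>
    by_cases h : j = i
    · subst h
      have h1 : mkStk (Function.update S j l) o (some j) = l := by
        change Function.update S j l j = l
        exact Function.update_self j l S
      exact h1.trans (Function.update_self (β := fun k => List (Alph I G O k))
        (some j) l (mkStk S o)).symm
    · have h1 : mkStk (Function.update S i l) o (some j) = S j := by
        change Function.update S i l j = S j
        exact Function.update_of_ne h l S
      exact h1.trans (Function.update_of_ne (β := fun k => List (Alph I G O k))
        (fun h' => h (Option.some.inj h')) l (mkStk S o)).symm

theorem mkStk_out (S : I → List G) (o o' : List O) :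
    mkStk S o' = Function.update (mkStk S o) none o' := by
  funext k
  cases k with
  | none => exact (Function.update_self (β := fun k => List (Alph I G O k))
      none o' (mkStk S o)).symm
  | some j => exact (Function.update_of_ne (β := fun k => List (Alph I G O k))
      (Option.some_ne_none j) o' (mkStk S o)).symm

/-- The configuration of the compiled machine at a label. -/
def cfg {Λ : Type} (l : Option Λ) (s : Store I G O) : Turing.TM2.Cfg (Alph I G O) Λ (Reg G) :=
  ⟨l, s.reg, mkStk s.stk s.out⟩

/-- `n` steps of a deterministic system, all the configurations satisfying `P`. -/
inductive Steps {C : Type} (f : C → Option C) (P : C → Prop) : ℕ → C → C → Prop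
  | refl {a} : P a → Steps f P 0 a a
  | head {n a b c} : P a → f a = some b → Steps f P n b c → Steps f P (n + 1) a c

theorem Steps.trans {C : Type} {f : C → Option C} {P : C → Prop} {m n : ℕ} {a b c : C}
    (h : Steps f P m a b) (h' : Steps f P n b c) : Steps f P (m + n) a c := by
  induction h with
  | refl _ => simpa using h'
  | @head k _ _ _ ha hab _ ih =>
    have := Steps.head ha hab (ih h')
    rwa [show k + 1 + n = k + n + 1 by omega]

/-- Iterating `flip bind f` is the form in which Mathlib expresses that a machine evaluates in `n`
steps. -/
theorem Steps.iterate {C : Type} {f : C → Option C} {P : C → Prop} {n : ℕ} {a b : C}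
    (h : Steps f P n a b) : (flip bind f)^[n] (some a) = some b := by
  induction h with
  | refl _ => rfl
  | head _ hab _ ih =>
    rw [Function.iterate_succ_apply]
    have : flip bind f (some _) = some _ := hab
    rw [this, ih]

/-- The system is deterministic and halts at `b`, so every reachable configuration lies on the one
run from `a` to `b`. An invariant of that run is therefore a bound for everything reachable, as the
definition of polynomial space demands. -/
theorem Steps.forall_reaches {C : Type} {f : C → Option C} {P : C → Prop} {n : ℕ} {a b c : C}
    (h : Steps f P n a b) (hb : f b = none)
    (hc : Relation.ReflTransGen (fun x y => y ∈ f x) a c) : P c := by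
  induction h with
  | refl ha =>
    rcases Relation.ReflTransGen.cases_head hc with rfl | ⟨d, hd, _⟩
    · exact ha
    · simp [hb] at hd
  | head ha hab _ ih =>
    rcases Relation.ReflTransGen.cases_head hc with rfl | ⟨d, hd, hdc⟩
    · exact ha
    · rw [hab] at hd
      cases hd
      exact ih hb hdc

/-- All the stacks except for the output have height at most `b`. -/
def Bdd (b : ℕ∞) {Λ : Type} (c : Turing.TM2.Cfg (Alph I G O) Λ (Reg G)) : Prop :=
  ∀ i : I, ((show List G from c.stk (some i)).length : ℕ∞) ≤ b

theorem stepAux_jump {Λ : Type} (e : Option Λ) (r : Reg G)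
    (S : (k : Option I) → List (Alph I G O k)) :
    Turing.TM2.stepAux (jump e) r S = ⟨e, r, S⟩ := by
  cases e <;> rfl

/-- Only `push` raises a stack, and its rule carries the bound as a premise. -/
theorem Exec.bdd {b : ℕ∞} {c : Cmd I G O} {n : ℕ} {s s' : Store I G O} (h : Exec b c n s s')
    (hs : ∀ i, ((s.stk i).length : ℕ∞) ≤ b) : ∀ i, ((s'.stk i).length : ℕ∞) ≤ b := by
  induction h with
  | @push i f s hb =>
    intro j
    by_cases h : j = i
    · subst h; simpa using hb
    · simpa [h] using hs j
  | pushOut => exact hs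
  | @pop i s =>
    intro j
    by_cases h : j = i
    · subst h
      refine le_trans ?_ (hs j)
      simp
    · simpa [h] using hs j
  | load => exact hs
  | seq _ _ ih ih' => exact ih' (ih hs)
  | iteTrue _ _ ih => exact ih hs
  | iteFalse _ _ ih => exact ih hs
  | loopStop => exact hs
  | loopStep _ _ _ ih ih' => exact ih' (ih hs)

/-- Correctness of the compiler. The embedding `emb` of the labels and the exit label `e` are
arbitrary because a subprogram occurs inside a larger program and continues at a place that depends
on its context; the induction changes both. -/
theorem Exec.steps {b : ℕ∞} {c : Cmd I G O} {n : ℕ} {s s' : Store I G O} (h : Exec b c n s s')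
    {Λ : Type} (M : Λ → Turing.TM2.Stmt (Alph I G O) Λ (Reg G)) (emb : Lbl c → Λ) (e : Option Λ)
    (hM : ∀ l, M (emb l) = code c emb e l) (hs : ∀ i, ((s.stk i).length : ℕ∞) ≤ b) :
    Steps (Turing.TM2.step M) (Bdd b) n (cfg (some (emb (entry c))) s) (cfg e s') := by
  have key : ∀ (l : Λ) (s : Store I G O) (c' : Turing.TM2.Cfg (Alph I G O) Λ (Reg G)),
      Turing.TM2.stepAux (M l) s.reg (mkStk s.stk s.out) = c' →
      Turing.TM2.step M (cfg (some l) s) = some c' := by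
    rintro l s c' rfl; rfl
  induction h generalizing e with
  | @push i f s hb =>
    refine .head hs (key _ _ _ ?_) (.refl (Exec.bdd (.push hb) hs))
    rw [hM]
    simp only [code, cfg, mkStk_update]
    exact stepAux_jump _ _ _
  | @pushOut f s =>
    refine .head hs (key _ _ _ ?_) (.refl hs)
    rw [hM]
    simp only [code, cfg]
    rw [mkStk_out s.stk s.out (f s.reg :: s.out)]
    exact stepAux_jump _ _ _
  | @pop i s =>
    refine .head hs (key _ _ _ ?_) (.refl (Exec.bdd .pop hs))
    rw [hM]
    simp only [code, stepAux_jump, cfg, Turing.TM2.stepAux.eq_3, mkStk_update]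
    rfl
  | @load f s =>
    refine .head hs (key _ _ _ ?_) (.refl hs)
    rw [hM]
    simp only [code, stepAux_jump, cfg, Turing.TM2.stepAux.eq_4]
  | @seq c d m n s s' s'' h h' ih ih' =>
    have h1 := ih (fun l => emb (Sum.inl l)) (some (emb (Sum.inr (entry d))))
      (fun l => hM (Sum.inl l)) hs
    have h2 := ih' (fun l => emb (Sum.inr l)) e (fun l => hM (Sum.inr l)) (h.bdd hs)
    exact h1.trans h2
  | @iteTrue p c d n s s' hp h ih =>
    have h1 := ih (fun l => emb (some (Sum.inl l))) e (fun l => hM (some (Sum.inl l))) hs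
    refine .head hs (key _ _ _ ?_) h1
    rw [hM]
    simp [code, entry, hp, cfg]
  | @iteFalse p c d n s s' hp h ih =>
    have h1 := ih (fun l => emb (some (Sum.inr l))) e (fun l => hM (some (Sum.inr l))) hs
    refine .head hs (key _ _ _ ?_) h1
    rw [hM]
    simp [code, entry, hp, cfg]
  | @loopStop p c s hp =>
    refine .head hs (key _ _ _ ?_) (.refl hs)
    rw [hM]
    simp [code, entry, hp, cfg, stepAux_jump]
  | @loopStep p c m n s s' s'' hp h h' ih ih' =>
    have h1 := ih (fun l => emb (some l)) (some (emb none)) (fun l => hM (some l)) hs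
    have h2 := ih' emb e hM (h.bdd hs)
    refine .head hs (key _ _ _ ?_) (h1.trans h2)
    rw [hM]
    simp [code, entry, hp, cfg]

/-- The machine of a stack program, with the input on the stack `i`. -/
noncomputable def toFinTM2 [Fintype I] [Fintype G] (c : Cmd I G O) (i : I) : Turing.FinTM2 where
  K := Option I
  k₀ := some i
  k₁ := none
  Γ := Alph I G O
  Λ := Lbl c
  main := entry c
  σ := Reg G
  initialState := (none, false, false)
  Γk₀Fin := inferInstanceAs (Fintype G)
  m := code c id none

/-- The initial state of a program with input `x` on the stack `i`. -/
def init (i : I) (x : List G) : Store I G O :=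
  ⟨(none, false, false), Function.update (fun _ => []) i x, []⟩

/-- The final state of a program with output `y`. -/
def final (y : List O) : Store I G O :=
  ⟨(none, false, false), fun _ => [], y⟩

/-- `c` takes `s` to `s'` in at most `n` steps, without pushing a stack beyond the height `b`. -/
def Run (b n : ℕ∞) (c : Cmd I G O) (s s' : Store I G O) : Prop :=
  ∃ m : ℕ, (m : ℕ∞) ≤ n ∧ Exec b c m s s'

variable [Fintype I] [Fintype G]

theorem initList_toFinTM2 (c : Cmd I G O) (i : I) (x : List G) :
    Turing.initList (toFinTM2 c i) x = cfg (some (entry c)) (init i x) := by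
  unfold Turing.initList cfg init
  congr 1
  funext k
  cases k with
  | none => rfl
  | some j =>
    by_cases h : j = i
    · subst h
      have h1 : Function.update (fun _ : I => ([] : List G)) j x j = x := Function.update_self ..
      exact (dif_pos rfl).trans h1.symm
    · have h1 : Function.update (fun _ : I => ([] : List G)) i x j = [] :=
        Function.update_of_ne h _ _
      exact (dif_neg fun h' => h (Option.some.inj h')).trans h1.symm

theorem haltList_toFinTM2 (c : Cmd I G O) (i : I) (y : List O) :
    Turing.haltList (toFinTM2 c i) y = cfg none (final y) := by
  unfold Turing.haltList cfg final
  congr 1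
  funext k
  cases k with
  | none => rfl
  | some j => rfl

/-- Time is the only concern here, so the height bound is `⊤`. -/
theorem computableInPolyTime (c : Cmd I G O) (i : I) (f : List G → List O) (p : Polynomial ℕ)
    (h : ∀ x, Run ⊤ (p.eval x.length : ℕ) c (init i x) (final (f x))) :
    Nonempty (Turing.TM2ComputableInPolyTime (id : List G → List G) (id : List O → List O) f) := by
  refine ⟨{ tm := toFinTM2 c i, inputAlphabet := Equiv.refl G, outputAlphabet := Equiv.refl O,
            time := p, outputsFun := fun x => ?_ }⟩
  have hx := Classical.choose_spec (h x)
  refine { steps := Classical.choose (h x), evals_in_steps := ?_, steps_le_m := ?_ }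
  · have := (hx.2.steps (code c id none) id none (fun _ => rfl) (fun _ => le_top)).iterate
    have e1 : List.map (Equiv.refl G).invFun (id x) = x := by
      simp only [id]; exact List.map_id x
    have e2 : List.map (Equiv.refl O).invFun (id (f x)) = f x := by
      simp only [id]; exact List.map_id _
    erw [e1, e2, initList_toFinTM2, Option.map_some, haltList_toFinTM2]
    exact this
  · simpa using hx.1

/-- Here the time bound is `⊤`. Termination is still guaranteed, since `Run` provides a finite
number of steps. The inequality `x.length ≤ p.eval x.length` covers the input stack in the initial
configuration. -/
theorem computableInPolySpace {β : Type} [Finite O] (c : Cmd I G O) (i : I) (eb : β → List O)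
    (f : List G → β) (p : Polynomial ℕ)
    (h : ∀ x : List G, x.length ≤ p.eval x.length ∧
      Run (p.eval x.length : ℕ) ⊤ c (init i x) (final (eb (f x)))) :
    Nonempty (Turing.TM2ComputableInPolySpace (id : List G → List G) eb f) := by
  have e1 : ∀ x : List G, List.map (Equiv.refl G).invFun (id x) = x := by
    intro x; simp only [id]; exact List.map_id x
  have key : ∀ x : List G, ∃ m, Steps (Turing.TM2.step (code c id none))
      (Bdd (p.eval x.length : ℕ)) m (cfg (some (entry c)) (init i x))
        (cfg none (final (eb (f x)))) := by
    intro x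
    obtain ⟨m, -, hm⟩ := (h x).2
    refine ⟨m, hm.steps (code c id none) id none (fun _ => rfl) ?_⟩
    intro j
    by_cases hj : j = i
    · subst hj; simpa [init] using (h x).1
    · simp [init, hj]
  refine ⟨{ tm := toFinTM2 c i, inputAlphabet := Equiv.refl G, outputAlphabet := Equiv.refl O,
            outputsFun := fun x => ?_, finite_alphabets := ?_, input_ne_output := ?_,
            -- Besides the output there are `Fintype.card I` stacks, each of height at most `p`.
            writeOnly := ?_, bound := Polynomial.C (Fintype.card I) * p, space_le := ?_ }⟩
  · refine { steps := Classical.choose (key x), evals_in_steps := ?_ }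
    have := (Classical.choose_spec (key x)).iterate
    have e2 : List.map (Equiv.refl O).invFun (eb (f x)) = eb (f x) := List.map_id _
    erw [e1, e2, initList_toFinTM2, Option.map_some, haltList_toFinTM2]
    exact this
  · intro k
    cases k with
    | none => exact inferInstanceAs (Finite O)
    | some j => exact inferInstanceAs (Finite G)
  · exact Option.some_ne_none i
  · intro l
    exact writeOnly_code c id none l
  · intro x a ha
    erw [e1, initList_toFinTM2] at ha
    obtain ⟨m, hm⟩ := key x
    have hb : Bdd (p.eval x.length : ℕ) a := hm.forall_reaches rfl ha
    have hle : ∀ j : I, (show List G from a.stk (some j)).length ≤ p.eval x.length := by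
      intro j
      exact_mod_cast hb j
    have hsum : (toFinTM2 c i).space a = ∑ j : I, (show List G from a.stk (some j)).length := by
      unfold Turing.FinTM2.space
      have : (Finset.univ.erase (none : Option I)) = Finset.univ.map Function.Embedding.some := by
        ext k; cases k <;> simp
      calc _ = ∑ k ∈ Finset.univ.erase (none : Option I), (a.stk k).length := by
              rfl
        _ = _ := by
          rw [this, Finset.sum_map]
          rfl
    rw [hsum]
    calc _ ≤ ∑ _j : I, p.eval x.length := Finset.sum_le_sum fun j _ => hle j
      _ = _ := by simp

end Cmd


/-! ### Derived rules: draining, clearing and moving stacks -/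

namespace Cmd

section Basic

variable {I G O : Type} [DecidableEq I] {b m n : ℕ∞} {c d : Cmd I G O} {s s' s'' : Store I G O}

theorem Run.mono (h : Run b m c s s') (hmn : m ≤ n) : Run b n c s s' :=
  let ⟨k, hk, h⟩ := h
  ⟨k, hk.trans hmn, h⟩

theorem Run.congr {t t' : Store I G O} (h : Run b n c s s') (h₁ : s = t) (h₂ : s' = t') :
    Run b n c t t' := by
  subst h₁ h₂
  exact h

theorem Run.push {i : I} {f : Reg G → G} (h : ((s.stk i).length + 1 : ℕ) ≤ b) :
    Run b 1 (.push i f : Cmd I G O) s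
      ⟨s.reg, Function.update s.stk i (f s.reg :: s.stk i), s.out⟩ :=
  ⟨1, by simp, .push h⟩

theorem Run.pushOut {f : Reg G → O} :
    Run b 1 (.pushOut f : Cmd I G O) s ⟨s.reg, s.stk, f s.reg :: s.out⟩ :=
  ⟨1, by simp, .pushOut⟩

theorem Run.pop {i : I} : Run b 1 (.pop i : Cmd I G O) s
    ⟨((s.stk i).head?, s.reg.2), Function.update s.stk i (s.stk i).tail, s.out⟩ :=
  ⟨1, by simp, .pop⟩

theorem Run.popEq {i : I} {r : Option G} {f : Bool × Bool} {S : I → List G} {o : List O}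
    {l : List G} (h : S i = l) : Run b 1 (.pop i : Cmd I G O) ⟨(r, f), S, o⟩
      ⟨(l.head?, f), Function.update S i l.tail, o⟩ := by
  subst h
  exact Run.pop

theorem Run.load {f : Reg G → Reg G} :
    Run b 1 (.load f : Cmd I G O) s ⟨f s.reg, s.stk, s.out⟩ :=
  ⟨1, by simp, .load⟩

theorem Run.seq (h : Run b m c s s') (h' : Run b n d s' s'') :
    Run b (m + n) (.seq c d) s s'' :=
  let ⟨k, hk, h⟩ := h
  let ⟨l, hl, h'⟩ := h'
  ⟨k + l, by push_cast; exact add_le_add hk hl, .seq h h'⟩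

theorem Run.iteTrue {p : Reg G → Bool} (hp : p s.reg = true) (h : Run b n c s s') :
    Run b (n + 1) (.ite p c d) s s' :=
  let ⟨k, hk, h⟩ := h
  ⟨k + 1, by push_cast; exact add_le_add hk le_rfl, .iteTrue hp h⟩

theorem Run.iteFalse {p : Reg G → Bool} (hp : p s.reg = false) (h : Run b n d s s') :
    Run b (n + 1) (.ite p c d) s s' :=
  let ⟨k, hk, h⟩ := h
  ⟨k + 1, by push_cast; exact add_le_add hk le_rfl, .iteFalse hp h⟩

theorem Run.loopStop {p : Reg G → Bool} (hp : p s.reg = false) : Run b 1 (.loop p c) s s :=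
  ⟨1, by simp, .loopStop hp⟩

theorem Run.loopStep {p : Reg G → Bool} (hp : p s.reg = true) (h : Run b m c s s')
    (h' : Run b n (.loop p c) s' s'') : Run b (m + n + 1) (.loop p c) s s'' :=
  let ⟨k, hk, h⟩ := h
  let ⟨l, hl, h'⟩ := h'
  ⟨k + l + 1, by push_cast; exact add_le_add (add_le_add hk hl) le_rfl, .loopStep hp h h'⟩

/-- Pop the symbols of the stack `i` one by one and run `c` after each, until `i` is empty. -/
def drain (i : I) (c : Cmd I G O) : Cmd I G O :=
  .seq (.pop i) (.loop (fun r => r.1.isSome) (.seq c (.pop i)))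

/-- The loop invariant is indexed by the suffix `l` of `l₀` that still lies on the stack. The body
starts with the popped symbol in the register and may leave anything there, since the next pop
overwrites it. Each symbol costs the body, a pop and a loop test; the additional 2 is the first pop
and the last test. -/
theorem Run.drain {i : I} (S : List G → I → List G) (o : List G → List O)
    (f : List G → Bool × Bool) (l₀ : List G) (hS : ∀ l, l <:+ l₀ → S l i = l)
    (hstep : ∀ g l, (g :: l) <:+ l₀ → ∃ r, Run b n c
      ⟨(some g, f (g :: l)), Function.update (S (g :: l)) i l, o (g :: l)⟩ ⟨(r, f l), S l, o l⟩)
    (r : Option G) :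
    Run b (l₀.length * (n + 2) + 2) (Cmd.drain i c)
      ⟨(r, f l₀), S l₀, o l₀⟩ ⟨(none, f []), S [], o []⟩ := by
  have key : ∀ l : List G, l <:+ l₀ →
      Run b (l.length * (n + 2) + 1) (.loop (fun r => r.1.isSome) (.seq c (.pop i)))
        ⟨(l.head?, f l), Function.update (S l) i l.tail, o l⟩ ⟨(none, f []), S [], o []⟩ := by
    intro l
    induction l with
    | nil =>
      intro h
      have : Function.update (S []) i [] = S [] := by
        conv_rhs => rw [← Function.update_eq_self i (S []), hS [] h]
      simp only [List.tail_nil, this, List.head?_nil]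
      exact (Run.loopStop rfl).mono (by simp)
    | cons g l ih =>
      intro h
      obtain ⟨r, h1⟩ := hstep g l h
      have hl : l <:+ l₀ := (List.suffix_cons g l).trans h
      have h2 := ih hl
      refine (Run.loopStep rfl (h1.seq (Run.popEq (hS l hl))) h2).mono ?_
      rw [List.length_cons]
      push_cast
      apply le_of_eq
      ring
  refine ((Run.popEq (hS l₀ List.suffix_rfl)).seq (key l₀ List.suffix_rfl)).mono ?_
  apply le_of_eq
  ring

/-- Empty the stack `i`. -/
def clear (i : I) : Cmd I G O := drain i (.load id)

theorem Run.clear {i : I} (r : Option G) (f : Bool × Bool) (S : I → List G) (o : List O) :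
    Run b ((S i).length * 3 + 2) (Cmd.clear i) ⟨(r, f), S, o⟩
      ⟨(none, f), Function.update S i [], o⟩ := by
  have := Run.drain (b := b) (n := 1) (c := (.load id : Cmd I G O)) (i := i)
    (fun l => Function.update S i l) (fun _ => o) (fun _ => f) (S i) (by simp)
    (fun g l _ => by
      refine ⟨some g, ?_⟩
      simpa using Run.load (b := b) (f := id) (s := ⟨(some g, f), Function.update S i l, o⟩)) r
  simpa [Cmd.clear, show (1 : ℕ∞) + 2 = 3 from rfl] using this

variable [Inhabited G]

/-- Push the symbols of the stack `i` on the stack `j`. -/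
def move (i j : I) : Cmd I G O := drain i (.push j fun r => r.1.getD default)

/-- The symbols arrive in reverse order. The target is never higher than the two initial heights
together, which is what `hb` bounds. -/
theorem Run.move {i j : I} (hij : i ≠ j) (r : Option G) (f : Bool × Bool) (S : I → List G)
    (o : List O) (hb : ((S i).length + (S j).length : ℕ) ≤ b) :
    Run b ((S i).length * 3 + 2) (Cmd.move i j) ⟨(r, f), S, o⟩
      ⟨(none, f), Function.update (Function.update S i []) j ((S i).reverse ++ S j), o⟩ := by
  have := Run.drain (b := b) (n := 1) (i := i) (c := (.push j fun r => r.1.getD default))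
    (fun l => Function.update (Function.update S i l) j
      (((S i).take ((S i).length - l.length)).reverse ++ S j))
    (fun _ => o) (fun _ => f) (S i) (by intro l _; simp [hij])
    (fun g l hl => by
      refine ⟨some g, ?_⟩
      obtain ⟨p, hp⟩ := hl
      have h1 : (S i).length = p.length + (l.length + 1) := by rw [← hp]; simp
      have h2 : (S i).take ((S i).length - l.length) = p ++ [g] := by
        rw [h1, ← hp, show p.length + (l.length + 1) - l.length = p.length + 1 by omega]
        simp [List.take_append]
      have h3 : (S i).take ((S i).length - (g :: l).length) = p := by
        rw [h1, ← hp, List.length_cons, show p.length + (l.length + 1) - (l.length + 1) = p.length by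
          omega]
        simp
      rw [h2, h3]
      have := Run.push (b := b) (i := j) (f := fun r : Reg G => r.1.getD default)
        (s := ⟨(some g, f), Function.update (Function.update (Function.update S i (g :: l)) j
          (p.reverse ++ S j)) i l, o⟩) ?_
      · convert this using 2
        funext k
        by_cases hki : k = i
        · subst hki; simp [hij]
        · by_cases hkj : k = j
          · subst hkj; simp [hki]
          · simp [hki, hkj]
      · refine le_trans ?_ hb
        simp [hij.symm, h1]
        norm_cast
        omega) r
  simpa [Cmd.move, show (1 : ℕ∞) + 2 = 3 from rfl] using this

end Basic

/-- The stacks of a program with variables in `V`: every variable has a stack of its own and an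
auxiliary stack to which its symbols are moved while it is scanned. -/
inductive Idx (V : Type) : Type
  | val (v : V)
  | tmp (v : V)
  | acc
  deriving DecidableEq, Fintype

/-! ### Loops over the length of a variable -/

section ForEach

variable {V G O : Type} [DecidableEq V] {b n : ℕ∞}

/-- Set both stacks of the variable `v`. -/
def setVar (S : Idx V → List G) (v : V) (l l' : List G) : Idx V → List G :=
  Function.update (Function.update S (.val v) l) (.tmp v) l'

theorem setVar_eq_self {S : Idx V → List G} {v : V} {l : List G} (h : S (.val v) = l)
    (h' : S (.tmp v) = []) : setVar S v l [] = S := by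
  subst h
  unfold setVar
  rw [Function.update_eq_self, ← h', Function.update_eq_self]

variable [Inhabited G]

/-- Run `c` once for every symbol of the variable `v`, without changing `v`. -/
def forEach (v : V) (c : Cmd (Idx V) G O) : Cmd (Idx V) G O :=
  .seq (drain (.val v) (.seq (.push (.tmp v) fun r => r.1.getD default)
    (.seq (.load fun r => (none, r.2)) c)))
    (move (.tmp v) (.val v))

/-- The body runs while the symbols of `v` are split between its two stacks. It must hence work for
every split `l₁`, `l₂` of the right total length and leave the split alone. The cost per symbol is
`n` for the body, 2 for push and load, 2 for the draining loop and 3 for moving the symbol back. -/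
theorem Run.forEach {c : Cmd (Idx V) G O} {v : V} {l : List G} (S : ℕ → Idx V → List G)
    (o : ℕ → List O) (r : Option G) (f : Bool × Bool) (hb : (l.length : ℕ∞) ≤ b)
    (hv : ∀ k, k ≤ l.length → S k (.val v) = l) (ht : ∀ k, k ≤ l.length → S k (.tmp v) = [])
    (hc : ∀ k, k < l.length → ∀ l₁ l₂ : List G, l₁.length + l₂.length = l.length →
      Run b n c ⟨(none, f), setVar (S k) v l₁ l₂, o k⟩
        ⟨(none, f), setVar (S (k + 1)) v l₁ l₂, o (k + 1)⟩) :
    Run b (l.length * (n + 7) + 4) (Cmd.forEach v c) ⟨(r, f), S 0, o 0⟩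
      ⟨(none, f), S l.length, o l.length⟩ := by
  have h1 := Run.drain (b := b) (n := n + 2) (i := .val v)
    (c := .seq (.push (.tmp v) fun r => r.1.getD default) (.seq (.load fun r => (none, r.2)) c))
    (fun l₁ => setVar (S (l.length - l₁.length)) v l₁ (l.take (l.length - l₁.length)).reverse)
    (fun l₁ => o (l.length - l₁.length)) (fun _ => f) l (by intro l₁ _; simp [setVar])
    (fun g l₁ hl => by
      refine ⟨none, ?_⟩
      obtain ⟨p, hp⟩ := hl
      have h1 : l.length = p.length + (l₁.length + 1) := by rw [← hp]; simp
      have h2 : l.length - l₁.length = p.length + 1 := by omega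
      have h3 : l.length - (g :: l₁).length = p.length := by rw [List.length_cons]; omega
      have h4 : l.take (p.length + 1) = p ++ [g] := by
        rw [← hp]; simp [List.take_append]
      have h5 : l.take p.length = p := by rw [← hp]; simp
      rw [h2, h3, h4, h5]
      have hp := Run.push (b := b) (O := O) (i := .tmp v) (f := fun r : Reg G => r.1.getD default)
        (s := ⟨(some g, f), Function.update (setVar (S p.length) v (g :: l₁) p.reverse)
          (.val v) l₁, o p.length⟩) (by
            refine le_trans ?_ hb
            simp [setVar, h1])
      have hl := Run.load (b := b) (f := fun r : Reg G => (none, r.2))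
        (s := ⟨(some g, f), setVar (S p.length) v l₁ (p ++ [g]).reverse, o p.length⟩)
      have hc' := hc p.length (by omega) l₁ (p ++ [g]).reverse (by simp; omega)
      refine (hp.seq ?_ : Run b (1 + (1 + n)) _ _ _).mono (by apply le_of_eq; ring)
      convert hl.seq hc' using 2
      funext k
      by_cases h : k = .val v
      · subst h; simp [setVar]
      · by_cases h' : k = .tmp v
        · subst h'; simp [setVar]
        · simp [setVar, h, h']) r
  have h2 := Run.move (b := b) (i := Idx.tmp v) (j := Idx.val v) (by simp) none f
    (setVar (S l.length) v [] l.reverse) (o l.length) (by simpa [setVar] using hb)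
  simp only [Nat.sub_self, List.take_zero, List.reverse_nil, List.length_nil, Nat.sub_zero,
    List.take_length] at h1
  rw [setVar_eq_self (hv 0 (by simp)) (ht 0 (by simp))] at h1
  refine (h1.seq ?_).mono ?_ (m := _ + (l.length * 3 + 2))
  · convert h2 using 2
    · simp [setVar]
    · funext k
      by_cases h : k = .val v
      · subst h; simp [setVar, hv]
      · by_cases h' : k = .tmp v
        · subst h'; simp [setVar, ht]
        · simp [setVar, h, h']
  · apply le_of_eq
    ring

end ForEach

end Cmd


/-! ### Bounded second-order formulas over strings -/

/-- Formulas whose variables range over strings. The term `T` in `get s T o` is a sum of products of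
variables and stands for the corresponding number built from the lengths of the variables; the
formula says that the symbol of `s` at this position is `o`. The quantifier `exU v b` ranges over the
unary strings shorter than `b`, and `exS v b` over all the strings of the length of `b`. -/
inductive Fm (V G : Type) : Type
  | get (s : V) (T : List (List V)) (o : Option G)
  | not (φ : Fm V G)
  | and (φ ψ : Fm V G)
  | exU (v b : V) (φ : Fm V G)
  | exS (v b : V) (φ : Fm V G)

namespace Fm

variable {V G : Type}

/-- The value of a product of variables. -/
def monoVal (e : V → List G) (m : List V) : ℕ := (m.map fun v => (e v).length).prod

/-- The value of a sum of products of variables. -/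
def termVal (e : V → List G) (T : List (List V)) : ℕ := (T.map (monoVal e)).sum

variable [DecidableEq V] [Inhabited G]

/-- The semantics of formulas. -/
def Sat : Fm V G → (V → List G) → Prop
  | get s T o, e => (e s)[termVal e T]? = o
  | not φ, e => ¬ Sat φ e
  | and φ ψ, e => Sat φ e ∧ Sat ψ e
  | exU v b φ, e => ∃ i < (e b).length, Sat φ (Function.update e v (List.replicate i default))
  | exS v b φ, e => ∃ l : List G, l.length = (e b).length ∧ Sat φ (Function.update e v l)

/-- The bound variables. -/
def bound : Fm V G → List V
  | get _ _ _ => []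
  | not φ => bound φ
  | and φ ψ => bound φ ++ bound ψ
  | exU v _ φ => v :: bound φ
  | exS v _ φ => v :: bound φ

/-- No variable is bound twice on a branch, and no product mentions a variable twice or the string
that is read. -/
def Ok : Fm V G → Bool
  | get s T _ => T.all fun m => decide (m.Nodup ∧ s ∉ m)
  | not φ => Ok φ
  | and φ ψ => Ok φ && Ok ψ
  | exU v b φ => decide (v ∉ bound φ ∧ v ≠ b) && Ok φ
  | exS v b φ => decide (v ∉ bound φ ∧ v ≠ b) && Ok φ

end Fm

/-! ### Enumerating the strings of a given length -/

section Enumerate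

variable {G : Type} [Fintype G]

/-- The number of a symbol. -/
noncomputable def digit (g : G) : ℕ := Fintype.equivFin G g

theorem digit_lt (g : G) : digit g < Fintype.card G := (Fintype.equivFin G g).2

theorem digit_injective : Function.Injective (digit : G → ℕ) := fun _ _ h =>
  (Fintype.equivFin G).injective (Fin.ext h)

/-- The next symbol. -/
noncomputable def nextSym (g : G) : Option G :=
  if h : digit g + 1 < Fintype.card G then some ((Fintype.equivFin G).symm ⟨_, h⟩) else none

theorem digit_of_nextSym {g g' : G} (h : nextSym g = some g') : digit g' = digit g + 1 := by
  unfold nextSym at h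
  split_ifs at h with hlt
  cases h
  simp [digit]

theorem digit_of_nextSym_none {g : G} (h : nextSym g = none) : digit g + 1 = Fintype.card G := by
  unfold nextSym at h
  split_ifs at h with hlt
  have := digit_lt g
  omega

/-- The number of a string. -/
noncomputable def strVal (l : List G) : ℕ := Nat.ofDigits (Fintype.card G) (l.map digit)

theorem strVal_cons (g : G) (l : List G) : strVal (g :: l) = digit g + Fintype.card G * strVal l := by
  simp [strVal, Nat.ofDigits_cons]

theorem strVal_injective {l l' : List G} (hl : l.length = l'.length) (h : strVal l = strVal l') :
    l = l' := by
  induction l generalizing l' with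
  | nil => exact (List.length_eq_zero_iff.1 hl.symm).symm
  | cons g l ih =>
    cases l' with
    | nil => simp at hl
    | cons g' l' =>
      simp only [strVal_cons] at h
      have h1 := digit_lt g
      have h2 := digit_lt g'
      have h3 : digit g = digit g' := by
        have := congrArg (· % Fintype.card G) h
        simpa [Nat.add_mul_mod_self_left, Nat.mod_eq_of_lt, h1, h2] using this
      have h4 : strVal l = strVal l' := by
        rw [h3] at h
        exact Nat.eq_of_mul_eq_mul_left (by omega : 0 < Fintype.card G) (by omega)
      rw [digit_injective h3, ih (by simpa using hl) h4]

theorem strVal_lt (l : List G) : strVal l < Fintype.card G ^ l.length := by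
  induction l with
  | nil => simp [strVal]
  | cons g l ih =>
    rw [strVal_cons, List.length_cons, pow_succ, mul_comm _ (Fintype.card G)]
    have := digit_lt g
    calc _ < Fintype.card G + Fintype.card G * strVal l := by omega
      _ = Fintype.card G * (strVal l + 1) := by ring
      _ ≤ _ := Nat.mul_le_mul_left _ ih

variable [Inhabited G]

variable (G) in
/-- The symbol number zero. -/
noncomputable def zeroSym : G := (Fintype.equivFin G).symm ⟨0, Fintype.card_pos⟩

theorem digit_zeroSym : digit (zeroSym G) = 0 := by simp [digit, zeroSym]

/-- The next string of the same length, the first symbol being the least significant one. -/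
noncomputable def nextStr : List G → Option (List G)
  | [] => none
  | g :: l =>
    match nextSym g with
    | some g' => some (g' :: l)
    | none => (nextStr l).map (zeroSym G :: ·)

/-- This is addition of one with carry, in base `Fintype.card G`. -/
theorem nextStr_some {l l' : List G} (h : nextStr l = some l') :
    l'.length = l.length ∧ strVal l' = strVal l + 1 := by
  induction l generalizing l' with
  | nil => simp [nextStr] at h
  | cons g l ih =>
    unfold nextStr at h
    cases hg : nextSym g with
    | some g' =>
      simp only [hg, Option.some.injEq] at h
      subst h
      simp only [List.length_cons, strVal_cons, digit_of_nextSym hg, true_and]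
      omega
    | none =>
      simp only [hg, Option.map_eq_some_iff] at h
      obtain ⟨l'', h1, rfl⟩ := h
      obtain ⟨h2, h3⟩ := ih h1
      simp only [List.length_cons, h2, strVal_cons, h3, digit_zeroSym, true_and]
      have := digit_of_nextSym_none hg
      rw [Nat.mul_add]
      omega

/-- There is no successor only if every digit is maximal, that is, for the last string of its
length. -/
theorem nextStr_none {l : List G} (h : nextStr l = none) :
    strVal l + 1 = Fintype.card G ^ l.length := by
  induction l with
  | nil => simp [strVal]
  | cons g l ih =>
    unfold nextStr at h
    cases hg : nextSym g with
    | some g' => simp [hg] at h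
    | none =>
      simp only [hg, Option.map_eq_none_iff] at h
      have := ih h
      have h2 := digit_of_nextSym_none hg
      rw [strVal_cons, List.length_cons, pow_succ, ← this, mul_comm (strVal l + 1), Nat.mul_add]
      omega

theorem strVal_replicate_zeroSym (n : ℕ) : strVal (List.replicate n (zeroSym G)) = 0 := by
  induction n with
  | zero => simp [strVal]
  | succ n ih => simp [List.replicate_succ, strVal_cons, ih, digit_zeroSym]

end Enumerate


/-! ### Programs that evaluate formulas -/

namespace Cmd

section Skip

variable {V G O : Type} [DecidableEq V] {b : ℕ∞}

/-- Do nothing. -/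
def skip : Cmd (Idx V) G O := .load id

theorem Run.skip {n : ℕ∞} (s : Store (Idx V) G O) (hn : 1 ≤ n) : Run b n Cmd.skip s s :=
  (Run.load (f := id)).mono hn

/-- The stacks after moving `n` symbols of `s` to the accumulator. -/
def advance (S : Idx V → List G) (s : V) (n : ℕ) : Idx V → List G :=
  Function.update (Function.update S (.val s) ((S (.val s)).drop n)) .acc
    (((S (.val s)).take n).reverse ++ S .acc)

theorem advance_zero (S : Idx V → List G) (s : V) : advance S s 0 = S := by
  simp [advance]

theorem advance_advance (S : Idx V → List G) (s : V) (m n : ℕ) :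
    advance (advance S s m) s n = advance S s (m + n) := by
  funext k
  cases k with
  | val v =>
    by_cases h : v = s
    · subst h; simp [advance]
    · simp [advance, h]
  | tmp v => simp [advance]
  | acc =>
    simp only [advance, Function.update_self, ne_eq, reduceCtorEq, not_false_eq_true,
      Function.update_of_ne]
    rw [List.take_add, List.reverse_append, List.append_assoc]

theorem advance_setVar (S : Idx V → List G) {s v : V} (h : s ≠ v) (n : ℕ) (l l' : List G) :
    advance (setVar S v l l') s n = setVar (advance S s n) v l l' := by
  funext k
  cases k with
  | val w =>
    by_cases h1 : w = s
    · subst h1; simp [advance, setVar, h]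
    · by_cases h2 : w = v
      · subst h2; simp [advance, setVar, h1]
      · simp [advance, setVar, h1, h2]
  | tmp w => simp [advance, setVar, Function.update_apply]
  | acc => simp [advance, setVar, h]

variable [Inhabited G]

/-- Move as many symbols of `s` to the accumulator as the value of the product says. -/
def skipMono (s : V) : List V → Cmd (Idx V) G O
  | [] => .seq (.pop (.val s)) (.seq
      (.ite (fun r => r.1.isSome) (.push .acc fun r => r.1.getD default) Cmd.skip)
      (.load fun r => (none, r.2)))
  | v :: m => forEach v (skipMono s m)

/-- Move as many symbols of `s` to the accumulator as the value of the term says. -/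
def skipTerm (s : V) : List (List V) → Cmd (Idx V) G O
  | [] => Cmd.skip
  | m :: T => .seq (skipMono s m) (skipTerm s T)

/-- A product is computed by nested loops, the innermost of which moves one symbol. A factor must
not repeat, because its symbols are split between two stacks while its loop is active, and `s` must
not be a factor because it is being consumed. If `s` runs out of symbols, the remaining rounds do
nothing, in agreement with `List.take` and `List.drop`. -/
theorem Run.skipMono (s : V) (m : List V) (S : Idx V → List G) (o : List O) (f : Bool × Bool)
    (hm : m.Nodup) (hs : s ∉ m) (ht : ∀ v ∈ m, S (.tmp v) = [])
    (hb : ∀ v ∈ m, ((S (.val v)).length : ℕ∞) ≤ b)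
    (hb' : ((S (.val s)).length + (S .acc).length : ℕ) ≤ b) :
    Run b ⊤ (Cmd.skipMono s m) ⟨(none, f), S, o⟩
      ⟨(none, f), advance S s ((m.map fun v => (S (.val v)).length).prod), o⟩ := by
  induction m generalizing S with
  | nil =>
    cases hl : S (.val s) with
    | nil =>
      have h1 := Run.popEq (b := b) (O := O) (r := none) (f := f) (o := o) hl
      have h2 := Run.skip (b := b) (⟨(none, f), Function.update S (.val s) [], o⟩ :
        Store (Idx V) G O) le_rfl
      have h3 := Run.iteFalse (c := .push .acc fun r => r.1.getD default)
        (p := fun r : Reg G => r.1.isSome) rfl h2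
      have h4 := Run.load (b := b) (f := fun r : Reg G => (none, r.2))
        (s := (⟨(none, f), Function.update S (.val s) [], o⟩ : Store (Idx V) G O))
      refine Run.mono (n := ⊤) ?_ le_top (m := 1 + (1 + 1 + 1))
      rw [Cmd.skipMono]
      convert h1.seq (h3.seq h4) using 2
      funext k
      cases k with
      | val v => by_cases h : v = s <;> simp [advance, hl, h]
      | tmp v => simp [advance]
      | acc => simp [advance, hl]
    | cons g l =>
      have h1 := Run.popEq (b := b) (O := O) (r := none) (f := f) (o := o) hl
      have h2 := Run.push (b := b) (i := .acc) (f := fun r : Reg G => r.1.getD default)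
        (s := (⟨(some g, f), Function.update S (.val s) l, o⟩ : Store (Idx V) G O)) (by
          refine le_trans ?_ hb'
          simp [hl]
          norm_cast
          omega)
      have h3 := Run.iteTrue (d := Cmd.skip) (p := fun r : Reg G => r.1.isSome) rfl h2
      have h4 := Run.load (b := b) (f := fun r : Reg G => (none, r.2))
        (s := (⟨(some g, f), Function.update (Function.update S (.val s) l) .acc (g :: S .acc), o⟩ :
          Store (Idx V) G O))
      refine Run.mono (n := ⊤) ?_ le_top (m := 1 + (1 + 1 + 1))
      rw [Cmd.skipMono]
      convert h1.seq (h3.seq h4) using 2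
      funext k
      cases k with
      | val v => by_cases h : v = s <;> simp [advance, hl, h]
      | tmp v => simp [advance]
      | acc =>
        simp [advance, hl]
        rfl
  | cons v m ih =>
    rw [List.nodup_cons] at hm
    have hsv : s ≠ v := fun h => hs (by simp [h])
    have hsm : s ∉ m := fun h => hs (by simp [h])
    set p := (m.map fun v => (S (.val v)).length).prod with hp
    have := Run.forEach (b := b) (n := ⊤) (c := Cmd.skipMono s m) (v := v) (l := S (.val v))
      (fun k => advance S s (k * p)) (fun _ => o) none f (hb v (by simp))
      (by intro k _; simp [advance, hsv.symm])
      (by intro k _; simp [advance, ht v (by simp)])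
      (by
        intro k hk l₁ l₂ hl
        have h := ih (setVar (advance S s (k * p)) v l₁ l₂) hm.2 hsm ?_ ?_ ?_
        · convert h using 2
          rw [advance_setVar _ hsv, advance_advance]
          congr 2
          rw [Nat.succ_mul, hp]
          congr 2
          apply List.map_congr_left
          intro w hw
          have h1 : w ≠ v := fun h => hm.1 (h ▸ hw)
          have h2 : w ≠ s := fun h => hsm (h ▸ hw)
          simp [setVar, advance, h1, h2]
        · intro w hw
          have h1 : w ≠ v := fun h => hm.1 (h ▸ hw)
          simp [setVar, advance, h1, ht w (by simp [hw])]
        · intro w hw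
          have h1 : w ≠ v := fun h => hm.1 (h ▸ hw)
          have h2 : w ≠ s := fun h => hsm (h ▸ hw)
          simpa [setVar, advance, h1, h2] using hb w (by simp [hw])
        · refine le_trans ?_ hb'
          simp [setVar, advance, hsv]
          norm_cast
          omega)
    simp only [zero_mul, advance_zero] at this
    exact this.mono le_top

theorem Run.skipTerm (s : V) (T : List (List V)) (S : Idx V → List G) (o : List O)
    (f : Bool × Bool) (hT : ∀ m ∈ T, m.Nodup ∧ s ∉ m) (ht : ∀ v, S (.tmp v) = [])
    (hb : ∀ v, ((S (.val v)).length : ℕ∞) ≤ b)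
    (hb' : ((S (.val s)).length + (S .acc).length : ℕ) ≤ b) :
    Run b ⊤ (Cmd.skipTerm s T) ⟨(none, f), S, o⟩
      ⟨(none, f), advance S s (Fm.termVal (fun v => S (.val v)) T), o⟩ := by
  induction T generalizing S with
  | nil =>
    simp only [Fm.termVal, List.map_nil, List.sum_nil, advance_zero]
    exact Run.skip _ le_top
  | cons m T ih =>
    have h1 := Run.skipMono s m S o f (hT m (by simp)).1 (hT m (by simp)).2 (fun v _ => ht v)
      (fun v _ => hb v) hb'
    set p := (m.map fun v => (S (.val v)).length).prod with hp
    have h2 := ih (advance S s p) (fun m' hm => hT m' (by simp [hm])) (by simp [advance, ht])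
      (by
        intro v
        refine le_trans ?_ (hb v)
        by_cases h : v = s
        · subst h
          simp [advance]
        · simp [advance, h])
      (by
        refine le_trans ?_ hb'
        simp [advance]
        norm_cast
        omega)
    refine (h1.seq ?_).mono le_top (m := ⊤ + ⊤)
    convert h2 using 2
    rw [advance_advance]
    congr 1
    simp only [Fm.termVal, List.map_cons, List.sum_cons, Fm.monoVal, ← hp]
    congr 2
    apply List.map_congr_left
    intro m' hm'
    unfold Fm.monoVal
    congr 1
    apply List.map_congr_left
    intro w hw
    have : w ≠ s := fun h => (hT m' (by simp [hm'])).2 (h ▸ hw)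
    simp [advance, this]

end Skip

/-! ### Atomic formulas -/

section Eval

variable {V G O : Type} [DecidableEq V] {b : ℕ∞}

/-- The stacks at rest, given the values of the variables. -/
def rest (e : V → List G) : Idx V → List G
  | .val v => e v
  | .tmp _ => []
  | .acc => []

theorem update_rest (e : V → List G) (v : V) (l : List G) :
    Function.update (rest e) (.val v) l = rest (Function.update e v l) := by
  funext k
  cases k with
  | val w => by_cases h : w = v <;> simp [rest, h]
  | tmp w => simp [rest]
  | acc => simp [rest]

variable [DecidableEq G] [Inhabited G]

/-- Evaluate an atomic formula. -/
def getProg (s : V) (T : List (List V)) (o : Option G) : Cmd (Idx V) G O :=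
  .seq (skipTerm s T) (.seq (.pop (.val s)) (.seq (.load fun r => (r.1, decide (r.1 = o), false))
    (.seq (.ite (fun r => r.1.isSome) (.push (.val s) fun r => r.1.getD default) Cmd.skip)
      (move .acc (.val s)))))

/-- After the skipped symbols have gone to the accumulator, the next pop reads exactly the position
given by the term, and it fails when the position is out of range. Pushing the symbol back and
returning the accumulator restores `s`; the two reversals cancel. -/
theorem Run.getProg (s : V) (T : List (List V)) (o : Option G) (e : V → List G) (out : List O)
    (f : Bool × Bool) (hT : ∀ m ∈ T, m.Nodup ∧ s ∉ m) (hb : ∀ v, ((e v).length : ℕ∞) ≤ b) :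
    Run b ⊤ (Cmd.getProg s T o) ⟨(none, f), rest e, out⟩
      ⟨(none, decide ((e s)[Fm.termVal e T]? = o), false), rest e, out⟩ := by
  have h1 := Run.skipTerm (b := b) s T (rest e) out f hT (fun _ => rfl) hb (by simpa [rest] using hb s)
  set n := Fm.termVal (fun v => rest e (.val v)) T with hn
  have hn' : Fm.termVal e T = n := rfl
  rw [hn']
  have h2 := Run.popEq (b := b) (O := O) (r := none) (f := f) (o := out) (S := advance (rest e) s n)
    (i := .val s) (l := (e s).drop n) (by simp [advance, rest])
  rw [List.head?_drop] at h2
  set x := (e s)[n]? with hx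
  have h3 := Run.load (b := b) (f := fun r : Reg G => (r.1, decide (r.1 = o), false))
    (s := (⟨(x, f), Function.update (advance (rest e) s n) (.val s) ((e s).drop n).tail, out⟩ :
      Store (Idx V) G O))
  have h4 : Run b (1 + 1) (.ite (fun r => r.1.isSome) (.push (.val s) fun r => r.1.getD default) Cmd.skip)
      (⟨(x, decide (x = o), false),
        Function.update (advance (rest e) s n) (.val s) ((e s).drop n).tail, out⟩ :
        Store (Idx V) G O)
      ⟨(x, decide (x = o), false), advance (rest e) s n, out⟩ := by
    cases hxx : x with
    | none =>
      have hnil : (e s).drop n = [] := by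
        rw [hx, List.getElem?_eq_none_iff] at hxx
        exact List.drop_eq_nil_of_le hxx
      have := Run.skip (b := b) (⟨(x, decide (x = o), false), advance (rest e) s n, out⟩ :
        Store (Idx V) G O) le_rfl
      have h := Run.iteFalse (c := .push (.val s) fun r => r.1.getD default)
        (p := fun r : Reg G => r.1.isSome) (by simp [hxx]) this
      rw [hxx] at h
      convert h using 2
      rw [hnil, List.tail_nil]
      funext k
      by_cases hk : k = .val s
      · subst hk; simp [advance, rest, hnil]
      · simp [hk]
    | some g =>
      have hcons : (e s).drop n = g :: ((e s).drop n).tail := by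
        rw [hx] at hxx
        have : ((e s).drop n).head? = some g := by rw [List.head?_drop, hxx]
        cases hd : (e s).drop n with
        | nil => simp [hd] at this
        | cons a t => simp [hd] at this; simp [this]
      have := Run.push (b := b) (i := .val s) (f := fun r : Reg G => r.1.getD default)
        (s := (⟨(some g, decide (some g = o), false),
          Function.update (advance (rest e) s n) (.val s) ((e s).drop n).tail, out⟩ :
          Store (Idx V) G O)) (by
          refine le_trans ?_ (hb s)
          have := congrArg List.length hcons
          simp only [List.length_drop, List.length_cons, List.length_tail] at this
          simp
          norm_cast
          omega)
      have h := Run.iteTrue (d := Cmd.skip) (p := fun r : Reg G => r.1.isSome) rfl this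
      convert h using 2
      funext k
      by_cases hk : k = .val s
      · subst hk
        simp only [advance, rest, Function.update_self, ne_eq, reduceCtorEq, not_false_eq_true,
          Function.update_of_ne, Option.getD_some]
        exact hcons
      · simp [hk]
  have h5 := Run.move (b := b) (i := Idx.acc) (j := .val s) (by simp) x
    (decide (x = o), false) (advance (rest e) s n) out (by
      refine le_trans ?_ (hb s)
      simp [advance, rest]
      norm_cast
      omega)
  refine (h1.seq (h2.seq (h3.seq (h4.seq ?_)))).mono le_top
    (n := ⊤) (m := ⊤ + (1 + (1 + (1 + 1 + (((advance (rest e) s n .acc).length : ℕ∞) * 3 + 2)))))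
  convert h5 using 2
  funext k
  cases k with
  | val w =>
    by_cases h : w = s
    · subst h; simp [advance, rest]
    · simp [advance, rest, h]
  | tmp w => simp [advance, rest]
  | acc => simp [advance, rest]

end Eval

end Cmd


/-! ### Enumeration of strings in place -/

namespace Cmd

section Enumerate

variable {V G O : Type} [DecidableEq V] {b : ℕ∞}

/-- The stacks in the search for the next string. -/
def searchStk (e : V → List G) (v : V) (l l' : List G) : Idx V → List G :=
  Function.update (Function.update (rest e) (.val v) l) .acc l'

theorem searchStk_nil (e : V → List G) (v : V) (l : List G) :
    searchStk e v l [] = rest (Function.update e v l) := by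
  rw [← update_rest]
  funext k
  cases k <;> simp [searchStk, rest]

variable [Inhabited G]

/-- Fill the empty variable `v` with as many copies of `g` as `w` has symbols. -/
def fill (v w : V) (g : G) : Cmd (Idx V) G O := forEach w (.push (.val v) fun _ => g)

theorem Run.fill (e : V → List G) {v w : V} (hvw : v ≠ w) (g : G) (o : List O) (f : Bool × Bool)
    (hv : e v = []) (hb : ((e w).length : ℕ∞) ≤ b) :
    Run b ⊤ (Cmd.fill v w g) ⟨(none, f), rest e, o⟩
      ⟨(none, f), rest (Function.update e v (List.replicate (e w).length g)), o⟩ := by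
  have := Run.forEach (b := b) (n := 1) (c := .push (.val v) fun _ => g) (v := w) (l := e w)
    (fun k => rest (Function.update e v (List.replicate k g))) (fun _ => o) none f hb
    (by intro k _; simp [rest, hvw.symm]) (by intro k _; simp [rest])
    (by
      intro k hk l₁ l₂ _
      have h := Run.push (b := b) (i := .val v) (f := fun _ : Reg G => g)
        (s := (⟨(none, f), setVar (rest (Function.update e v (List.replicate k g))) w l₁ l₂, o⟩ :
          Store (Idx V) G O)) (by
          refine le_trans ?_ hb
          simp [setVar, hvw, rest]
          norm_cast)
      convert h using 2
      funext i
      cases i with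
      | val u =>
        by_cases h1 : u = v
        · subst h1; simp [setVar, hvw, rest, List.replicate_succ]
        · by_cases h2 : u = w
          · subst h2; simp [setVar, h1]
          · simp [setVar, h1, h2, rest]
      | tmp u => simp [setVar, rest, Function.update_apply]
      | acc => simp [setVar, rest])
  have h0 : Function.update e v (List.replicate 0 g) = e := by
    rw [List.replicate_zero, ← hv, Function.update_eq_self]
  simp only [h0] at this
  exact this.mono le_top

variable [Fintype G]

/-- The search for the first symbol of `v` that can be increased. -/
noncomputable def nextLoop (v : V) : Cmd (Idx V) G O :=
  .loop (fun r => r.2.2) (.seq (.pop (.val v))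
    (.ite (fun r => r.1.isSome)
      (.ite (fun r => (r.1.bind nextSym).isSome)
        (.seq (.push (.val v) fun r => (r.1.bind nextSym).getD default)
          (.load fun _ => (none, true, false)))
        (.seq (.push .acc fun _ => zeroSym G) (.load fun _ => (none, false, true))))
      (.load fun _ => (none, false, false))))

/-- Replace `v` by the next string and set the second flag; if there is none, empty `v`. -/
noncomputable def nextProg (v : V) : Cmd (Idx V) G O :=
  .seq (.load fun _ => (none, false, true)) (.seq (nextLoop v)
    (.ite (fun r => r.2.1)
      (.seq (move .acc (.val v)) (.load fun _ => (none, false, true)))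
      (.seq (clear .acc) (.load fun _ => (none, false, false)))))

/-- The `k` digits that have overflowed are kept on the accumulator as zero symbols. They are all
equal, so the reversal on moving them back is harmless. -/
theorem Run.nextLoop (e : V → List G) (v : V) (l : List G) (k : ℕ) (o : List O)
    (hb : (l.length + k : ℕ) ≤ b) :
    (nextStr l = none ∧ Run b ⊤ (Cmd.nextLoop v)
        ⟨(none, false, true), searchStk e v l (List.replicate k (zeroSym G)), o⟩
        ⟨(none, false, false), searchStk e v [] (List.replicate (k + l.length) (zeroSym G)), o⟩) ∨
    ∃ j l', nextStr l = some (List.replicate j (zeroSym G) ++ l') ∧ Run b ⊤ (Cmd.nextLoop v)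
        ⟨(none, false, true), searchStk e v l (List.replicate k (zeroSym G)), o⟩
        ⟨(none, true, false), searchStk e v l' (List.replicate (k + j) (zeroSym G)), o⟩ := by
  induction l generalizing k with
  | nil =>
    left
    refine ⟨rfl, ?_⟩
    have h1 := Run.popEq (b := b) (O := O) (r := none) (f := (false, true)) (o := o)
      (S := searchStk e v [] (List.replicate k (zeroSym G))) (i := .val v) (l := [])
      (by simp [searchStk])
    have h0 : Function.update (searchStk e v [] (List.replicate k (zeroSym G))) (.val v) [] =
        searchStk e v [] (List.replicate k (zeroSym G)) := by
      funext i
      by_cases hi : i = .val v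
      · subst hi; simp [searchStk]
      · simp [hi]
    rw [List.tail_nil, h0] at h1
    have h2 := Run.load (b := b) (f := fun _ : Reg G => (none, false, false))
      (s := (⟨(none, false, true), searchStk e v [] (List.replicate k (zeroSym G)), o⟩ :
        Store (Idx V) G O))
    exact (Run.loopStep rfl (h1.seq (Run.iteFalse rfl h2)) (Run.loopStop rfl)).mono le_top
  | cons g l ih =>
    have h1 := Run.popEq (b := b) (O := O) (r := none) (f := (false, true)) (o := o)
      (S := searchStk e v (g :: l) (List.replicate k (zeroSym G))) (i := .val v) (l := g :: l)
      (by simp [searchStk])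
    have h0 : Function.update (searchStk e v (g :: l) (List.replicate k (zeroSym G))) (.val v) l =
        searchStk e v l (List.replicate k (zeroSym G)) := by
      funext i
      by_cases hi : i = .val v
      · subst hi; simp [searchStk]
      · simp [searchStk, Function.update_apply, hi]
    rw [List.tail_cons, h0] at h1
    rw [List.length_cons] at hb
    cases hg : nextSym g with
    | some g' =>
      right
      refine ⟨0, g' :: l, by simp [nextStr, hg], ?_⟩
      have h2 := Run.push (b := b) (i := .val v) (f := fun r : Reg G => (r.1.bind nextSym).getD default)
        (s := (⟨(some g, false, true), searchStk e v l (List.replicate k (zeroSym G)), o⟩ :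
          Store (Idx V) G O)) (by
          refine le_trans ?_ hb
          simp [searchStk])
      have h3 := Run.load (b := b) (f := fun _ : Reg G => (none, true, false))
        (s := (⟨(some g, false, true), searchStk e v (g' :: l) (List.replicate k (zeroSym G)), o⟩ :
          Store (Idx V) G O))
      have h4 : Function.update (searchStk e v l (List.replicate k (zeroSym G))) (.val v) (g' :: l) =
          searchStk e v (g' :: l) (List.replicate k (zeroSym G)) := by
        funext i
        by_cases hi : i = .val v
        · subst hi; simp [searchStk]
        · simp [searchStk, Function.update_apply, hi]
      have h5 : searchStk e v l (List.replicate k (zeroSym G)) (.val v) = l := by simp [searchStk]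
      simp only [Option.bind_some, hg, Option.getD_some, h5, h4] at h2
      refine (Run.loopStep rfl (h1.seq (Run.iteTrue rfl (Run.iteTrue ?_ (h2.seq h3))))
        (Run.loopStop rfl)).mono le_top
      simp [hg]
    | none =>
      have h2 := Run.push (b := b) (i := .acc) (f := fun _ : Reg G => zeroSym G)
        (s := (⟨(some g, false, true), searchStk e v l (List.replicate k (zeroSym G)), o⟩ :
          Store (Idx V) G O)) (by
          refine le_trans ?_ hb
          simp [searchStk]
          norm_cast
          omega)
      have h3 := Run.load (b := b) (f := fun _ : Reg G => (none, false, true))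
        (s := (⟨(some g, false, true), searchStk e v l (List.replicate (k + 1) (zeroSym G)), o⟩ :
          Store (Idx V) G O))
      have h4 : Function.update (searchStk e v l (List.replicate k (zeroSym G))) .acc
          (zeroSym G :: List.replicate k (zeroSym G)) =
          searchStk e v l (List.replicate (k + 1) (zeroSym G)) := by
        simp [searchStk, List.replicate_succ]
      have h5 : searchStk e v l (List.replicate k (zeroSym G)) .acc =
          List.replicate k (zeroSym G) := by simp [searchStk]
      simp only [h5, h4] at h2
      have hstep := h1.seq (Run.iteTrue (d := .load fun _ => (none, false, false))
        (p := fun r : Reg G => r.1.isSome) rfl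
        (Run.iteFalse (p := fun r : Reg G => (r.1.bind nextSym).isSome)
          (c := (.seq (.push (.val v) fun r => (r.1.bind nextSym).getD default)
          (.load fun _ => (none, true, false)))) (by simp [hg]) (h2.seq h3)))
      rcases ih (k + 1) (by rw [show l.length + (k + 1) = l.length + 1 + k by omega]; exact hb) with
        ⟨h6, h7⟩ | ⟨j, l', h6, h7⟩
      · left
        refine ⟨by simp [nextStr, hg, h6], ?_⟩
        rw [List.length_cons, show k + (l.length + 1) = k + 1 + l.length by omega]
        exact (Run.loopStep rfl hstep h7).mono le_top
      · right
        refine ⟨j + 1, l', by simp [nextStr, hg, h6, List.replicate_succ], ?_⟩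
        rw [show k + (j + 1) = k + 1 + j by omega]
        exact (Run.loopStep rfl hstep h7).mono le_top

theorem Run.nextProg (e : V → List G) (v : V) (l : List G) (o : List O) (r : Reg G)
    (hb : (l.length : ℕ∞) ≤ b) :
    Run b ⊤ (Cmd.nextProg v) ⟨r, rest (Function.update e v l), o⟩
      ⟨(none, false, (nextStr l).isSome),
        rest (Function.update e v ((nextStr l).getD [])), o⟩ := by
  have h0 := Run.load (b := b) (f := fun _ : Reg G => (none, false, true))
    (s := (⟨r, rest (Function.update e v l), o⟩ : Store (Idx V) G O))
  rcases Run.nextLoop (b := b) e v l 0 o (by simpa using hb) with ⟨h1, h2⟩ | ⟨j, l', h1, h2⟩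
  · rw [List.replicate_zero, searchStk_nil] at h2
    have h3 := Run.clear (b := b) (i := .acc) none (false, false)
      (searchStk e v [] (List.replicate (0 + l.length) (zeroSym G))) o
    have h4 : Function.update (searchStk e v [] (List.replicate (0 + l.length) (zeroSym G))) .acc [] =
        rest (Function.update e v []) := by
      rw [← searchStk_nil]
      simp [searchStk]
    rw [h4] at h3
    have h5 := Run.load (b := b) (f := fun _ : Reg G => (none, false, false))
      (s := (⟨(none, false, false), rest (Function.update e v []), o⟩ : Store (Idx V) G O))
    rw [h1]
    exact (h0.seq (h2.seq (Run.iteFalse rfl (h3.seq h5)))).mono le_top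
  · rw [List.replicate_zero, searchStk_nil] at h2
    have hlen := (nextStr_some h1).1
    have h3 := Run.move (b := b) (i := Idx.acc) (j := .val v) (by simp) none (true, false)
      (searchStk e v l' (List.replicate (0 + j) (zeroSym G))) o (by
        refine le_trans ?_ hb
        simp at hlen
        simp [searchStk]
        norm_cast
        omega)
    have h4 : Function.update (Function.update
        (searchStk e v l' (List.replicate (0 + j) (zeroSym G))) .acc []) (.val v)
        ((searchStk e v l' (List.replicate (0 + j) (zeroSym G)) .acc).reverse ++
          searchStk e v l' (List.replicate (0 + j) (zeroSym G)) (.val v)) =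
        rest (Function.update e v (List.replicate j (zeroSym G) ++ l')) := by
      rw [← searchStk_nil]
      funext k
      cases k with
      | val w => by_cases h : w = v <;> simp [searchStk, h]
      | tmp w => simp [searchStk]
      | acc => simp [searchStk]
    rw [h4] at h3
    have h5 := Run.load (b := b) (f := fun _ : Reg G => (none, false, true))
      (s := (⟨(none, true, false), rest (Function.update e v (List.replicate j (zeroSym G) ++ l')), o⟩ :
        Store (Idx V) G O))
    rw [h1]
    exact (h0.seq (h2.seq (Run.iteTrue rfl (h3.seq h5)))).mono le_top

/-- One round of an exhaustive search: either the current string is a witness, or the search goes on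
from its successor. Both the evaluation of `exS` and the enumeration of queries unfold by this
equivalence. -/
theorem exists_le_strVal {L : ℕ} {P : List G → Prop} {l : List G} (hl : l.length = L) :
    (∃ l' : List G, l'.length = L ∧ strVal l ≤ strVal l' ∧ P l') ↔
      P l ∨ ∃ l', nextStr l = some l' ∧
        ∃ l'' : List G, l''.length = L ∧ strVal l' ≤ strVal l'' ∧ P l'' := by
  constructor
  · rintro ⟨l', h1, h2, h3⟩
    by_cases h : strVal l = strVal l'
    · left
      rwa [strVal_injective (hl.trans h1.symm) h]
    · right
      cases hn : nextStr l with
      | none =>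
        have := nextStr_none hn
        have h4 := strVal_lt l'
        rw [h1] at h4
        rw [hl] at this
        omega
      | some l₂ =>
        have := (nextStr_some hn).2
        exact ⟨l₂, rfl, l', h1, by omega, h3⟩
  · rintro (h | ⟨l', h1, l'', h2, h3, h4⟩)
    · exact ⟨l, hl, le_rfl, h⟩
    · have := (nextStr_some h1).2
      exact ⟨l'', h2, by omega, h4⟩

end Enumerate

/-! ### Correctness of the evaluator -/

section Eval

variable {V G O : Type} [DecidableEq V] [Fintype G] [DecidableEq G] [Inhabited G] {b : ℕ∞}

/-- The program that evaluates a formula and stores the value in the first flag. -/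
noncomputable def evalProg : Fm V G → Cmd (Idx V) G O
  | .get s T o => getProg s T o
  | .not φ => .seq (evalProg φ) (.load fun r => (none, !r.2.1, false))
  | .and φ ψ => .seq (evalProg φ) (.ite (fun r => r.2.1) (evalProg ψ) Cmd.skip)
  | .exU v w φ => .seq (fill v w default) (.seq (.pop (.val v))
      (.seq (.load fun r => (none, false, r.1.isSome)) (.loop (fun r => r.2.2) (.seq (evalProg φ)
        (.ite (fun r => r.2.1) (clear (.val v))
          (.seq (.pop (.val v)) (.load fun r => (none, false, r.1.isSome))))))))
  | .exS v w φ => .seq (fill v w (zeroSym G))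
      (.seq (.load fun _ => (none, false, true)) (.loop (fun r => r.2.2) (.seq (evalProg φ)
        (.ite (fun r => r.2.1) (clear (.val v)) (nextProg v)))))

/-- Bound variables are empty before and after the evaluation, so every subformula finds its stacks
at rest. A quantified string is never longer than the variable that bounds it; the heights hence
stay below the `b` that bounds the given values, however deep the quantifiers are nested. -/
theorem Run.evalProg (φ : Fm V G) (hφ : φ.Ok = true) (e : V → List G) (o : List O)
    (f : Bool × Bool) (he : ∀ v ∈ φ.bound, e v = []) (hb : ∀ v, ((e v).length : ℕ∞) ≤ b) :
    ∃ t : Bool, (t = true ↔ φ.Sat e) ∧ Run b ⊤ (Cmd.evalProg φ) ⟨(none, f), rest e, o⟩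
      ⟨(none, t, false), rest e, o⟩ := by
  induction φ generalizing e f with
  | get s T x =>
    have := Run.getProg (b := b) s T x e o f (by simpa [Fm.Ok] using hφ) hb
    exact ⟨_, by simp [Fm.Sat], this⟩
  | not φ ih =>
    obtain ⟨t, ht, h1⟩ := ih hφ e f he hb
    have h2 := Run.load (b := b) (f := fun r : Reg G => (none, !r.2.1, false))
      (s := (⟨(none, t, false), rest e, o⟩ : Store (Idx V) G O))
    exact ⟨!t, by simp [Fm.Sat, ← ht], (h1.seq h2).mono le_top⟩
  | and φ ψ ih ih' =>
    simp only [Fm.Ok, Bool.and_eq_true] at hφ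
    obtain ⟨t, ht, h1⟩ := ih hφ.1 e f (fun v hv => he v (by simp [Fm.bound, hv])) hb
    obtain ⟨t', ht', h2⟩ :=
      ih' hφ.2 e (true, false) (fun v hv => he v (by simp [Fm.bound, hv])) hb
    cases t with
    | true => exact ⟨t', by simp [Fm.Sat, ← ht, ht'], (h1.seq (Run.iteTrue rfl h2)).mono le_top⟩
    | false => exact ⟨false, by simp [Fm.Sat, ← ht],
        (h1.seq (Run.iteFalse rfl (Run.skip _ le_rfl))).mono le_top⟩
  | exU v w φ ih =>
    simp only [Fm.Ok, Bool.and_eq_true, decide_eq_true_eq] at hφ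
    obtain ⟨⟨hv, hvw⟩, hφ⟩ := hφ
    have hev : e v = [] := he v (by simp [Fm.bound])
    have hnil : Function.update e v [] = e := by rw [← hev, Function.update_eq_self]
    have hbody : ∀ i, i < (e w).length → ∃ t : Bool,
        (t = true ↔ φ.Sat (Function.update e v (List.replicate i default))) ∧
        Run b ⊤ (Cmd.evalProg φ)
          ⟨(none, false, true), rest (Function.update e v (List.replicate i default)), o⟩
          ⟨(none, t, false), rest (Function.update e v (List.replicate i default)), o⟩ := by
      intro i hi
      refine ih hφ _ _ ?_ ?_
      · intro u hu
        have : u ≠ v := fun h => hv (h ▸ hu)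
        simpa [this] using he u (by simp [Fm.bound, hu])
      · intro u
        by_cases h : u = v
        · subst h
          refine le_trans ?_ (hb w)
          simpa using hi.le
        · simpa [h] using hb u
    have hclear : ∀ i, Run b ⊤ (Cmd.clear (.val v))
        ⟨(none, true, false), rest (Function.update e v (List.replicate i default)), o⟩
        ⟨(none, true, false), rest e, o⟩ := by
      intro i
      have := Run.clear (b := b) (i := .val v) none (true, false)
        (rest (Function.update e v (List.replicate i default))) o
      rw [update_rest, Function.update_idem, hnil] at this
      exact this.mono le_top
    have hload : ∀ (x : Option G) (y : Bool × Bool) (e' : V → List G),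
        Run b 1 (.load fun r => (none, false, r.1.isSome)) (⟨(x, y), rest e', o⟩ :
          Store (Idx V) G O) ⟨(none, false, x.isSome), rest e', o⟩ :=
      fun x y e' => Run.load
    have hpop : ∀ (i : ℕ) (y : Bool × Bool), Run b 1 (.pop (.val v))
        (⟨(none, y), rest (Function.update e v (List.replicate i default)), o⟩ : Store (Idx V) G O)
        ⟨((List.replicate i default).head?, y),
          rest (Function.update e v (List.replicate (i - 1) default)), o⟩ := by
      intro i y
      have := Run.popEq (b := b) (O := O) (r := none) (f := y) (o := o) (i := .val v)
        (S := rest (Function.update e v (List.replicate i default)))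
        (l := List.replicate i default) (by simp [rest])
      rwa [update_rest, Function.update_idem, List.tail_replicate] at this
    -- The search goes downwards: popping a symbol replaces the unary value `i` by `i - 1`.
    have key : ∀ i, i < (e w).length → ∃ t : Bool,
        (t = true ↔ ∃ j ≤ i, φ.Sat (Function.update e v (List.replicate j default))) ∧
        Run b ⊤ (.loop (fun r => r.2.2) (.seq (Cmd.evalProg φ)
        (.ite (fun r => r.2.1) (Cmd.clear (.val v))
          (.seq (.pop (.val v)) (.load fun r => (none, false, r.1.isSome))))))
        ⟨(none, false, true), rest (Function.update e v (List.replicate i default)), o⟩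
        ⟨(none, t, false), rest e, o⟩ := by
      intro i
      induction i with
      | zero =>
        intro hi
        obtain ⟨t, ht, h1⟩ := hbody 0 hi
        refine ⟨t, by simpa using ht, ?_⟩
        cases t with
        | true =>
          exact (Run.loopStep rfl (h1.seq (Run.iteTrue rfl (hclear 0)))
            (Run.loopStop rfl)).mono le_top
        | false =>
          have h2 := (hpop 0 (false, false)).seq (hload none (false, false) _)
          simp only [Nat.zero_sub, List.replicate_zero, hnil] at h1 h2
          rw [List.replicate_zero, hnil]
          exact (Run.loopStep rfl (h1.seq (Run.iteFalse rfl h2)) (Run.loopStop rfl)).mono le_top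
      | succ i ihi =>
        intro hi
        obtain ⟨t, ht, h1⟩ := hbody (i + 1) hi
        cases t with
        | true =>
          refine ⟨true, ?_, ?_⟩
          · simp only [true_iff]
            exact ⟨i + 1, le_rfl, ht.1 rfl⟩
          · exact (Run.loopStep rfl (h1.seq (Run.iteTrue rfl (hclear _)))
              (Run.loopStop rfl)).mono le_top
        | false =>
          obtain ⟨t, ht', h3⟩ := ihi (by omega)
          refine ⟨t, ?_, ?_⟩
          · rw [ht']
            constructor
            · rintro ⟨j, hj, h⟩
              exact ⟨j, by omega, h⟩
            · rintro ⟨j, hj, h⟩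
              refine ⟨j, ?_, h⟩
              by_contra hc
              have : j = i + 1 := by omega
              subst this
              exact absurd (ht.2 h) (by simp)
          · have h2 := (hpop (i + 1) (false, false)).seq (hload _ (false, false) _)
            exact (Run.loopStep rfl (h1.seq (Run.iteFalse rfl h2)) h3).mono le_top
    -- The variable is filled up to the length of `w`, and the first pop leaves the largest
    -- admissible value, one less. If `w` is empty, this pop fails and the loop is not entered.
    have hfill := Run.fill (b := b) e hvw default o f hev (hb w)
    have h2 := (hpop (e w).length f).seq (hload _ f _)
    cases hn : (e w).length with
    | zero =>
      refine ⟨false, by simp [Fm.Sat, hn], ?_⟩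
      rw [hn] at hfill h2
      have hexit := Run.loopStop (b := b) (c := (.seq (Cmd.evalProg φ)
        (.ite (fun r => r.2.1) (Cmd.clear (.val v))
          (.seq (.pop (.val v)) (.load fun r => (none, false, r.1.isSome))))))
          (p := fun r : Reg G => r.2.2) (s := (⟨(none, false, false), rest e, o⟩ :
          Store (Idx V) G O)) rfl
      simp only [Nat.zero_sub, List.replicate_zero, hnil] at hfill h2
      have h3 := hload none f e
      have h4 := hpop 0 f
      simp only [Nat.zero_sub, List.replicate_zero, hnil] at h4
      exact (hfill.seq (h4.seq (h3.seq hexit))).mono le_top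
    | succ n =>
      obtain ⟨t, ht, h3⟩ := key n (by omega)
      refine ⟨t, ?_, ?_⟩
      · rw [ht]
        simp only [Fm.Sat, hn, Nat.lt_succ_iff]
      · rw [hn] at hfill
        have h4 := hpop (n + 1) f
        exact (hfill.seq (h4.seq ((hload _ f _).seq h3))).mono le_top
  | exS v w φ ih =>
    simp only [Fm.Ok, Bool.and_eq_true, decide_eq_true_eq] at hφ
    obtain ⟨⟨hv, hvw⟩, hφ⟩ := hφ
    have hev : e v = [] := he v (by simp [Fm.bound])
    have hnil : Function.update e v [] = e := by rw [← hev, Function.update_eq_self]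
    -- Induction on a bound for the number of strings from `l` onwards.
    have key : ∀ (n : ℕ) (l : List G), l.length = (e w).length →
        Fintype.card G ^ (e w).length - strVal l ≤ n → ∃ t : Bool,
        (t = true ↔ ∃ l' : List G, l'.length = (e w).length ∧ strVal l ≤ strVal l' ∧
          φ.Sat (Function.update e v l')) ∧
        Run b ⊤ (.loop (fun r => r.2.2) (.seq (Cmd.evalProg φ)
        (.ite (fun r => r.2.1) (Cmd.clear (.val v)) (Cmd.nextProg v))))
        ⟨(none, false, true), rest (Function.update e v l), o⟩
        ⟨(none, t, false), rest e, o⟩ := by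
      intro n
      induction n with
      | zero =>
        intro l hl hn
        have := strVal_lt l
        rw [hl] at this
        omega
      | succ n ihn =>
        intro l hl hn
        have hlb : (l.length : ℕ∞) ≤ b := by rw [hl]; exact hb w
        obtain ⟨t, ht, h1⟩ := ih hφ (Function.update e v l) (false, true) (by
          intro u hu
          have : u ≠ v := fun h => hv (h ▸ hu)
          simpa [this] using he u (by simp [Fm.bound, hu])) (by
          intro u
          by_cases h : u = v
          · subst h; simpa using hlb
          · simpa [h] using hb u)
        rw [exists_le_strVal hl]
        cases t with
        | true =>
          refine ⟨true, by simp [ht.1 rfl], ?_⟩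
          have h2 := Run.clear (b := b) (i := .val v) none (true, false)
            (rest (Function.update e v l)) o
          rw [update_rest, Function.update_idem, hnil] at h2
          exact (Run.loopStep rfl (h1.seq (Run.iteTrue rfl h2)) (Run.loopStop rfl)).mono le_top
        | false =>
          have hns : ¬ φ.Sat (Function.update e v l) := fun h => absurd (ht.2 h) (by simp)
          have h2 := Run.nextProg (b := b) e v l o (none, false, false) hlb
          cases hnext : nextStr l with
          | none =>
            refine ⟨false, by simp [hns], ?_⟩
            rw [hnext, Option.getD_none, hnil] at h2
            exact (Run.loopStep rfl (h1.seq (Run.iteFalse rfl h2)) (Run.loopStop rfl)).mono le_top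
          | some l' =>
            obtain ⟨h3, h4⟩ := nextStr_some hnext
            obtain ⟨t, ht', h5⟩ := ihn l' (h3.trans hl) (by omega)
            refine ⟨t, by rw [ht']; simp [hns], ?_⟩
            rw [hnext, Option.getD_some] at h2
            exact (Run.loopStep rfl (h1.seq (Run.iteFalse rfl h2)) h5).mono le_top
    have hfill := Run.fill (b := b) e hvw (zeroSym G) o f hev (hb w)
    have hload := Run.load (b := b) (f := fun _ : Reg G => (none, false, true))
      (s := (⟨(none, f), rest (Function.update e v (List.replicate (e w).length (zeroSym G))), o⟩ :
        Store (Idx V) G O))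
    obtain ⟨t, ht, h⟩ := key _ (List.replicate (e w).length (zeroSym G)) (by simp) le_rfl
    refine ⟨t, ?_, (hfill.seq (hload.seq h)).mono le_top⟩
    rw [ht]
    simp [strVal_replicate_zeroSym, Fm.Sat]

end Eval

end Cmd


/-! ### Writing the queries -/

namespace Cmd

section Output

variable {V G : Type} [DecidableEq V] {b : ℕ∞}

/-- Output a fixed word. -/
def pushWord : List Bool → Cmd (Idx V) G (Option Bool)
  | [] => .pushOut fun _ => none
  | x :: w => .seq (pushWord w) (.pushOut fun _ => some x)

/-- The output is a stack that grows at its head, so the terminator comes first and the letters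
follow from the last to the first. -/
theorem Run.pushWord (w : List Bool) (r : Reg G) (S : Idx V → List G) (o : List (Option Bool)) :
    Run b ⊤ (Cmd.pushWord w) ⟨r, S, o⟩ ⟨r, S, w.map some ++ none :: o⟩ := by
  induction w with
  | nil => exact Run.pushOut.mono le_top
  | cons x w ih => exact (ih.seq Run.pushOut).mono le_top

variable [Inhabited G]

/-- Output the word that `dec` reads off the string `v`. -/
def emitWord (dec : G → Option Bool) (v : V) : Cmd (Idx V) G (Option Bool) :=
  .seq (.pushOut fun _ => none) (.seq (move (.val v) .acc) (drain .acc
    (.seq (.ite (fun r => (r.1.bind dec).isSome) (.pushOut fun r => r.1.bind dec) Cmd.skip)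
      (.push (.val v) fun r => r.1.getD default))))

/-- Moving `v` to the accumulator reverses it, so draining the accumulator visits the symbols from
the last to the first. This is the right order both for the output stack and for rebuilding `v`. -/
theorem Run.emitWord (dec : G → Option Bool) (e : V → List G) (v : V) (o : List (Option Bool))
    (f : Bool × Bool) (hb : ((e v).length : ℕ∞) ≤ b) :
    Run b ⊤ (Cmd.emitWord dec v) ⟨(none, f), rest e, o⟩
      ⟨(none, f), rest e, ((e v).filterMap dec).map some ++ none :: o⟩ := by
  have h1 := Run.pushOut (b := b) (f := fun _ => none)
    (s := (⟨(none, f), rest e, o⟩ : Store (Idx V) G (Option Bool)))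
  have h2 := Run.move (b := b) (i := Idx.val v) (j := .acc) (by simp) none f (rest e) (none :: o)
    (by simpa [rest] using hb)
  have h3 := Run.drain (b := b) (n := 3) (i := (.acc : Idx V))
    (c := (.seq (.ite (fun r => (r.1.bind dec).isSome) (.pushOut fun r => r.1.bind dec) Cmd.skip)
      (.push (.val v) fun r => r.1.getD default)))
    (fun l => Function.update (Function.update (rest e) (.val v) ((e v).drop l.length)) .acc l)
    (fun l => (((e v).drop l.length).filterMap dec).map some ++ none :: o) (fun _ => f)
    (e v).reverse (by intro l _; simp)
    (fun g l hl => by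
      refine ⟨some g, ?_⟩
      obtain ⟨p, hp⟩ := hl
      have he : e v = l.reverse ++ g :: p.reverse := by
        rw [← List.reverse_reverse (e v), ← hp]; simp
      have hd1 : (e v).drop l.length = g :: p.reverse := by rw [he]; simp
      have hd2 : (e v).drop (g :: l).length = p.reverse := by
        rw [he, List.length_cons, ← List.drop_drop]
        simp
      rw [hd1, hd2]
      set S := Function.update (Function.update (Function.update (rest e) (.val v) p.reverse) .acc
        (g :: l)) .acc l with hS
      have hSv : S (.val v) = p.reverse := by simp [hS]
      have h2 := fun o' => Run.push (b := b) (i := .val v) (f := fun r : Reg G => r.1.getD default)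
        (s := (⟨(some g, f), S, o'⟩ : Store (Idx V) G (Option Bool))) (by
          refine le_trans ?_ hb
          simp [hSv, he])
      simp only [hSv, Option.getD_some] at h2
      have h3 : Function.update S (.val v) (g :: p.reverse) = Function.update (Function.update (rest e)
          (.val v) (g :: p.reverse)) .acc l := by
        funext k
        cases k with
        | val u => by_cases h : u = v <;> simp [hS, h]
        | tmp u => simp [hS]
        | acc => simp [hS]
      rw [h3] at h2
      cases hg : dec g with
      | none =>
        have h1 := Run.iteFalse (p := fun r : Reg G => (r.1.bind dec).isSome)
          (c := .pushOut fun r => r.1.bind dec) (by simp [hg])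
          (Run.skip (b := b) (⟨(some g, f), S, (p.reverse.filterMap dec).map some ++ none :: o⟩ :
            Store (Idx V) G (Option Bool)) le_rfl)
        refine ((h1.seq (h2 _)).mono (by norm_num)).congr rfl ?_
        simp [hg]
      | some x =>
        have h1 := Run.iteTrue (p := fun r : Reg G => (r.1.bind dec).isSome) (d := Cmd.skip)
          (by simp [hg]) (Run.pushOut (b := b) (f := fun r : Reg G => r.1.bind dec)
          (s := (⟨(some g, f), S, (p.reverse.filterMap dec).map some ++ none :: o⟩ :
            Store (Idx V) G (Option Bool))))
        refine ((h1.seq (h2 _)).mono (by norm_num)).congr rfl ?_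
        simp [hg]) none
  refine (h1.seq (h2.seq (h3.congr ?_ ?_))).mono le_top
  · simp [rest]
  · simp
    funext k
    cases k with
    | val u => by_cases h : u = v <;> simp [rest, h]
    | tmp u => simp [rest]
    | acc => simp [rest]

variable [Fintype G] [DecidableEq G]

/-- Enumerate the strings `v` of the length of `w` and output the words of those which satisfy the
formula. -/
noncomputable def emitAll (dec : G → Option Bool) (v w : V) (φ : Fm V G) :
    Cmd (Idx V) G (Option Bool) :=
  .seq (fill v w (zeroSym G)) (.seq (.load fun _ => (none, false, true))
    (.loop (fun r => r.2.2) (.seq (evalProg φ)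
      (.seq (.ite (fun r => r.2.1) (emitWord dec v) Cmd.skip) (nextProg v)))))

/-- Only membership in the list is specified. Different strings may decode to the same word, and for
a disjunctive reduction the order and the repetitions of queries are immaterial. -/
theorem Run.emitAll (dec : G → Option Bool) {v w : V} (φ : Fm V G) (hφ : φ.Ok = true)
    (hv : v ∉ φ.bound) (hvw : v ≠ w) (e : V → List G) (o : List (Option Bool)) (f : Bool × Bool)
    (he : ∀ u ∈ v :: φ.bound, e u = []) (hb : ∀ u, ((e u).length : ℕ∞) ≤ b) :
    ∃ qs : List (List Bool),
      (∀ q, q ∈ qs ↔ ∃ l : List G, l.length = (e w).length ∧ φ.Sat (Function.update e v l) ∧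
        l.filterMap dec = q) ∧
      Run b ⊤ (Cmd.emitAll dec v w φ) ⟨(none, f), rest e, o⟩
        ⟨(none, false, false), rest e, encodeWordList qs ++ o⟩ := by
  have hev : e v = [] := he v (by simp)
  have hnil : Function.update e v [] = e := by rw [← hev, Function.update_eq_self]
  have key : ∀ (n : ℕ) (l : List G) (o : List (Option Bool)), l.length = (e w).length →
      Fintype.card G ^ (e w).length - strVal l ≤ n → ∃ qs : List (List Bool),
      (∀ q, q ∈ qs ↔ ∃ l' : List G, l'.length = (e w).length ∧ strVal l ≤ strVal l' ∧
        (φ.Sat (Function.update e v l') ∧ l'.filterMap dec = q)) ∧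
      Run b ⊤ (.loop (fun r => r.2.2) (.seq (Cmd.evalProg φ)
        (.seq (.ite (fun r => r.2.1) (Cmd.emitWord dec v) Cmd.skip) (Cmd.nextProg v))))
      ⟨(none, false, true), rest (Function.update e v l), o⟩
      ⟨(none, false, false), rest e, encodeWordList qs ++ o⟩ := by
    intro n
    induction n with
    | zero =>
      intro l o hl hn
      have := strVal_lt l
      rw [hl] at this
      omega
    | succ n ihn =>
      intro l o hl hn
      have hlb : (l.length : ℕ∞) ≤ b := by rw [hl]; exact hb w
      obtain ⟨t, ht, h1⟩ := Run.evalProg (b := b) φ hφ (Function.update e v l) o (false, true) (by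
        intro u hu
        have : u ≠ v := fun h => hv (h ▸ hu)
        simpa [this] using he u (by simp [hu])) (by
        intro u
        by_cases h : u = v
        · subst h; simpa using hlb
        · simpa [h] using hb u)
      have h2 : ∃ qs : List (List Bool), (∀ q, q ∈ qs ↔ φ.Sat (Function.update e v l) ∧
          l.filterMap dec = q) ∧
          Run b ⊤ (.ite (fun r => r.2.1) (Cmd.emitWord dec v) Cmd.skip)
            ⟨(none, t, false), rest (Function.update e v l), o⟩
            ⟨(none, t, false), rest (Function.update e v l), encodeWordList qs ++ o⟩ := by
        cases t with
        | true =>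
          refine ⟨[l.filterMap dec], by simp [ht.1 rfl, eq_comm], ?_⟩
          have := Run.emitWord (b := b) dec (Function.update e v l) v o (true, false)
            (by simpa using hlb)
          refine ((Run.iteTrue rfl this).mono le_top).congr rfl ?_
          simp [encodeWordList]
        | false =>
          have hns : ¬ φ.Sat (Function.update e v l) := fun h => absurd (ht.2 h) (by simp)
          exact ⟨[], by simp [hns], (Run.iteFalse rfl (Run.skip _ le_rfl)).mono le_top⟩
      obtain ⟨qs, hqs, h2⟩ := h2
      have h3 := Run.nextProg (b := b) e v l (encodeWordList qs ++ o) (none, t, false) hlb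
      cases hnext : nextStr l with
      | none =>
        refine ⟨qs, ?_, ?_⟩
        · intro q
          rw [exists_le_strVal (P := fun l => φ.Sat (Function.update e v l) ∧ l.filterMap dec = q)
            hl, hqs]
          simp [hnext]
        · rw [hnext, Option.getD_none, hnil] at h3
          exact (Run.loopStep rfl (h1.seq (h2.seq h3)) (Run.loopStop rfl)).mono le_top
      | some l' =>
        obtain ⟨h4, h5⟩ := nextStr_some hnext
        obtain ⟨qs', hqs', h6⟩ := ihn l' (encodeWordList qs ++ o) (h4.trans hl) (by omega)
        refine ⟨qs' ++ qs, ?_, ?_⟩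
        · intro q
          rw [exists_le_strVal (P := fun l => φ.Sat (Function.update e v l) ∧ l.filterMap dec = q)
            hl, List.mem_append, hqs, hqs']
          simp only [hnext, Option.some.injEq, exists_eq_left']
          exact or_comm
        · rw [hnext, Option.getD_some] at h3
          refine ((Run.loopStep rfl (h1.seq (h2.seq h3)) h6).mono le_top).congr rfl ?_
          simp [encodeWordList]
  have hfill := Run.fill (b := b) e hvw (zeroSym G) o f hev (hb w)
  have hload := Run.load (b := b) (f := fun _ : Reg G => (none, false, true))
    (s := (⟨(none, f), rest (Function.update e v (List.replicate (e w).length (zeroSym G))), o⟩ :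
      Store (Idx V) G (Option Bool)))
  obtain ⟨qs, hqs, h⟩ := key _ (List.replicate (e w).length (zeroSym G)) o (by simp) le_rfl
  refine ⟨qs, ?_, (hfill.seq (hload.seq h)).mono le_top⟩
  intro q
  rw [hqs]
  simp [strVal_replicate_zeroSym]

end Output

/-! ### Squaring the length of a variable -/

section Square

variable {V G O : Type} [DecidableEq V] [Inhabited G] {b : ℕ∞}

/-- Push as many symbols on the accumulator as the product of the lengths of `v` and `u`. -/
def mulAcc (v u : V) : Cmd (Idx V) G O := forEach v (forEach u (.push .acc fun _ => default))

theorem Run.mulAcc (e : V → List G) {v u : V} (hvu : v ≠ u) (o : List O) (f : Bool × Bool)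
    (hb : ((e v).length * (e u).length : ℕ) ≤ b) (hv : ((e v).length : ℕ∞) ≤ b)
    (hu : ((e u).length : ℕ∞) ≤ b) :
    Run b ⊤ (Cmd.mulAcc v u) ⟨(none, f), rest e, o⟩ ⟨(none, f), Function.update (rest e) .acc
      (List.replicate ((e v).length * (e u).length) default), o⟩ := by
  have hinner : ∀ (k : ℕ) (S : Idx V → List G), S (.val u) = e u → S (.tmp u) = [] →
      S .acc = List.replicate k default → (k + (e u).length : ℕ) ≤ b →
      Run b ⊤ (Cmd.forEach u (.push .acc fun _ => default)) (⟨(none, f), S, o⟩ : Store (Idx V) G O)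
        ⟨(none, f), Function.update S .acc (List.replicate (k + (e u).length) default), o⟩ := by
    intro k S h1 h2 h3 h4
    have := Run.forEach (b := b) (n := 1) (c := .push .acc fun _ => default) (v := u) (l := e u)
      (fun i => Function.update S .acc (List.replicate (k + i) default)) (fun _ => o) none f hu
      (by intro i _; simp [h1]) (by intro i _; simp [h2])
      (by
        intro i hi l₁ l₂ _
        have h := Run.push (b := b) (i := .acc) (f := fun _ : Reg G => default)
          (s := (⟨(none, f), setVar (Function.update S .acc (List.replicate (k + i) default)) u l₁ l₂,
            o⟩ : Store (Idx V) G O)) (by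
            refine le_trans ?_ h4
            simp [setVar]
            norm_cast
            omega)
        refine h.congr rfl ?_
        congr 1
        funext j
        cases j with
        | val x => by_cases h : x = u <;> simp [setVar, h]
        | tmp x => by_cases h : x = u <;> simp [setVar, h]
        | acc => simp [setVar, ← add_assoc, List.replicate_succ])
    have h0 : Function.update S .acc (List.replicate (k + 0) default) = S := by
      rw [add_zero, ← h3, Function.update_eq_self]
    simp only [h0] at this
    exact this.mono le_top
  have := Run.forEach (b := b) (n := ⊤) (c := Cmd.forEach u (.push .acc fun _ => default)) (v := v)
    (l := e v) (fun i => Function.update (rest e) .acc (List.replicate (i * (e u).length) default))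
    (fun _ => o) none f hv (by intro i _; simp [rest]) (by intro i _; simp [rest])
    (by
      intro i hi l₁ l₂ _
      have h := hinner (i * (e u).length) (setVar (Function.update (rest e) .acc
        (List.replicate (i * (e u).length) default)) v l₁ l₂) (by simp [setVar, hvu.symm, rest])
        (by simp [setVar, hvu.symm, rest]) (by simp [setVar]) (by
          refine le_trans ?_ hb
          norm_cast
          rw [← Nat.succ_mul]
          exact Nat.mul_le_mul_right _ hi)
      refine h.congr rfl ?_
      congr 1
      funext j
      cases j with
      | val x => by_cases h : x = v <;> simp [setVar, h]
      | tmp x => by_cases h : x = v <;> simp [setVar, h]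
      | acc => simp [setVar, Nat.succ_mul])
  have h0 : Function.update (rest e) .acc (List.replicate (0 * (e u).length) default) = rest e := by
    funext j
    cases j <;> simp [rest]
  simp only [h0] at this
  exact this.mono le_top

/-- Square the length of `v`, with the help of the empty variable `u`. -/
def square (v u : V) : Cmd (Idx V) G O :=
  .seq (fill u v default) (.seq (mulAcc v u) (.seq (clear (.val v)) (.seq (clear (.val u))
    (move .acc (.val v)))))

theorem Run.square (e : V → List G) {v u : V} (hvu : v ≠ u) (hu : e u = []) (o : List O)
    (f : Bool × Bool) (hb : ((e v).length ^ 2 : ℕ) ≤ b) :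
    Run b ⊤ (Cmd.square v u) ⟨(none, f), rest e, o⟩ ⟨(none, f), rest (Function.update e v
      (List.replicate ((e v).length ^ 2) default)), o⟩ := by
  have hv : ((e v).length : ℕ∞) ≤ b := by
    refine le_trans ?_ hb
    norm_cast
    exact Nat.le_self_pow (by norm_num) _
  have h1 := Run.fill (b := b) e hvu.symm default o f hu hv
  set n := (e v).length with hn
  have h2 := Run.mulAcc (b := b) (Function.update e u (List.replicate n default)) hvu o f
    (by simpa [hvu, ← hn, sq] using hb) (by simpa [hvu] using hv) (by simpa using hv)
  simp only [ne_eq, hvu, not_false_eq_true, Function.update_of_ne, Function.update_self,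
    List.length_replicate, ← hn] at h2
  have h3 := Run.clear (b := b) (i := .val v) none f (Function.update (rest (Function.update e u
    (List.replicate n default))) .acc (List.replicate (n * n) default)) o
  have h4 := Run.clear (b := b) (i := .val u) none f (Function.update (Function.update
    (rest (Function.update e u (List.replicate n default))) .acc
      (List.replicate (n * n) default)) (.val v) []) o
  have h5 := Run.move (b := b) (i := Idx.acc) (j := .val v) (by simp) none f (Function.update
    (Function.update (Function.update (rest (Function.update e u (List.replicate n default))) .acc
      (List.replicate (n * n) default)) (.val v) []) (.val u) []) o (by
      simpa [hvu, sq] using hb)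
  refine ((h1.seq (h2.seq (h3.seq (h4.seq h5)))).mono le_top).congr rfl ?_
  congr 1
  funext j
  cases j with
  | val x =>
    by_cases h : x = v
    · subst h; simp [hvu, rest, sq]
    · by_cases h' : x = u
      · subst h'; simp [h, rest, hu]
      · simp [h, h', rest]
  | tmp x => simp [rest]
  | acc => simp [rest]

end Square

end Cmd


/-! ### The search program and its space bound -/

namespace Cmd

section Main

variable {V G : Type}

theorem final_eq (o : List (Option Bool)) : (final o : Store (Idx V) G (Option Bool)) =
    ⟨(none, false, false), rest (fun _ => []), o⟩ := by
  unfold final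
  congr 2
  funext k
  cases k <;> rfl

variable [DecidableEq V]

theorem init_eq (inp : V) (x : List G) : (init (.val inp) x : Store (Idx V) G (Option Bool)) =
    ⟨(none, false, false), rest (Function.update (fun _ => []) inp x), []⟩ := by
  unfold init
  rw [← update_rest]
  congr 2
  funext k
  cases k <;> rfl

variable [Inhabited G]

/-- The values of the variables for the input `x`: besides the input `inp`, two strings of
polynomial length that bound the quantifiers. -/
def baseEnv (inp bnd bnd2 : V) (B : ℕ) (x : List G) : V → List G :=
  Function.update (Function.update (Function.update (fun _ => []) inp x)
    bnd (List.replicate B default))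
    bnd2 (List.replicate (B ^ 2) default)

variable [Fintype G] [DecidableEq G]

/-- The program that outputs the words of all the strings `w` that satisfy `φ`, and the word `w₀`
if `ψ` holds. -/
noncomputable def searchProg (dec : G → Option Bool) (inp bnd bnd2 w : V) (φ ψ : Fm V G)
    (w₀ : List Bool) : Cmd (Idx V) G (Option Bool) :=
  .seq (fill bnd inp default) <| .seq (.push (.val bnd) fun _ => default) <|
  .seq (.push (.val bnd) fun _ => default) <| .seq (.push (.val bnd) fun _ => default) <|
  .seq (.push (.val bnd) fun _ => default) <| .seq (square bnd w) <| .seq (square bnd w) <|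
  .seq (square bnd w) <| .seq (fill bnd2 bnd default) <| .seq (square bnd2 w) <|
  .seq (emitAll dec w bnd φ) <| .seq (evalProg ψ) <|
  .seq (.ite (fun r => r.2.1) (pushWord w₀) Cmd.skip) <|
  .seq (clear (.val inp)) <| .seq (clear (.val bnd)) <| .seq (clear (.val bnd2))
  (.load fun _ => (none, false, false))

/-- Four pushes turn the length of the input into N, three squarings give B = N ^ 8, and one more
squaring of a copy gives B ^ 2, the greatest height that is needed. The variable `w` serves as
scratch space for the squarings before it becomes the search variable. At the end all stacks are
cleared, as a halting configuration requires. -/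
theorem Run.searchProg (dec : G → Option Bool) {inp bnd bnd2 w : V} {φ ψ : Fm V G}
    (w₀ : List Bool) (h12 : inp ≠ bnd) (h13 : inp ≠ bnd2) (h14 : inp ≠ w) (h23 : bnd ≠ bnd2)
    (h24 : bnd ≠ w) (h34 : bnd2 ≠ w) (hφ : φ.Ok = true) (hψ : ψ.Ok = true)
    (hφb : ∀ v ∈ φ.bound, v ≠ inp ∧ v ≠ bnd ∧ v ≠ bnd2 ∧ v ≠ w)
    (hψb : ∀ v ∈ ψ.bound, v ≠ inp ∧ v ≠ bnd ∧ v ≠ bnd2) (x : List G) {N B : ℕ}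
    {b : ℕ∞} (hN : N = x.length + 4) (hB : B = N ^ 8) (hb : ((B ^ 2 : ℕ) : ℕ∞) ≤ b) :
    ∃ qs : List (List Bool),
      (∀ q, q ∈ qs ↔ (∃ l : List G, l.length = B ∧
        φ.Sat (Function.update (baseEnv inp bnd bnd2 B x) w l) ∧ l.filterMap dec = q) ∨
        (ψ.Sat (baseEnv inp bnd bnd2 B x) ∧ q = w₀)) ∧
      Run b ⊤ (Cmd.searchProg dec inp bnd bnd2 w φ ψ w₀)
        (init (.val inp) x) (final (encodeWordList qs)) := by
  have hNB : N ≤ B := hB ▸ Nat.le_self_pow (by norm_num) _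
  have hBB : B ≤ B ^ 2 := Nat.le_self_pow (by norm_num) _
  have hle : ∀ k : ℕ, k ≤ B ^ 2 → (k : ℕ∞) ≤ b := fun k hk => le_trans (by exact_mod_cast hk) hb
  let e₀ : V → List G := Function.update (fun _ => []) inp x
  let E : ℕ → V → List G := fun k => Function.update e₀ bnd (List.replicate k default)
  let E' : ℕ → V → List G := fun k => Function.update (E B) bnd2 (List.replicate k default)
  have hfin : E' (B ^ 2) = baseEnv inp bnd bnd2 B x := rfl
  let o : List (Option Bool) := []
  let f : Bool × Bool := (false, false)
  have h1 : Run b ⊤ (Cmd.fill bnd inp default) ⟨(none, f), rest e₀, o⟩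
      ⟨(none, f), rest (E x.length), o⟩ := by
    have := Run.fill (b := b) e₀ h12.symm default o f (by simp [e₀, h12.symm])
      (by simp only [e₀, Function.update_self]; exact hle _ (by omega))
    simpa [e₀, E] using this
  have hpush : ∀ k, k < N → Run b 1 (.push (.val bnd) fun _ => default)
      (⟨(none, f), rest (E k), o⟩ : Store (Idx V) G (Option Bool))
      ⟨(none, f), rest (E (k + 1)), o⟩ := by
    intro k hk
    have := Run.push (b := b) (i := .val bnd) (f := fun _ : Reg G => default)
      (s := (⟨(none, f), rest (E k), o⟩ : Store (Idx V) G (Option Bool))) (by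
        simp only [rest, E, Function.update_self, List.length_replicate]
        exact hle _ (by omega))
    refine this.congr rfl ?_
    simp [rest, E, update_rest, List.replicate_succ]
  have hsq : ∀ k, k ^ 2 ≤ B → Run b ⊤ (Cmd.square bnd w) ⟨(none, f), rest (E k), o⟩
      ⟨(none, f), rest (E (k ^ 2)), o⟩ := by
    intro k hk
    have := Run.square (b := b) (E k) h24 (by simp [E, e₀, h24.symm, h14.symm]) o f
      (by simp only [E, Function.update_self, List.length_replicate]; exact hle _ (hk.trans hBB))
    simpa [E] using this
  have h2 : Run b ⊤ (Cmd.fill bnd2 bnd default) ⟨(none, f), rest (E B), o⟩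
      ⟨(none, f), rest (E' B), o⟩ := by
    have := Run.fill (b := b) (E B) h23.symm default o f
      (by simp [E, e₀, h23.symm, h13.symm])
      (by
        simp only [E, Function.update_self, List.length_replicate]
        exact hle _ hBB)
    simpa [E, E'] using this
  have h3 : Run b ⊤ (Cmd.square bnd2 w) ⟨(none, f), rest (E' B), o⟩
      ⟨(none, f), rest (baseEnv inp bnd bnd2 B x), o⟩ := by
    have := Run.square (b := b) (E' B) h34
      (by simp [E', E, e₀, h24.symm, h14.symm, h34.symm]) o f
      (by
        simpa only [E', Function.update_self, List.length_replicate] using hb)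
    rw [← hfin]
    simpa [E'] using this
  have hbase : ∀ v, v ≠ inp → v ≠ bnd → v ≠ bnd2 → baseEnv inp bnd bnd2 B x v = [] := by
    intro v h1 h2 h3
    simp [baseEnv, h1, h2, h3]
  have hbb : ∀ v, ((baseEnv inp bnd bnd2 B x v).length : ℕ∞) ≤ b := by
    intro v
    by_cases hv3 : v = bnd2
    · subst hv3; simpa [baseEnv] using hb
    · by_cases hv2 : v = bnd
      · subst hv2
        simp only [baseEnv, ne_eq, hv3, not_false_eq_true, Function.update_of_ne,
          Function.update_self, List.length_replicate]
        exact hle _ hBB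
      · by_cases hv1 : v = inp
        · subst hv1
          simp only [baseEnv, ne_eq, hv3, hv2, not_false_eq_true, Function.update_of_ne,
            Function.update_self]
          exact hle _ (by omega)
        · simp [hbase v hv1 hv2 hv3]
  obtain ⟨qs, hqs, h4⟩ := Run.emitAll (b := b) dec (v := w) (w := bnd) φ hφ
    (fun h => (hφb w h).2.2.2 rfl) h24.symm (baseEnv inp bnd bnd2 B x) o f
    (by
      intro u hu
      rcases List.mem_cons.1 hu with rfl | hu
      · exact hbase _ h14.symm h24.symm h34.symm
      · exact hbase _ (hφb u hu).1 (hφb u hu).2.1 (hφb u hu).2.2.1) hbb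
  obtain ⟨t, ht, h5⟩ := Run.evalProg (b := b) ψ hψ (baseEnv inp bnd bnd2 B x)
    (encodeWordList qs ++ o) (false, false)
    (fun v hv => hbase v (hψb v hv).1 (hψb v hv).2.1 (hψb v hv).2.2) hbb
  have h6 : ∃ qs' : List (List Bool), (∀ q, q ∈ qs' ↔ q ∈ qs ∨
      (ψ.Sat (baseEnv inp bnd bnd2 B x) ∧ q = w₀)) ∧
      Run b ⊤ (.ite (fun r => r.2.1) (Cmd.pushWord w₀) Cmd.skip)
        ⟨(none, t, false), rest (baseEnv inp bnd bnd2 B x), encodeWordList qs ++ o⟩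
        ⟨(none, t, false), rest (baseEnv inp bnd bnd2 B x), encodeWordList qs'⟩ := by
    cases t with
    | true =>
      refine ⟨w₀ :: qs, ?_, ?_⟩
      · intro q
        simp [ht.1 rfl, or_comm]
      · refine ((Run.iteTrue rfl (Run.pushWord w₀ _ _ _)).mono le_top).congr rfl ?_
        simp [encodeWordList, o]
    | false =>
      have hns : ¬ ψ.Sat (baseEnv inp bnd bnd2 B x) := fun h => absurd (ht.2 h) (by simp)
      refine ⟨qs, by simp [hns], ?_⟩
      refine ((Run.iteFalse rfl (Run.skip _ le_rfl)).mono le_top).congr rfl ?_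
      simp [o]
  obtain ⟨qs', hqs', h6⟩ := h6
  refine ⟨qs', ?_, ?_⟩
  · intro q
    rw [hqs', hqs]
    simp [baseEnv, h23]
  · have hc1 := Run.clear (b := b) (i := .val inp) none (t, false)
      (rest (baseEnv inp bnd bnd2 B x)) (encodeWordList qs')
    rw [update_rest] at hc1
    have hc2 := Run.clear (b := b) (i := .val bnd) none (t, false)
      (rest (Function.update (baseEnv inp bnd bnd2 B x) inp [])) (encodeWordList qs')
    rw [update_rest] at hc2
    have hc3 := Run.clear (b := b) (i := .val bnd2) none (t, false)
      (rest (Function.update (Function.update (baseEnv inp bnd bnd2 B x) inp []) bnd []))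
      (encodeWordList qs')
    rw [update_rest] at hc3
    have hz : Function.update (Function.update (Function.update (baseEnv inp bnd bnd2 B x) inp []) bnd
        []) bnd2 [] = fun _ => [] := by
      funext v
      by_cases hv3 : v = bnd2
      · subst hv3; simp
      · by_cases hv2 : v = bnd
        · subst hv2; simp [hv3]
        · by_cases hv1 : v = inp
          · subst hv1; simp [hv2, hv3]
          · simp [hv1, hv2, hv3, hbase]
    rw [hz] at hc3
    have hl := Run.load (b := b) (f := fun _ : Reg G => (none, false, false))
      (s := (⟨(none, t, false), rest (fun _ => []), encodeWordList qs'⟩ :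
        Store (Idx V) G (Option Bool)))
    have hpow : ∀ {a : ℕ}, a ≤ 8 → N ^ a ≤ B := fun h => hB ▸ Nat.pow_le_pow_right (by omega) h
    have hs1 := hsq N (hpow (by norm_num))
    have hs2 := hsq (N ^ 2) (by rw [← pow_mul]; exact hpow (by norm_num))
    have hs3 := hsq (N ^ 4) (by rw [← pow_mul]; exact hpow (by norm_num))
    rw [← pow_mul] at hs2 hs3
    rw [← hB] at hs3
    subst hN
    rw [init_eq, final_eq]
    exact (h1.seq <| (hpush _ (by omega)).seq <| (hpush _ (by omega)).seq <|
      (hpush _ (by omega)).seq <| (hpush _ (by omega)).seq <| hs1.seq <| hs2.seq <| hs3.seq <|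
      h2.seq <| h3.seq <| h4.seq <| h5.seq <| h6.seq <| hc1.seq <| hc2.seq <| hc3.seq hl).mono le_top

variable [Fintype V]

theorem exists_searchProg_computable (dec : G → Option Bool) {inp bnd bnd2 w : V} {φ ψ : Fm V G}
    (w₀ : List Bool) (h12 : inp ≠ bnd) (h13 : inp ≠ bnd2) (h14 : inp ≠ w) (h23 : bnd ≠ bnd2)
    (h24 : bnd ≠ w) (h34 : bnd2 ≠ w) (hφ : φ.Ok = true) (hψ : ψ.Ok = true)
    (hφb : ∀ v ∈ φ.bound, v ≠ inp ∧ v ≠ bnd ∧ v ≠ bnd2 ∧ v ≠ w)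
    (hψb : ∀ v ∈ ψ.bound, v ≠ inp ∧ v ≠ bnd ∧ v ≠ bnd2) :
    ∃ f : List G → List (List Bool),
      Nonempty (Turing.TM2ComputableInPolySpace (id : List G → List G) encodeWordList f) ∧
      ∀ x q, q ∈ f x ↔ (∃ l : List G, l.length = (x.length + 4) ^ 8 ∧
        φ.Sat (Function.update (baseEnv inp bnd bnd2 ((x.length + 4) ^ 8) x) w l) ∧ l.filterMap dec = q) ∨
        (ψ.Sat (baseEnv inp bnd bnd2 ((x.length + 4) ^ 8) x) ∧ q = w₀) := by
  -- The program is one and the same for all inputs; only its list of outputs is chosen for each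
  -- `x`.
  choose f hf hrun using fun x => Run.searchProg dec w₀ h12 h13 h14 h23 h24 h34 hφ hψ hφb hψb x
    (b := ((((x.length + 4) ^ 8) ^ 2 : ℕ) : ℕ∞)) rfl rfl le_rfl
  refine ⟨f, ?_, hf⟩
  refine computableInPolySpace (searchProg dec inp bnd bnd2 w φ ψ w₀) (.val inp) encodeWordList f
    (((Polynomial.X + 4) ^ 8) ^ 2) fun x => ?_
  have : Polynomial.eval x.length (((Polynomial.X + 4) ^ 8) ^ 2 : Polynomial ℕ) =
      ((x.length + 4) ^ 8) ^ 2 := by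
    simp
  rw [this]
  refine ⟨?_, hrun x⟩
  exact le_trans (by omega) ((Nat.le_self_pow (by norm_num) (x.length + 4)).trans
    (Nat.le_self_pow (by norm_num) _))

end Main

end Cmd


/-! ### Reading off an automaton from its description -/

namespace Automaton

variable {α : Type}

open AutomatonSymbol

/-- The description of a transition. -/
def encodeTransition (t : ℕ × Option α × ℕ) : List (AutomatonSymbol α) :=
  transition :: (List.replicate t.1 tally ++ label t.2.1 :: List.replicate t.2.2 tally)

/-- The description of an accepting state. -/
def encodeAccept (q : ℕ) : List (AutomatonSymbol α) := AutomatonSymbol.accept :: List.replicate q tally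

theorem encode_eq (A : Automaton α) : A.encode = List.replicate A.start tally ++
    (A.accept.flatMap encodeAccept ++ A.transitions.flatMap encodeTransition) := by
  rw [← List.append_assoc]; rfl

/-- Exactly `q` tallies stand at the position `k` of `x`. -/
def TallyAt (x : List (AutomatonSymbol α)) (k q : ℕ) : Prop :=
  (∀ i < q, x[k + i]? = some tally) ∧ x[k + q]? ≠ some tally

/-- A description of the transition `(p, o, q)` stands at the position `k` of `x`. -/
def TransAt (x : List (AutomatonSymbol α)) (k p : ℕ) (o : Option α) (q : ℕ) : Prop :=
  x[k]? = some transition ∧ (∀ i < p, x[k + 1 + i]? = some tally) ∧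
    x[k + 1 + p]? = some (label o) ∧ TallyAt x (k + p + 2) q

/-- A description of the accepting state `q` stands at the position `k` of `x`. -/
def AccAt (x : List (AutomatonSymbol α)) (k q : ℕ) : Prop :=
  x[k]? = some AutomatonSymbol.accept ∧ TallyAt x (k + 1) q

theorem TallyAt.unique {x : List (AutomatonSymbol α)} {k q q' : ℕ} (h : TallyAt x k q)
    (h' : TallyAt x k q') : q = q' := by
  rcases lt_trichotomy q q' with hlt | heq | hlt
  · exact absurd (h'.1 q hlt) h.2
  · exact heq
  · exact absurd (h.1 q' hlt) h'.2

theorem tallyAt_append_right (l₁ l₂ : List (AutomatonSymbol α)) (k q : ℕ) :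
    TallyAt (l₁ ++ l₂) (l₁.length + k) q ↔ TallyAt l₂ k q := by
  simp [TallyAt, List.getElem?_append_right, add_assoc]

theorem tallyAt_replicate_append (q : ℕ) {l : List (AutomatonSymbol α)}
    (hl : l.head? ≠ some tally) : TallyAt (List.replicate q tally ++ l) 0 q := by
  constructor
  · intro i hi
    simp [List.getElem?_append_left, hi]
  · simpa [List.getElem?_append_right, List.head?_eq_getElem?] using hl

theorem transAt_append_right (l₁ l₂ : List (AutomatonSymbol α)) (k p : ℕ) (o : Option α) (q : ℕ) :
    TransAt (l₁ ++ l₂) (l₁.length + k) p o q ↔ TransAt l₂ k p o q := by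
  unfold TransAt
  rw [show l₁.length + k + p + 2 = l₁.length + (k + p + 2) by omega, tallyAt_append_right]
  simp [List.getElem?_append_right, add_assoc]

theorem accAt_append_right (l₁ l₂ : List (AutomatonSymbol α)) (k q : ℕ) :
    AccAt (l₁ ++ l₂) (l₁.length + k) q ↔ AccAt l₂ k q := by
  unfold AccAt
  rw [show l₁.length + k + 1 = l₁.length + (k + 1) by omega, tallyAt_append_right]
  simp [List.getElem?_append_right]

theorem exists_transAt_append {l₁ l₂ : List (AutomatonSymbol α)} (h : transition ∉ l₁) {p : ℕ}
    {o : Option α} {q : ℕ} :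
    (∃ k, TransAt (l₁ ++ l₂) k p o q) ↔ ∃ k, TransAt l₂ k p o q := by
  constructor
  · rintro ⟨k, hk⟩
    rcases lt_or_ge k l₁.length with hlt | hge
    · have := hk.1
      rw [List.getElem?_append_left hlt] at this
      exact absurd (List.mem_of_getElem? this) h
    · obtain ⟨j, rfl⟩ := Nat.exists_eq_add_of_le hge
      exact ⟨j, (transAt_append_right _ _ _ _ _ _).1 hk⟩
  · rintro ⟨k, hk⟩
    exact ⟨_, (transAt_append_right l₁ _ _ _ _ _).2 hk⟩

theorem exists_accAt_append {l₁ l₂ : List (AutomatonSymbol α)} (h : AutomatonSymbol.accept ∉ l₁) {q : ℕ} :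
    (∃ k, AccAt (l₁ ++ l₂) k q) ↔ ∃ k, AccAt l₂ k q := by
  constructor
  · rintro ⟨k, hk⟩
    rcases lt_or_ge k l₁.length with hlt | hge
    · have := hk.1
      rw [List.getElem?_append_left hlt] at this
      exact absurd (List.mem_of_getElem? this) h
    · obtain ⟨j, rfl⟩ := Nat.exists_eq_add_of_le hge
      exact ⟨j, (accAt_append_right _ _ _ _).1 hk⟩
  · rintro ⟨k, hk⟩
    exact ⟨_, (accAt_append_right l₁ _ _ _).2 hk⟩

theorem head?_transitions (ts : List (ℕ × Option α × ℕ)) :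
    (ts.flatMap encodeTransition).head? ≠ some tally := by
  cases ts <;> simp [encodeTransition]

theorem head?_accepts (as : List ℕ) {l : List (AutomatonSymbol α)} (hl : l.head? ≠ some tally) :
    (as.flatMap encodeAccept ++ l).head? ≠ some tally := by
  cases as <;> simp [encodeAccept, hl]

/-- A maximal block of tallies has a unique length, and the label separates the two numbers. The
hypothesis `hl` keeps the second number from running on into `l`. -/
theorem transAt_zero (p' : ℕ) (o' : Option α) (q' : ℕ) {l : List (AutomatonSymbol α)}
    (hl : l.head? ≠ some tally) {p : ℕ} {o : Option α} {q : ℕ} :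
    TransAt (encodeTransition (p', o', q') ++ l) 0 p o q ↔ (p, o, q) = (p', o', q') := by
  have key : TransAt (encodeTransition (p', o', q') ++ l) 0 p' o' q' := by
    refine ⟨by simp [encodeTransition], ?_, ?_, ?_⟩
    · intro i hi
      simp [encodeTransition, add_comm 1 i, List.getElem?_append_left, hi]
    · simp [encodeTransition, add_comm 1 p']
    · have := (tallyAt_append_right (transition :: (List.replicate p' tally ++ [label o']))
        (List.replicate q' tally ++ l) 0 q').2 (tallyAt_replicate_append q' hl)
      convert this using 1
      · simp [encodeTransition]
      · simp
  constructor
  · intro h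
    have hp : p = p' := by
      have h1 : TallyAt (encodeTransition (p', o', q') ++ l) (0 + 1) p :=
        ⟨h.2.1, by rw [h.2.2.1]; simp⟩
      have h2 : TallyAt (encodeTransition (p', o', q') ++ l) (0 + 1) p' :=
        ⟨key.2.1, by rw [key.2.2.1]; simp⟩
      exact h1.unique h2
    subst hp
    have ho : o = o' := by
      have := h.2.2.1.symm.trans key.2.2.1
      simpa using this
    subst ho
    rw [h.2.2.2.unique key.2.2.2]
  · intro h
    simp only [Prod.mk.injEq] at h
    obtain ⟨rfl, rfl, rfl⟩ := h
    exact key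

/-- The marker `transition` occurs only at the beginning of a piece, so a position where a
transition is described is either the beginning of the first piece or lies in the remaining ones. -/
theorem exists_transAt_transitions (ts : List (ℕ × Option α × ℕ)) {p : ℕ} {o : Option α} {q : ℕ} :
    (∃ k, TransAt (ts.flatMap encodeTransition) k p o q) ↔ (p, o, q) ∈ ts := by
  induction ts with
  | nil => simp [TransAt]
  | cons t ts ih =>
    obtain ⟨p', o', q'⟩ := t
    rw [List.flatMap_cons, List.mem_cons, ← ih]
    have hsplit : (∃ k, TransAt (encodeTransition (p', o', q') ++ ts.flatMap encodeTransition) k p o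
        q) ↔ TransAt (encodeTransition (p', o', q') ++ ts.flatMap encodeTransition) 0 p o q ∨
        ∃ k, TransAt ((List.replicate p' tally ++ label o' :: List.replicate q' tally) ++
          ts.flatMap encodeTransition) k p o q := by
      constructor
      · rintro ⟨k, hk⟩
        cases k with
        | zero => exact Or.inl hk
        | succ k =>
          right
          refine ⟨k, ?_⟩
          rw [← transAt_append_right [transition], List.length_singleton, add_comm]
          exact hk
      · rintro (h | ⟨k, hk⟩)
        · exact ⟨0, h⟩
        · exact ⟨_, (transAt_append_right [transition] _ k p o q).2 hk⟩
    rw [hsplit, transAt_zero _ _ _ (head?_transitions ts), exists_transAt_append]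
    simp [List.mem_replicate]

theorem accAt_zero (q' : ℕ) {l : List (AutomatonSymbol α)} (hl : l.head? ≠ some tally) {q : ℕ} :
    AccAt (encodeAccept q' ++ l) 0 q ↔ q = q' := by
  have key : AccAt (encodeAccept q' ++ l) 0 q' :=
    ⟨by simp [encodeAccept], (tallyAt_append_right [AutomatonSymbol.accept] _ 0 q').2
      (tallyAt_replicate_append q' hl)⟩
  constructor
  · intro h
    exact h.2.unique key.2
  · rintro rfl
    exact key

theorem exists_accAt_accepts (as : List ℕ) {l : List (AutomatonSymbol α)}
    (hl : l.head? ≠ some tally) (hl' : AutomatonSymbol.accept ∉ l) {q : ℕ} :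
    (∃ k, AccAt (as.flatMap encodeAccept ++ l) k q) ↔ q ∈ as := by
  induction as with
  | nil =>
    simp only [List.flatMap_nil, List.nil_append, List.not_mem_nil, iff_false, not_exists]
    intro k hk
    exact hl' (List.mem_of_getElem? hk.1)
  | cons a as ih =>
    rw [List.flatMap_cons, List.append_assoc, List.mem_cons, ← ih]
    have hsplit : (∃ k, AccAt (encodeAccept a ++ (as.flatMap encodeAccept ++ l)) k q) ↔
        AccAt (encodeAccept a ++ (as.flatMap encodeAccept ++ l)) 0 q ∨
        ∃ k, AccAt (List.replicate a tally ++ (as.flatMap encodeAccept ++ l)) k q := by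
      constructor
      · rintro ⟨k, hk⟩
        cases k with
        | zero => exact Or.inl hk
        | succ k =>
          right
          refine ⟨k, ?_⟩
          rw [← accAt_append_right [AutomatonSymbol.accept], List.length_singleton, add_comm]
          exact hk
      · rintro (h | ⟨k, hk⟩)
        · exact ⟨0, h⟩
        · exact ⟨_, (accAt_append_right [AutomatonSymbol.accept] _ k q).2 hk⟩
    rw [hsplit, accAt_zero _ (head?_accepts as hl), exists_accAt_append]
    simp [List.mem_replicate]

/-- The right-hand side speaks of the word only. It is the form that a formula over the input string
can express. -/
theorem mem_transitions_iff (A : Automaton α) {p : ℕ} {o : Option α} {q : ℕ} :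
    (p, o, q) ∈ A.transitions ↔ ∃ k, TransAt A.encode k p o q := by
  rw [encode_eq, exists_transAt_append, exists_transAt_append, exists_transAt_transitions]
  · simp [encodeAccept, List.mem_replicate]
  · simp [List.mem_replicate]

theorem mem_accept_iff (A : Automaton α) {q : ℕ} :
    q ∈ A.accept ↔ ∃ k, AccAt A.encode k q := by
  rw [encode_eq, exists_accAt_append, exists_accAt_accepts _ (head?_transitions _)]
  · simp [encodeTransition, List.mem_replicate]
  · simp [List.mem_replicate]

theorem eq_start_iff (A : Automaton α) {q : ℕ} : q = A.start ↔ TallyAt A.encode 0 q := by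
  have key : TallyAt A.encode 0 A.start := by
    rw [encode_eq]
    exact tallyAt_replicate_append _ (head?_accepts _ (head?_transitions _))
  exact ⟨fun h => h ▸ key, fun h => h.unique key⟩

/-- `NRR` asks for some automaton with the given description, and by this lemma its choice is
irrelevant. Membership in the lists and the initial state determine the language, so the lists
themselves need not be compared. -/
theorem language_eq_of_encode_eq {A A' : Automaton α} (h : A.encode = A'.encode) :
    A.language = A'.language := by
  unfold language
  congr 1
  unfold toεNFA
  congr 1
  · funext p o
    ext q
    simp only [Set.mem_ofPred_eq, mem_transitions_iff, h]
  · have : A.start = A'.start := A'.eq_start_iff.2 (h ▸ A.eq_start_iff.1 rfl)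
    rw [this]
  · ext q
    simp only [Set.mem_ofPred_eq, mem_accept_iff, h]

theorem getElem?_some_lt {x : List (AutomatonSymbol α)} {k : ℕ} {a : AutomatonSymbol α}
    (h : x[k]? = some a) : k < x.length := by
  by_contra hc
  rw [List.getElem?_eq_none (by omega)] at h
  simp at h

/-- Unary notation: a state is no larger than the description. This bounds both the pumping length
and the length of runs. -/
theorem lt_length_of_mem_transitions (A : Automaton α) {p : ℕ} {o : Option α} {q : ℕ}
    (h : (p, o, q) ∈ A.transitions) : p ≤ A.encode.length ∧ q ≤ A.encode.length := by
  obtain ⟨k, -, -, h2, h3⟩ := A.mem_transitions_iff.1 h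
  have := getElem?_some_lt h2
  refine ⟨by omega, ?_⟩
  by_contra hc
  have := getElem?_some_lt (h3.1 (q - 1) (by omega))
  omega

theorem start_le_length (A : Automaton α) : A.start ≤ A.encode.length := by
  rw [encode_eq]; simp

/-! ### Recognizing well-formed descriptions -/

/-- The transition function of a finite automaton that recognizes the descriptions of automata; its
three states are `tally`, `accept` and `transition`. -/
def formatStep : AutomatonSymbol α → AutomatonSymbol α → Option (AutomatonSymbol α)
  | tally, tally => some tally
  | tally, AutomatonSymbol.accept => some tally
  | tally, transition => some AutomatonSymbol.accept
  | AutomatonSymbol.accept, tally => some AutomatonSymbol.accept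
  | AutomatonSymbol.accept, label _ => some transition
  | transition, tally => some transition
  | transition, transition => some AutomatonSymbol.accept
  | _, _ => none

/-- The words accepted from a state. -/
def FormatOk : AutomatonSymbol α → List (AutomatonSymbol α) → Prop
  | s, [] => s ≠ AutomatonSymbol.accept
  | s, g :: l => ∃ s', formatStep s g = some s' ∧ FormatOk s' l

/-- The recursion along the word is replaced by a sequence of states that is constrained locally,
and such a sequence can be quantified as a string. -/
theorem formatOk_iff (s : AutomatonSymbol α) (x : List (AutomatonSymbol α)) :
    FormatOk s x ↔ ∃ Z : ℕ → AutomatonSymbol α, Z 0 = s ∧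
      (∀ i g, x[i]? = some g → formatStep (Z i) g = some (Z (i + 1))) ∧ Z x.length ≠ AutomatonSymbol.accept := by
  induction x generalizing s with
  | nil =>
    simp only [FormatOk, List.getElem?_nil, reduceCtorEq, false_implies, implies_true, true_and,
      List.length_nil]
    exact ⟨fun h => ⟨fun _ => s, rfl, h⟩, fun ⟨Z, h1, h2⟩ => h1 ▸ h2⟩
  | cons g l ih =>
    simp only [FormatOk, ih]
    constructor
    · rintro ⟨s', h1, Z, h2, h3, h4⟩
      refine ⟨fun i => if i = 0 then s else Z (i - 1), by simp, ?_, by simpa using h4⟩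
      intro i g' hi
      cases i with
      | zero =>
        simp only [List.getElem?_cons_zero, Option.some.injEq] at hi
        subst hi
        simpa [h2] using h1
      | succ i => simpa using h3 i g' (by simpa using hi)
    · rintro ⟨Z, h1, h2, h3⟩
      refine ⟨Z 1, ?_, fun i => Z (i + 1), rfl, ?_, by simpa using h3⟩
      · rw [← h1]
        exact h2 0 g (by simp)
      · intro i g' hi
        exact h2 (i + 1) g' (by simpa using hi)

theorem formatOk_replicate {s : AutomatonSymbol α} (hs : ∀ o, s ≠ label o) (k : ℕ)
    (l : List (AutomatonSymbol α)) : FormatOk s (List.replicate k tally ++ l) ↔ FormatOk s l := by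
  induction k with
  | zero => simp
  | succ k ih =>
    rw [List.replicate_succ, List.cons_append, FormatOk]
    have : formatStep s tally = some s := by
      cases s with
      | label o => exact absurd rfl (hs o)
      | _ => rfl
    simp [this, ih]

theorem formatOk_transitions (ts : List (ℕ × Option α × ℕ)) {s : AutomatonSymbol α}
    (hs : s = tally ∨ s = transition) : FormatOk s (ts.flatMap encodeTransition) := by
  induction ts generalizing s with
  | nil => rcases hs with rfl | rfl <;> simp [FormatOk]
  | cons t ts ih =>
    rw [List.flatMap_cons, encodeTransition, List.cons_append, FormatOk]
    refine ⟨AutomatonSymbol.accept, by rcases hs with rfl | rfl <;> rfl, ?_⟩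
    rw [List.append_assoc, formatOk_replicate (by simp), List.cons_append, FormatOk]
    exact ⟨transition, rfl, (formatOk_replicate (by simp) _ _).2 (ih (Or.inr rfl))⟩

theorem formatOk_encode (A : Automaton α) : FormatOk tally A.encode := by
  rw [encode_eq, formatOk_replicate (by simp)]
  induction A.accept with
  | nil => simpa using formatOk_transitions _ (Or.inl rfl)
  | cons a as ih =>
    rw [List.flatMap_cons, encodeAccept, List.append_assoc, List.cons_append, FormatOk]
    exact ⟨tally, rfl, (formatOk_replicate (by simp) _ _).2 ih⟩

/-- The three states are treated in one induction. In `transition` the second number of a transition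
is being read, in `accept` its first number, and in `tally` the initial state or an accepting one.
What remains is parsed accordingly. -/
theorem exists_of_formatOk (x : List (AutomatonSymbol α)) :
    (FormatOk transition x → ∃ k ts, x = List.replicate k tally ++
      List.flatMap encodeTransition ts) ∧
    (FormatOk AutomatonSymbol.accept x → ∃ k o k' ts, x = List.replicate k tally ++
      label o :: (List.replicate k' tally ++ List.flatMap encodeTransition ts)) ∧
    (FormatOk tally x → ∃ A : Automaton α, A.encode = x) := by
  induction x with
  | nil =>
    refine ⟨fun _ => ⟨0, [], rfl⟩, fun h => absurd rfl h, fun _ => ⟨⟨0, [], []⟩, rfl⟩⟩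
  | cons g l ih =>
    obtain ⟨ih2, ih1, ih0⟩ := ih
    have htr : FormatOk AutomatonSymbol.accept l → ∃ ts : List (ℕ × Option α × ℕ), transition :: l =
        ts.flatMap encodeTransition := by
      intro h
      obtain ⟨k, o, k', ts, rfl⟩ := ih1 h
      exact ⟨(k, o, k') :: ts, by simp [encodeTransition]⟩
    refine ⟨?_, ?_, ?_⟩
    · rintro ⟨s', h1, h2⟩
      cases g with
      | tally =>
        cases h1
        obtain ⟨k, ts, rfl⟩ := ih2 h2
        exact ⟨k + 1, ts, by simp [List.replicate_succ]⟩
      | accept => cases h1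
      | transition =>
        cases h1
        obtain ⟨ts, h⟩ := htr h2
        exact ⟨0, ts, by simpa using h⟩
      | label o => cases h1
    · rintro ⟨s', h1, h2⟩
      cases g with
      | tally =>
        cases h1
        obtain ⟨k, o, k', ts, rfl⟩ := ih1 h2
        exact ⟨k + 1, o, k', ts, by simp [List.replicate_succ]⟩
      | accept => cases h1
      | transition => cases h1
      | label o =>
        cases h1
        obtain ⟨k, ts, rfl⟩ := ih2 h2
        exact ⟨0, o, k, ts, by simp⟩
    · rintro ⟨s', h1, h2⟩
      cases g with
      | tally =>
        cases h1
        obtain ⟨A, rfl⟩ := ih0 h2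
        exact ⟨⟨A.start + 1, A.accept, A.transitions⟩, by simp [encode_eq, List.replicate_succ]⟩
      | accept =>
        cases h1
        obtain ⟨A, rfl⟩ := ih0 h2
        exact ⟨⟨0, A.start :: A.accept, A.transitions⟩, by simp [encode_eq, encodeAccept]⟩
      | transition =>
        cases h1
        obtain ⟨ts, h⟩ := htr h2
        exact ⟨⟨0, [], ts⟩, by simpa [encode_eq] using h.symm⟩
      | label o => cases h1

theorem exists_encode_eq_iff (x : List (AutomatonSymbol α)) :
    (∃ A : Automaton α, A.encode = x) ↔ FormatOk tally x :=
  ⟨fun ⟨A, h⟩ => h ▸ A.formatOk_encode, (exists_of_formatOk x).2.2⟩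

end Automaton


/-! ### Paths in automata -/

namespace εNFA

variable {α σ τ : Type}

/-- Paths as functions of time, the form from which runs and formulas are built. -/
theorem isPath_iff_exists_states (M : εNFA α σ) {s t : σ} {l : List (Option α)} :
    M.IsPath s t l ↔ ∃ st : ℕ → σ, st 0 = s ∧ st l.length = t ∧
      ∀ i o, l[i]? = some o → st (i + 1) ∈ M.step (st i) o := by
  constructor
  · intro h
    induction h with
    | nil s => exact ⟨fun _ => s, rfl, rfl, by simp⟩
    | cons t s u a l hstep _ ih =>
      obtain ⟨st, h0, h1, h2⟩ := ih
      refine ⟨fun i => if i = 0 then s else st (i - 1), by simp, by simpa using h1, ?_⟩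
      intro i o hi
      cases i with
      | zero =>
        simp only [List.getElem?_cons_zero, Option.some.injEq] at hi
        subst hi
        simpa [h0] using hstep
      | succ i => simpa using h2 i o (by simpa using hi)
  · rintro ⟨st, rfl, rfl, h⟩
    induction l generalizing st with
    | nil => simp
    | cons a l ih =>
      refine IsPath.cons _ _ _ _ _ (h 0 a (by simp)) ?_
      have := ih (fun i => st (i + 1)) fun i o hi => h (i + 1) o (by simpa using hi)
      simpa using this

/-- A path may be replaced by a path that does not visit a state twice. -/
theorem exists_isPath_injOn (M : εNFA α σ) {s t : σ} {l : List (Option α)} (h : M.IsPath s t l) :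
    ∃ (l' : List (Option α)) (st : ℕ → σ), st 0 = s ∧ st l'.length = t ∧
      (∀ i o, l'[i]? = some o → st (i + 1) ∈ M.step (st i) o) ∧
      Set.InjOn st (Set.Iic l'.length) := by
  classical
  have hex : ∃ n l, M.IsPath s t l ∧ l.length = n := ⟨_, l, h, rfl⟩
  obtain ⟨l', hl, hlen⟩ := Nat.find_spec hex
  obtain ⟨st, h0, h1, h2⟩ := M.isPath_iff_exists_states.1 hl
  refine ⟨l', st, h0, h1, h2, ?_⟩
  have key : ∀ i j, i < j → j ≤ l'.length → st i ≠ st j := by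
    intro i j hij hj heq
    have hp1 : M.IsPath s (st i) (l'.take i) := by
      refine M.isPath_iff_exists_states.2 ⟨st, h0, ?_, fun k o hk => h2 k o ?_⟩
      · rw [List.length_take, min_eq_left (by omega)]
      · rw [List.getElem?_take] at hk
        split_ifs at hk
        exact hk
    have hp2 : M.IsPath (st i) t (l'.drop j) := by
      refine M.isPath_iff_exists_states.2 ⟨fun k => st (j + k), by simp [heq], ?_, fun k o hk =>
        h2 (j + k) o ?_⟩
      · rw [List.length_drop]
        simp only
        rw [Nat.add_sub_cancel' hj, h1]
      · rwa [List.getElem?_drop] at hk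
    have := Nat.find_min' hex ⟨_, M.isPath_append.2 ⟨_, hp1, hp2⟩, rfl⟩
    rw [← hlen] at this
    simp only [List.length_append, List.length_take, List.length_drop] at this
    omega
  intro i hi j hj heq
  rcases lt_trichotomy i j with hlt | rfl | hlt
  · exact absurd heq (key i j hlt hj)
  · rfl
  · exact absurd heq.symm (key j i hlt hi)

/-- The synchronous product. -/
def prod (M : εNFA α σ) (N : εNFA α τ) : εNFA α (σ × τ) where
  step s o := {s' | s'.1 ∈ M.step s.1 o ∧ s'.2 ∈ N.step s.2 o}
  start := M.start ×ˢ N.start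
  accept := M.accept ×ˢ N.accept

/-- The factors move simultaneously on every label, ε included, so a component that should rest on ε
needs an ε-loop. -/
theorem isPath_prod (M : εNFA α σ) (N : εNFA α τ) {s t : σ} {s' t' : τ} {l : List (Option α)}
    (h : M.IsPath s t l) (h' : N.IsPath s' t' l) : (M.prod N).IsPath (s, s') (t, t') l := by
  obtain ⟨st, h0, h1, h2⟩ := M.isPath_iff_exists_states.1 h
  obtain ⟨st', h0', h1', h2'⟩ := N.isPath_iff_exists_states.1 h'
  exact (M.prod N).isPath_iff_exists_states.2 ⟨fun i => (st i, st' i), by simp [h0, h0'],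
    by simp [h1, h1'], fun i o hi => ⟨h2 i o hi, h2' i o hi⟩⟩

end εNFA

/-! ### Parsing encodings of relations with saturated counters -/

namespace Parser

/-- The last delimiter that was read, and the counters of the current block. -/
abbrev Cfg := Letter × ℕ × ℕ

/-- Reading a letter. The counters saturate at `c`. -/
def move (c : ℕ) : Option Letter → Cfg → Option Cfg
  | none, s => some s
  | some .left, (.right, _, _) => some (.left, 0, 0)
  | some .a, (.left, x, y) => some (.left, min (x + 1) c, y)
  | some .a, (.hash, x, y) => some (.hash, x, min (y + 1) c)
  | some .hash, (.left, x, y) => some (.hash, x, y)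
  | some .right, (.hash, x, y) => some (.right, x, y)
  | _, _ => none

/-- The automaton that parses encodings of relations and remembers the pairs it has read, with
saturated components. -/
def parser (c : ℕ) : εNFA Letter (Cfg × Finset (ℕ × ℕ)) where
  step s o := {s' | move c o s.1 = some s'.1 ∧
    s'.2 = if o = some .right then insert s.1.2 s.2 else s.2}
  start := {((.right, 0, 0), ∅)}
  accept := {s | s.1.1 = .right}

/-- Saturation of a pair. -/
def sat (c : ℕ) (p : ℕ × ℕ) : ℕ × ℕ := (min p.1 c, min p.2 c)

/-- The word `w` is a prefix of an encoding: it consists of the blocks of `xs` and of an incomplete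
block described by the configuration. -/
def Pending (c : ℕ) (xs : List (ℕ × ℕ)) (w : List Letter) : Cfg → Prop
  | (.right, _, _) => w = xs.flatMap block
  | (.left, x, y) => ∃ x', x = min x' c ∧ y = 0 ∧
      w = xs.flatMap block ++ .left :: List.replicate x' .a
  | (.hash, x, y) => ∃ x' y', x = min x' c ∧ y = min y' c ∧
      w = xs.flatMap block ++ .left :: (List.replicate x' .a ++ .hash :: List.replicate y' .a)
  | (.a, _, _) => False

theorem min_succ_min (x c : ℕ) : min (min x c + 1) c = min (x + 1) c := by omega

/-- Soundness of the parser, by induction from the end of the path. Saturation forgets the true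
lengths of the blocks of letters, so they reappear as witnesses in `Pending`. -/
theorem exists_pending (c : ℕ) {l : List (Option Letter)} {s : Cfg × Finset (ℕ × ℕ)}
    (h : (parser c).IsPath ((.right, 0, 0), ∅) s l) :
    ∃ xs, s.2 = (xs.map (sat c)).toFinset ∧ Pending c xs l.reduceOption s.1 := by
  induction l using List.reverseRecOn generalizing s with
  | nil =>
    rw [εNFA.isPath_nil] at h
    subst h
    exact ⟨[], by simp, by simp [Pending]⟩
  | append_singleton l o ih =>
    rw [εNFA.isPath_append] at h
    obtain ⟨r, h1, h2⟩ := h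
    rw [εNFA.isPath_singleton] at h2
    obtain ⟨xs, hxs, hp⟩ := ih h1
    obtain ⟨⟨ph, x, y⟩, R⟩ := r
    obtain ⟨s, S⟩ := s
    obtain ⟨h3, h4⟩ := h2
    simp only at h3 h4 hxs hp
    rw [List.reduceOption_append]
    cases o with
    | none =>
      simp only [move, Option.some.injEq] at h3
      subst h3
      exact ⟨xs, by simpa [h4] using hxs, by simpa using hp⟩
    | some o =>
      cases o <;> cases ph <;> simp only [move, reduceCtorEq, Option.some.injEq] at h3
      · obtain ⟨x', hx, hy, hw⟩ := hp
        subst h3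
        refine ⟨xs, by simpa [h4] using hxs, x' + 1, ?_, hy, ?_⟩
        · rw [hx, min_succ_min]
        · simp [hw, List.reduceOption_singleton, List.replicate_succ']
      · obtain ⟨x', y', hx, hy, hw⟩ := hp
        subst h3
        refine ⟨xs, by simpa [h4] using hxs, x', y' + 1, hx, ?_, ?_⟩
        · rw [hy, min_succ_min]
        · simp [hw, List.reduceOption_singleton, List.replicate_succ']
      · subst h3
        refine ⟨xs, by simpa [h4] using hxs, 0, by simp, rfl, ?_⟩
        have hw : l.reduceOption = xs.flatMap block := hp
        simp [hw, List.reduceOption_singleton]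
      · obtain ⟨x', y', hx, hy, hw⟩ := hp
        subst h3
        refine ⟨xs ++ [(x', y')], ?_, ?_⟩
        · ext p
          simp only [h4, if_true, hxs, hx, hy, Finset.mem_insert, List.mem_toFinset, List.map_append,
            List.map_cons, List.map_nil, List.mem_append, List.mem_singleton, sat]
          exact or_comm
        · show _ = _
          simp [hw, List.reduceOption_singleton, block]
      · obtain ⟨x', hx, hy, hw⟩ := hp
        subst h3
        refine ⟨xs, by simpa [h4] using hxs, x', 0, hx, by simp [hy], ?_⟩
        simp [hw, List.reduceOption_singleton]

/-- The parser has an ε-loop at every state and can therefore follow the labels of any path of `A`,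
wherever its ε-transitions occur. -/
theorem isPath_reduceOption (c : ℕ) {s t : Cfg × Finset (ℕ × ℕ)} {l : List (Option Letter)}
    (h : (parser c).IsPath s t (l.reduceOption.map some)) : (parser c).IsPath s t l := by
  induction l generalizing s with
  | nil => simpa using h
  | cons o l ih =>
    cases o with
    | none => exact .cons s _ _ _ _ ⟨rfl, by simp⟩ (ih (by simpa using h))
    | some o =>
      rw [List.reduceOption_cons_of_some, List.map_cons] at h
      cases h with
      | cons r _ _ _ _ h1 h2 => exact .cons r _ _ _ _ h1 (ih h2)

theorem isPath_replicate_left (c k x y : ℕ) (S : Finset (ℕ × ℕ)) :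
    (parser c).IsPath ((.left, min x c, y), S) ((.left, min (x + k) c, y), S)
      (List.replicate k (some .a)) := by
  induction k generalizing x with
  | zero => simp
  | succ k ih =>
    refine .cons ((.left, min (x + 1) c, y), S) _ _ _ _ ⟨?_, by simp⟩ ?_
    · simp [move, min_succ_min]
    · rw [show x + (k + 1) = x + 1 + k by omega]
      exact ih _

theorem isPath_replicate_hash (c k x y : ℕ) (S : Finset (ℕ × ℕ)) :
    (parser c).IsPath ((.hash, x, min y c), S) ((.hash, x, min (y + k) c), S)
      (List.replicate k (some .a)) := by
  induction k generalizing y with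
  | zero => simp
  | succ k ih =>
    refine .cons ((.hash, x, min (y + 1) c), S) _ _ _ _ ⟨?_, by simp⟩ ?_
    · simp [move, min_succ_min]
    · rw [show y + (k + 1) = y + 1 + k by omega]
      exact ih _

theorem isPath_block (c x y : ℕ) (p : ℕ × ℕ) (S : Finset (ℕ × ℕ)) :
    (parser c).IsPath ((.right, x, y), S) ((.right, sat c p), insert (sat c p) S)
      ((block p).map some) := by
  rw [block, List.map_cons]
  refine .cons ((.left, 0, 0), S) _ _ _ _ ⟨rfl, by simp⟩ ?_
  rw [List.map_append, List.map_replicate, εNFA.isPath_append]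
  refine ⟨((.left, min p.1 c, 0), S), by simpa using isPath_replicate_left c p.1 0 0 S, ?_⟩
  refine .cons ((.hash, min p.1 c, 0), S) _ _ _ _ ⟨rfl, by simp⟩ ?_
  rw [List.map_append, List.map_replicate, εNFA.isPath_append]
  refine ⟨((.hash, min p.1 c, min p.2 c), S),
    by simpa using isPath_replicate_hash c p.2 (min p.1 c) 0 S, ?_⟩
  exact .cons _ _ _ _ _ ⟨rfl, by simp [sat]⟩ (.nil _)

theorem exists_isPath_flatMap (c : ℕ) (xs : List (ℕ × ℕ)) (x y : ℕ) (S : Finset (ℕ × ℕ)) :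
    ∃ x' y', (parser c).IsPath ((.right, x, y), S)
      ((.right, x', y'), S ∪ (xs.map (sat c)).toFinset) ((xs.flatMap block).map some) := by
  induction xs generalizing x y S with
  | nil => exact ⟨x, y, by simp⟩
  | cons p xs ih =>
    obtain ⟨x', y', h⟩ := ih (sat c p).1 (sat c p).2 (insert (sat c p) S)
    refine ⟨x', y', ?_⟩
    rw [List.flatMap_cons, List.map_append, εNFA.isPath_append]
    refine ⟨_, isPath_block c x y p S, ?_⟩
    convert h using 2
    simp [Finset.insert_union]

end Parser


/-! ### Runs of an automaton on encodings of relations -/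

open Parser

/-- An accepting run of `A` of length `T` on the encoding of a relation: the states, the
configurations of the parser and the labels of the transitions as functions of the time. -/
structure IsRun (A : Automaton Letter) (c T : ℕ) (st : ℕ → ℕ) (cfg : ℕ → Cfg)
    (lb : ℕ → Option Letter) : Prop where
  st_zero : st 0 = A.start
  cfg_zero : cfg 0 = (.right, 0, 0)
  step : ∀ t < T, (st t, lb t, st (t + 1)) ∈ A.transitions
  move : ∀ t < T, Parser.move c (lb t) (cfg t) = some (cfg (t + 1))
  accept : st T ∈ A.accept
  complete : (cfg T).1 = .right

/-- The pairs read before the time `T`. -/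
def emitted (cfg : ℕ → Cfg) (lb : ℕ → Option Letter) (T : ℕ) : Finset (ℕ × ℕ) :=
  ((Finset.range T).filter fun t => lb t = some .right).image fun t => (cfg t).2

theorem emitted_succ (cfg : ℕ → Cfg) (lb : ℕ → Option Letter) (T : ℕ) : emitted cfg lb (T + 1) =
    if lb T = some .right then insert (cfg T).2 (emitted cfg lb T) else emitted cfg lb T := by
  unfold emitted
  rw [Finset.range_add_one, Finset.filter_insert]
  split_ifs
  · rw [Finset.image_insert]
  · rfl

theorem mem_emitted {cfg : ℕ → Cfg} {lb : ℕ → Option Letter} {T : ℕ} {p : ℕ × ℕ} :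
    p ∈ emitted cfg lb T ↔ ∃ t < T, lb t = some .right ∧ (cfg t).2 = p := by
  simp [emitted, and_assoc]

theorem Automaton.mem_language_iff (A : Automaton Letter) (w : List Letter) : w ∈ A.language ↔
    ∃ q ∈ A.accept, ∃ l, l.reduceOption = w ∧ A.toεNFA.IsPath A.start q l := by
  unfold Automaton.language
  rw [εNFA.mem_accepts_iff_exists_path]
  constructor
  · rintro ⟨s, t, l, hs, ht, hl, hp⟩
    cases hs
    exact ⟨t, ht, l, hl, hp⟩
  · rintro ⟨t, ht, l, hl, hp⟩
    exact ⟨_, t, l, rfl, ht, hl, hp⟩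

theorem getElem?_map_range {α : Type} (f : ℕ → α) (T i : ℕ) (o : α)
    (h : ((List.range T).map f)[i]? = some o) : i < T ∧ f i = o := by
  rw [List.getElem?_map, Option.map_eq_some_iff] at h
  obtain ⟨j, hj, rfl⟩ := h
  rw [List.getElem?_eq_some_iff] at hj
  obtain ⟨h1, h2⟩ := hj
  simp only [List.length_range, List.getElem_range] at h1 h2
  exact ⟨h1, by rw [h2]⟩

/-- The states and the parser configurations are two paths along the same labels. `exists_pending`
recovers the blocks from the second one, and `h.complete` excludes an unfinished block. -/
theorem IsRun.exists_mem_language {A : Automaton Letter} {c T : ℕ} {st : ℕ → ℕ} {cfg : ℕ → Cfg}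
    {lb : ℕ → Option Letter} (h : IsRun A c T st cfg lb) :
    ∃ xs : List (ℕ × ℕ), xs.flatMap block ∈ A.language ∧
      emitted cfg lb T = (xs.map (sat c)).toFinset := by
  have h1 : A.toεNFA.IsPath A.start (st T) ((List.range T).map lb) := by
    refine A.toεNFA.isPath_iff_exists_states.2 ⟨st, h.st_zero, by simp, fun i o hi => ?_⟩
    obtain ⟨hlt, rfl⟩ := getElem?_map_range _ _ _ _ hi
    exact h.step i hlt
  have h2 : (parser c).IsPath ((.right, 0, 0), ∅) (cfg T, emitted cfg lb T)
      ((List.range T).map lb) := by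
    refine (parser c).isPath_iff_exists_states.2 ⟨fun t => (cfg t, emitted cfg lb t),
      by simp [h.cfg_zero, emitted], by simp, fun i o hi => ?_⟩
    obtain ⟨hlt, rfl⟩ := getElem?_map_range _ _ _ _ hi
    exact ⟨h.move i hlt, emitted_succ cfg lb i⟩
  obtain ⟨xs, hxs, hp⟩ := exists_pending c h2
  refine ⟨xs, (A.mem_language_iff _).2 ⟨st T, h.accept, _, ?_, h1⟩, hxs⟩
  have hc := h.complete
  rcases hT : cfg T with ⟨ph, x, y⟩
  rw [hT] at hp hc
  cases hc
  exact hp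

theorem IsRun.st_le {A : Automaton Letter} {c T : ℕ} {st : ℕ → ℕ} {cfg : ℕ → Cfg}
    {lb : ℕ → Option Letter} (h : IsRun A c T st cfg lb) {t : ℕ} (ht : t ≤ T) :
    st t ≤ A.encode.length := by
  cases t with
  | zero => rw [h.st_zero]; exact A.start_le_length
  | succ t => exact (A.lt_length_of_mem_transitions (h.step t ht)).2

theorem Parser.move_le {c : ℕ} {o : Option Letter} {s s' : Cfg} (h : move c o s = some s')
    (hs : s.2.1 ≤ c ∧ s.2.2 ≤ c) : s'.2.1 ≤ c ∧ s'.2.2 ≤ c := by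
  obtain ⟨ph, x, y⟩ := s
  simp only at hs
  cases o with
  | none =>
    cases h
    exact hs
  | some o =>
    cases o <;> cases ph <;> simp only [move, reduceCtorEq, Option.some.injEq] at h <;> subst h <;>
      simp [hs]

theorem cfg_le {c T : ℕ} {cfg : ℕ → Cfg} {lb : ℕ → Option Letter} (h0 : cfg 0 = (.right, 0, 0))
    (h : ∀ t < T, Parser.move c (lb t) (cfg t) = some (cfg (t + 1))) {t : ℕ} (ht : t ≤ T) :
    (cfg t).2.1 ≤ c ∧ (cfg t).2.2 ≤ c := by
  induction t with
  | zero => simp [h0]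
  | succ t ih => exact Parser.move_le (h t ht) (ih (by omega))

/-- A path without repetitions in the product of `A` and the parser. The product remembers a set of
pairs and has exponentially many states, but along a path this set increases, so it is determined
there by its cardinality. The bound is the product of the numbers of states, delimiters, counter
values and cardinalities. -/
theorem exists_isRun (A : Automaton Letter) (c : ℕ) (xs : List (ℕ × ℕ))
    (h : xs.flatMap block ∈ A.language) :
    ∃ T < (A.encode.length + 1) * 4 * ((c + 1) * (c + 1)) * ((c + 1) * (c + 1) + 1),
      ∃ st cfg lb, IsRun A c T st cfg lb ∧ emitted cfg lb T = (xs.map (sat c)).toFinset := by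
  obtain ⟨q, hq, l, hl, hpath⟩ := (A.mem_language_iff _).1 h
  obtain ⟨x', y', hpath'⟩ := exists_isPath_flatMap c xs 0 0 ∅
  rw [← hl, Finset.empty_union] at hpath'
  obtain ⟨l', s, h0, h1, h2, hinj⟩ := εNFA.exists_isPath_injOn _
    (εNFA.isPath_prod _ _ hpath (isPath_reduceOption c hpath'))
  set T := l'.length with hT
  set st : ℕ → ℕ := fun t => (s t).1
  set cfg : ℕ → Cfg := fun t => (s t).2.1
  set lb : ℕ → Option Letter := fun t => l'.getD t none
  have hlb : ∀ t < T, l'[t]? = some (lb t) := by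
    intro t ht
    simp [lb, List.getD_eq_getElem?_getD, List.getElem?_eq_getElem (hT ▸ ht)]
  have hstep : ∀ t < T, (s (t + 1)).1 ∈ A.toεNFA.step (s t).1 (lb t) ∧
    (s (t + 1)).2 ∈ (parser c).step (s t).2 (lb t) := fun t ht => h2 t _ (hlb t ht)
  have hem : ∀ t ≤ T, (s t).2.2 = emitted cfg lb t := by
    intro t ht
    induction t with
    | zero => simp [h0, emitted]
    | succ t ih =>
      rw [emitted_succ, ← ih (by omega)]
      exact (hstep t ht).2.2
  have hrun : IsRun A c T st cfg lb := by
    refine ⟨by simp [st, h0], by simp [cfg, h0], fun t ht => (hstep t ht).1,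
      fun t ht => (hstep t ht).2.1, by simpa [st, h1] using hq, by simp [cfg, h1]⟩
  have hcfg : ∀ t ≤ T, (cfg t).2.1 ≤ c ∧ (cfg t).2.2 ≤ c :=
    fun t ht => cfg_le hrun.cfg_zero hrun.move ht
  have hmono : Monotone (emitted cfg lb) := by
    refine monotone_nat_of_le_succ fun t => ?_
    rw [emitted_succ]
    split_ifs
    · exact Finset.subset_insert _ _
    · exact le_rfl
  have hcard : ∀ t ≤ T, (emitted cfg lb t).card < (c + 1) * (c + 1) + 1 := by
    intro t ht
    rw [Nat.lt_succ_iff]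
    calc _ ≤ (Finset.range (c + 1) ×ˢ Finset.range (c + 1)).card := by
          refine Finset.card_le_card fun p hp => ?_
          obtain ⟨i, hi, -, rfl⟩ := mem_emitted.1 hp
          have := hcfg i (by omega)
          simp only [Finset.mem_product, Finset.mem_range]
          omega
      _ = _ := by simp
  refine ⟨T, ?_, st, cfg, lb, hrun, ?_⟩
  -- The `T + 1` times are mapped injectively into `U`.
  · set U : Finset (ℕ × Letter × (ℕ × ℕ) × ℕ) := Finset.range (A.encode.length + 1) ×ˢ
      ({.a, .left, .right, .hash} : Finset Letter) ×ˢ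
        (Finset.range (c + 1) ×ˢ Finset.range (c + 1)) ×ˢ Finset.range ((c + 1) * (c + 1) + 1)
      with hU
    have hUc : U.card =
        (A.encode.length + 1) * 4 * ((c + 1) * (c + 1)) * ((c + 1) * (c + 1) + 1) := by
      have : ({.a, .left, .right, .hash} : Finset Letter).card = 4 := rfl
      simp [hU, this, Finset.card_product, mul_assoc]
    rw [← hUc, ← Nat.succ_le_iff, Nat.succ_eq_add_one, ← Finset.card_range (T + 1)]
    refine Finset.card_le_card_of_injOn
      (fun t => (st t, (cfg t).1, (cfg t).2, (emitted cfg lb t).card)) ?_ ?_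
    · intro t ht
      have ht' : t ≤ T := by simpa [Nat.lt_succ_iff] using ht
      have h1 := hrun.st_le ht'
      have h2 := hcfg t ht'
      have h3 := hcard t ht'
      have h4 : (cfg t).1 ∈ ({.a, .left, .right, .hash} : Finset Letter) := by
        cases (cfg t).1 <;> simp
      simp only [hU, SetLike.mem_coe, Finset.mem_product, Finset.mem_range]
      exact ⟨by omega, h4, ⟨by omega, by omega⟩, h3⟩
    · intro t ht t' ht' heq
      have ht1 : t ≤ T := by simpa [Nat.lt_succ_iff] using ht
      have ht1' : t' ≤ T := by simpa [Nat.lt_succ_iff] using ht'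
      simp only [Prod.mk.injEq] at heq
      obtain ⟨e1, e2, e3, e4⟩ := heq
      refine hinj ht1 ht1' ?_
      -- Members of an increasing chain with equal cardinalities coincide.
      have e5 : emitted cfg lb t = emitted cfg lb t' := by
        rcases le_total t t' with hle | hle
        · exact Finset.eq_of_subset_of_card_le (hmono hle) e4.ge
        · exact (Finset.eq_of_subset_of_card_le (hmono hle) e4.le).symm
      exact Prod.ext e1 (Prod.ext (Prod.ext e2 e3) (by rw [hem t ht1, hem t' ht1', e5]))
  · rw [← hem T le_rfl, h1]

/-! ### Pumping -/

namespace Automaton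

/-- The automaton can go from the state `p` to the state `q` reading `w`. -/
def Reads (A : Automaton Letter) (p q : ℕ) (w : List Letter) : Prop :=
  ∃ l, l.reduceOption = w ∧ A.toεNFA.IsPath p q l

variable {A : Automaton Letter} {p q : ℕ}

theorem reads_append {w w' : List Letter} :
    A.Reads p q (w ++ w') ↔ ∃ r, A.Reads p r w ∧ A.Reads r q w' := by
  constructor
  · rintro ⟨l, hl, hp⟩
    obtain ⟨l₁, l₂, rfl, h1, h2⟩ := (List.reduceOption_eq_append_iff _ _ _).1 hl
    obtain ⟨r, hr1, hr2⟩ := (εNFA.isPath_append _).1 hp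
    exact ⟨r, ⟨l₁, h1, hr1⟩, l₂, h2, hr2⟩
  · rintro ⟨r, ⟨l₁, rfl, h1⟩, l₂, rfl, h2⟩
    exact ⟨l₁ ++ l₂, List.reduceOption_append _ _, (εNFA.isPath_append _).2 ⟨r, h1, h2⟩⟩

theorem Reads.le_length {w : List Letter} (h : A.Reads p q w) (hp : p ≤ A.encode.length) :
    q ≤ A.encode.length := by
  obtain ⟨l, -, hl⟩ := h
  induction hl with
  | nil => exact hp
  | cons t s u a l hstep _ ih => exact ih (A.lt_length_of_mem_transitions hstep).2

theorem exists_states_of_reads_replicate {k : ℕ} (h : A.Reads p q (List.replicate k .a)) :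
    ∃ st : ℕ → ℕ, st 0 = p ∧ A.Reads (st k) q [] ∧
      ∀ i < k, A.Reads (st i) (st (i + 1)) [.a] := by
  induction k generalizing p with
  | zero => exact ⟨fun _ => p, rfl, h, by simp⟩
  | succ k ih =>
    rw [List.replicate_succ, ← List.singleton_append] at h
    obtain ⟨r, h1, h2⟩ := reads_append.1 h
    obtain ⟨st, h3, h4, h5⟩ := ih h2
    refine ⟨fun i => if i = 0 then p else st (i - 1), by simp, by simpa using h4, ?_⟩
    intro i hi
    cases i with
    | zero => simpa [h3] using h1
    | succ i => simpa using h5 i (by omega)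

theorem reads_replicate {st : ℕ → ℕ} {k : ℕ} (h : ∀ i < k, A.Reads (st i) (st (i + 1)) [.a])
    {i m : ℕ} (him : i + m ≤ k) : A.Reads (st i) (st (i + m)) (List.replicate m .a) := by
  induction m with
  | zero => exact ⟨[], rfl, .nil _⟩
  | succ m ih =>
    rw [List.replicate_succ']
    exact reads_append.2 ⟨_, ih (by omega), h (i + m) (by omega)⟩

/-- Pigeonhole: more than `A.encode.length + 1` moments, but states at most `A.encode.length`. The
loop between two visits to a state may be run through any number of additional times. -/
theorem reads_pump {k : ℕ} (hp : p ≤ A.encode.length) (hk : A.encode.length < k)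
    (h : A.Reads p q (List.replicate k .a)) :
    ∃ d, 0 < d ∧ ∀ j, A.Reads p q (List.replicate (k + j * d) .a) := by
  obtain ⟨st, h0, h1, h2⟩ := exists_states_of_reads_replicate h
  obtain ⟨i₁, hi₁, i₂, hi₂, hne, heq⟩ := Finset.exists_ne_map_eq_of_card_lt_of_maps_to
    (s := Finset.range (k + 1)) (t := Finset.range (A.encode.length + 1)) (f := st)
    (by simp; omega) (by
      intro i hi
      simp only [Finset.coe_range, Set.mem_Iio] at hi ⊢
      have := (h0 ▸ reads_replicate h2 (i := 0) (m := i) (by omega)).le_length hp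
      rw [zero_add] at this
      omega)
  wlog hlt : i₁ < i₂ generalizing i₁ i₂
  · exact this i₂ hi₂ i₁ hi₁ hne.symm heq.symm (by omega)
  simp only [Finset.mem_range] at hi₁ hi₂
  refine ⟨i₂ - i₁, by omega, fun j => ?_⟩
  have hloop : A.Reads (st i₁) (st i₁) (List.replicate (j * (i₂ - i₁)) .a) := by
    induction j with
    | zero => exact ⟨[], by simp, .nil _⟩
    | succ j ih =>
      rw [Nat.succ_mul, List.replicate_add]
      refine reads_append.2 ⟨_, ih, ?_⟩
      have := reads_replicate h2 (i := i₁) (m := i₂ - i₁) (by omega)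
      rwa [Nat.add_sub_cancel' hlt.le, ← heq] at this
  have hpre : A.Reads p (st i₁) (List.replicate i₁ .a) := by
    have := reads_replicate h2 (i := 0) (m := i₁) (by omega)
    rwa [h0, zero_add] at this
  have hsuf : A.Reads (st i₁) q (List.replicate (k - i₁) .a) := by
    have := reads_replicate h2 (i := i₁) (m := k - i₁) (by omega)
    rw [Nat.add_sub_cancel' (by omega)] at this
    rw [← List.append_nil (List.replicate _ _)]
    exact reads_append.2 ⟨_, this, h1⟩
  rw [show k + j * (i₂ - i₁) = i₁ + (j * (i₂ - i₁) + (k - i₁)) by omega, List.replicate_add,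
    List.replicate_add]
  exact reads_append.2 ⟨_, hpre, reads_append.2 ⟨_, hloop, hsuf⟩⟩

theorem mem_language_iff_reads {w : List Letter} :
    w ∈ A.language ↔ ∃ q ∈ A.accept, A.Reads A.start q w := A.mem_language_iff w

/-- A long segment of letters `a` in an accepted word may be replaced by arbitrarily long ones. -/
theorem exists_mem_language_replicate {k : ℕ} (hk : A.encode.length < k) {u v : List Letter}
    (h : u ++ (List.replicate k .a ++ v) ∈ A.language) (N : ℕ) :
    ∃ m, N ≤ m ∧ u ++ (List.replicate m .a ++ v) ∈ A.language := by
  obtain ⟨q, hq, h⟩ := mem_language_iff_reads.1 h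
  obtain ⟨r, h1, h⟩ := reads_append.1 h
  obtain ⟨r', h2, h3⟩ := reads_append.1 h
  obtain ⟨d, hd, h4⟩ := reads_pump (h1.le_length A.start_le_length) hk h2
  refine ⟨k + N * d, by nlinarith, mem_language_iff_reads.2 ⟨q, hq, ?_⟩⟩
  exact reads_append.2 ⟨_, h1, reads_append.2 ⟨_, h4 N, h3⟩⟩

end Automaton

/-- If a long number occurs in an accepted encoding, then there is an accepted encoding which
contains a large number exactly once. -/
theorem exists_pumped {A : Automaton Letter} {xs : List (ℕ × ℕ)} (h : xs.flatMap block ∈ A.language)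
    {p : ℕ × ℕ} (hp : p ∈ xs) (hlarge : A.encode.length < p.1 ∨ A.encode.length < p.2) :
    ∃ (ys zs : List (ℕ × ℕ)) (y : ℕ), xs = ys ++ p :: zs ∧ ∀ N, ∃ m, N ≤ m ∧
      ((ys ++ (m, y) :: zs).flatMap block ∈ A.language ∨
        (ys ++ (y, m) :: zs).flatMap block ∈ A.language) := by
  obtain ⟨ys, zs, rfl⟩ := List.append_of_mem hp
  obtain ⟨x, y⟩ := p
  rcases hlarge with hl | hl
  · refine ⟨ys, zs, y, rfl, fun N => ?_⟩
    obtain ⟨m, hm, hmem⟩ := Automaton.exists_mem_language_replicate (A := A) hl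
      (u := ys.flatMap block ++ [.left])
      (v := .hash :: (List.replicate y .a ++ .right :: zs.flatMap block)) (by simpa [block] using h) N
    exact ⟨m, hm, Or.inl (by simpa [block] using hmem)⟩
  · refine ⟨ys, zs, x, rfl, fun N => ?_⟩
    obtain ⟨m, hm, hmem⟩ := Automaton.exists_mem_language_replicate (A := A) hl
      (u := ys.flatMap block ++ (.left :: (List.replicate x .a ++ [.hash])))
      (v := .right :: zs.flatMap block) (by simpa [block] using h) N
    exact ⟨m, hm, Or.inr (by simpa [block] using hmem)⟩


/-! ### Degree sets of graphs -/

open Parser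

/-- The set of the degrees of the vertices. -/
def NatGraph.degs (G : NatGraph) : Set ℕ := {d | ∃ v : G.verts, (G.graph.neighborSet v).ncard = d}

/-- The set of numbers that represents a binary word. -/
def wordDegs (w : List Bool) : Set ℕ := {d | ∃ i b, w[i]? = some b ∧ d = 2 * i + 2 + b.toNat}

/-- The graphs that have a vertex of degree one, or whose degree set represents a word of `X`. -/
def degGraphs (X : Language Bool) : Set NatGraph :=
  {G | 1 ∈ G.degs ∨ ∃ w ∈ X, G.degs = wordDegs w}

theorem NatGraph.degs_subset_of_iso {G H : NatGraph} (e : G.graph ≃g H.graph) :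
    G.degs ⊆ H.degs := by
  rintro d ⟨v, rfl⟩
  refine ⟨e v, ?_⟩
  rw [← Nat.card_coe_set_eq, ← Nat.card_coe_set_eq]
  exact (Nat.card_congr (e.mapNeighborSet v)).symm

theorem isoClosed_degGraphs (X : Language Bool) : IsoClosed (degGraphs X) := by
  rintro G H hG ⟨e⟩
  have : G.degs = H.degs :=
    (NatGraph.degs_subset_of_iso e).antisymm (NatGraph.degs_subset_of_iso e.symm)
  show _ ∨ _
  rw [← this]
  exact hG

/-- The code of a letter determines its position and its value, because the pairs {2i + 2, 2i + 3}
are disjoint. -/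
theorem wordDegs_injective : Function.Injective wordDegs := by
  have key : ∀ w w' : List Bool, wordDegs w = wordDegs w' → ∀ (i : ℕ) (b : Bool), w[i]? = some b →
      w'[i]? = some b := by
    intro w w' h i b hi
    have h1 : 2 * i + 2 + b.toNat ∈ wordDegs w' := h ▸ ⟨i, b, hi, rfl⟩
    obtain ⟨j, b', hj, he⟩ := h1
    have h2 : b.toNat ≤ 1 := Bool.toNat_le b
    have h3 : b'.toNat ≤ 1 := Bool.toNat_le b'
    have h4 : j = i := by omega
    have h5 : b = b' := by
      cases b <;> cases b' <;> simp_all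
    rw [h5, ← h4, hj]
  intro w w' h
  refine List.ext_getElem? fun i => ?_
  cases hi : w[i]? with
  | some b => exact (key w w' h i b hi).symm
  | none =>
    cases hi' : w'[i]? with
    | none => rfl
    | some b => rw [key w' w h.symm i b hi'] at hi; cases hi

theorem one_notMem_wordDegs (w : List Bool) : 1 ∉ wordDegs w := by
  rintro ⟨i, b, -, h⟩
  omega

/-- The number `v` occurs in the relation `R`. -/
def IsVert (R : Finset (ℕ × ℕ)) (v : ℕ) : Prop := ∃ p ∈ R, p.1 = v ∨ p.2 = v

/-- The neighbours of `v` in the graph of the relation `R`. -/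
def nbrs (R : Finset (ℕ × ℕ)) (v : ℕ) : Set ℕ := {u | v ≠ u ∧ ((v, u) ∈ R ∨ (u, v) ∈ R)}

/-- Replaces the subtype of vertices by conditions on numbers, on which both pumping and formulas
operate. -/
theorem degs_graphOf (R : Finset (ℕ × ℕ)) :
    (graphOf R).degs = {d | ∃ v, IsVert R v ∧ (nbrs R v).ncard = d} := by
  have hv : ∀ v, v ∈ (graphOf R).verts ↔ IsVert R v := by
    intro v
    simp only [graphOf, Finset.mem_union, Finset.mem_image, IsVert]
    constructor
    · rintro (⟨p, h1, h2⟩ | ⟨p, h1, h2⟩)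
      · exact ⟨p, h1, Or.inl h2⟩
      · exact ⟨p, h1, Or.inr h2⟩
    · rintro ⟨p, h1, h2 | h2⟩
      · exact Or.inl ⟨p, h1, h2⟩
      · exact Or.inr ⟨p, h1, h2⟩
  have hn : ∀ v : (graphOf R).verts, ((graphOf R).graph.neighborSet v).ncard =
      (nbrs R (v : ℕ)).ncard := by
    intro v
    rw [← Set.ncard_image_of_injective _ Subtype.val_injective]
    congr 1
    ext u
    simp only [Set.mem_image, SimpleGraph.mem_neighborSet, nbrs, Set.mem_ofPred_eq]
    constructor
    · rintro ⟨u', h, rfl⟩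
      have h' := (SimpleGraph.fromRel_adj _ _ _).1 h
      exact ⟨fun he => h'.1 (Subtype.ext he), h'.2⟩
    · rintro ⟨h1, h2⟩
      refine ⟨⟨u, (hv u).2 ?_⟩, ?_, rfl⟩
      · rcases h2 with h2 | h2
        · exact ⟨_, h2, Or.inr rfl⟩
        · exact ⟨_, h2, Or.inl rfl⟩
      · exact (SimpleGraph.fromRel_adj _ _ _).2 ⟨fun he => h1 (congrArg Subtype.val he), h2⟩
  ext d
  simp only [NatGraph.degs, Set.mem_ofPred_eq, hn]
  constructor
  · rintro ⟨v, h⟩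
    exact ⟨v, (hv _).1 v.2, h⟩
  · rintro ⟨v, h1, h2⟩
    exact ⟨⟨v, (hv _).2 h1⟩, h2⟩

theorem mem_NRR_iff (𝒢 : Set NatGraph) (x : List (AutomatonSymbol Letter)) :
    x ∈ NRR (graphLanguage 𝒢) ↔ ∃ A : Automaton Letter, A.encode = x ∧
      ∃ xs : List (ℕ × ℕ), xs.flatMap block ∈ A.language ∧ graphOf xs.toFinset ∈ 𝒢 := by
  constructor
  · rintro ⟨A, rfl, u, ⟨R, hR, xs, rfl, rfl⟩, hu⟩
    exact ⟨A, rfl, xs, hu, hR⟩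
  · rintro ⟨A, rfl, xs, hu, hR⟩
    exact ⟨A, rfl, _, ⟨_, hR, xs, rfl, rfl⟩, hu⟩

/-- The number `m` occurs only together with `y`, its one neighbour. The case `m = y` must be
excluded because a loop yields no edge. -/
theorem one_mem_degs_of_fresh {R : Finset (ℕ × ℕ)} {m y : ℕ}
    (hmem : (m, y) ∈ R ∨ (y, m) ∈ R) (hy : m ≠ y)
    (h : ∀ p ∈ R, p.1 = m ∨ p.2 = m → p = (m, y) ∨ p = (y, m)) : 1 ∈ (graphOf R).degs := by
  rw [degs_graphOf]
  refine ⟨m, ?_, ?_⟩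
  · rcases hmem with hmem | hmem
    · exact ⟨_, hmem, Or.inl rfl⟩
    · exact ⟨_, hmem, Or.inr rfl⟩
  · rw [Set.ncard_eq_one]
    refine ⟨y, ?_⟩
    ext u
    simp only [nbrs, Set.mem_ofPred_eq, Set.mem_singleton_iff]
    constructor
    · rintro ⟨h1, h2 | h2⟩
      · have := h _ h2 (Or.inl rfl)
        simp only [Prod.mk.injEq] at this
        omega
      · have := h _ h2 (Or.inr rfl)
        simp only [Prod.mk.injEq] at this
        omega
    · rintro rfl
      exact ⟨hy, hmem⟩

/-- The heart of the upper bound: an accepted encoding with a large number is pumped until this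
number is fresh, and a fresh number has degree one. Nothing about the rest of the graph matters. -/
theorem exists_one_mem_degs {A : Automaton Letter} {xs : List (ℕ × ℕ)}
    (h : xs.flatMap block ∈ A.language) {p : ℕ × ℕ} (hp : p ∈ xs)
    (hlarge : A.encode.length < p.1 ∨ A.encode.length < p.2) :
    ∃ xs' : List (ℕ × ℕ), xs'.flatMap block ∈ A.language ∧ 1 ∈ (graphOf xs'.toFinset).degs := by
  obtain ⟨ys, zs, y, -, hpump⟩ := exists_pumped h hp hlarge
  -- The sum exceeds every number of the other pairs, and `y` is the partner of the pumped number in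
  -- its own pair.
  obtain ⟨m, hm, hmem⟩ := hpump (y + ((ys ++ zs).map fun p => p.1 + p.2).sum + 1)
  have hsum : ∀ p ∈ ys ++ zs, p.1 + p.2 < m := by
    intro p hp
    have := List.single_le_sum (l := (ys ++ zs).map fun p => p.1 + p.2) (by simp) _
      (List.mem_map.2 ⟨p, hp, rfl⟩)
    omega
  rcases hmem with hmem | hmem
  · refine ⟨_, hmem, one_mem_degs_of_fresh (m := m) (y := y) (by simp) (by omega) ?_⟩
    intro q hq hqm
    have hq' : q ∈ ys ++ zs ∨ q = (m, y) := by
      simp only [List.mem_toFinset, List.mem_append, List.mem_cons] at hq ⊢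
      tauto
    rcases hq' with hq' | hq'
    · have := hsum q hq'
      omega
    · exact Or.inl hq'
  · refine ⟨_, hmem, one_mem_degs_of_fresh (m := m) (y := y) (by simp) (by omega) ?_⟩
    intro q hq hqm
    have hq' : q ∈ ys ++ zs ∨ q = (y, m) := by
      simp only [List.mem_toFinset, List.mem_append, List.mem_cons] at hq ⊢
      tauto
    rcases hq' with hq' | hq'
    · have := hsum q hq'
      omega
    · exact Or.inr hq'

/-- A saturated value below `c` has not been truncated. -/
theorem toFinset_map_sat {c : ℕ} {xs : List (ℕ × ℕ)}
    (h : ∀ p ∈ (xs.map (sat c)).toFinset, p.1 < c ∧ p.2 < c) :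
    (xs.map (sat c)).toFinset = xs.toFinset := by
  have : xs.map (sat c) = xs.map id := by
    refine List.map_congr_left fun p hp => ?_
    have := h (sat c p) (List.mem_toFinset.2 (List.mem_map_of_mem hp))
    simp only [sat] at this ⊢
    exact Prod.ext (by simp; omega) (by simp; omega)
  rw [this, List.map_id]

/-- The left-hand side is the bound of `exists_isRun` for counters that saturate at n + 1. The
exponent 8 is generous, and as a power of two it is reached by repeated squaring. -/
theorem run_bound (n : ℕ) :
    (n + 1) * 4 * ((n + 1 + 1) * (n + 1 + 1)) * ((n + 1 + 1) * (n + 1 + 1) + 1) ≤ (n + 4) ^ 8 := by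
  calc _ ≤ (n + 4) * (n + 4) * ((n + 4) * (n + 4)) * ((n + 4) * (n + 4) * (n + 4) * (n + 4)) := by
        gcongr ?_ * ?_ * (?_ * ?_) * ?_
        · omega
        · omega
        · omega
        · omega
        · nlinarith
    _ = _ := by ring

/-- The regular realizability problem in terms of short runs with saturated counters. -/
theorem mem_NRR_degGraphs_iff (X : Language Bool)
    (x : List (AutomatonSymbol Letter)) :
    x ∈ NRR (graphLanguage (degGraphs X)) ↔ ∃ A : Automaton Letter, A.encode = x ∧
      ∃ T < (x.length + 4) ^ 8, ∃ st cfg lb, IsRun A (x.length + 1) T st cfg lb ∧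
        (((∃ p ∈ emitted cfg lb T, x.length < p.1 ∨ x.length < p.2) ∨
          1 ∈ (graphOf (emitted cfg lb T)).degs) ∨
        ((∀ p ∈ emitted cfg lb T, p.1 ≤ x.length ∧ p.2 ≤ x.length) ∧
          ∃ w ∈ X, (graphOf (emitted cfg lb T)).degs = wordDegs w)) := by
  rw [mem_NRR_iff]
  constructor
  · rintro ⟨A, rfl, xs, hxs, hG⟩
    obtain ⟨T, hT, st, cfg, lb, hrun, hem⟩ := exists_isRun A (A.encode.length + 1) xs hxs
    refine ⟨A, rfl, T, hT.trans_le (run_bound _), st, cfg, lb, hrun, ?_⟩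
    -- The counters saturate at n + 1, so exceeding n is still visible, and all numbers up to n are
    -- exact.
    by_cases hl : ∃ p ∈ emitted cfg lb T, A.encode.length < p.1 ∨ A.encode.length < p.2
    · exact Or.inl (Or.inl hl)
    · push Not at hl
      have hS : emitted cfg lb T = xs.toFinset := by
        rw [hem, toFinset_map_sat]
        intro p hp
        have := hl p (hem ▸ hp)
        omega
      rw [← hS] at hG
      rcases hG with hG | hG
      · exact Or.inl (Or.inr hG)
      · exact Or.inr ⟨hl, hG⟩
  · rintro ⟨A, rfl, T, -, st, cfg, lb, hrun, h⟩
    obtain ⟨xs, hxs, hem⟩ := hrun.exists_mem_language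
    by_cases hl : ∃ p ∈ emitted cfg lb T, A.encode.length < p.1 ∨ A.encode.length < p.2
    · obtain ⟨p, hp, hl⟩ := hl
      rw [hem, List.mem_toFinset, List.mem_map] at hp
      obtain ⟨p, hp, rfl⟩ := hp
      -- A saturated component above n comes from a true component above n.
      obtain ⟨xs', h1, h2⟩ := exists_one_mem_degs hxs hp (by simp only [sat] at hl; omega)
      exact ⟨A, rfl, xs', h1, Or.inl h2⟩
    · refine ⟨A, rfl, xs, hxs, ?_⟩
      have hS : emitted cfg lb T = xs.toFinset := by
        rw [hem, toFinset_map_sat]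
        intro p hp
        rw [← hem] at hp
        push Not at hl
        have := hl p hp
        omega
      rw [← hS]
      rcases h with (h | h) | h
      · exact absurd h hl
      · exact Or.inl h
      · exact Or.inr h.2


/-! ### Derived connectives -/

namespace Fm

variable {V G : Type}

/-- Disjunction. -/
def or (φ ψ : Fm V G) : Fm V G := not (and (not φ) (not ψ))

/-- Implication. -/
def imp (φ ψ : Fm V G) : Fm V G := not (and φ (not ψ))

/-- Universal quantification over unary strings. -/
def allU (v b : V) (φ : Fm V G) : Fm V G := not (exU v b (not φ))

/-- The length of `v` is at most the value of the term. -/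
def le (v : V) (T : List (List V)) : Fm V G := get v T none

/-- The length of `v` is the successor of the value of the term `T`. -/
def eqSucc (v : V) (T : List (List V)) : Fm V G := and (le v ([] :: T)) (not (le v T))

/-- A false formula. -/
def falsum (v : V) : Fm V G := and (get v [] none) (not (get v [] none))

/-- The disjunction of a list of formulas; the variable `v` is irrelevant. -/
def orAll (v : V) : List (Fm V G) → Fm V G
  | [] => falsum v
  | φ :: l => or φ (orAll v l)

variable [DecidableEq V] [Inhabited G] {e : V → List G} {φ ψ : Fm V G} {v b : V}
  {T : List (List V)}

theorem sat_or : (or φ ψ).Sat e ↔ φ.Sat e ∨ ψ.Sat e := by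
  simp only [or, Sat]; tauto

theorem sat_imp : (imp φ ψ).Sat e ↔ (φ.Sat e → ψ.Sat e) := by
  simp only [imp, Sat]; tauto

theorem sat_allU : (allU v b φ).Sat e ↔
    ∀ i < (e b).length, φ.Sat (Function.update e v (List.replicate i default)) := by
  simp only [allU, Sat]; push Not; rfl

/-- A string has no symbol at a position exactly when the position is not less than its length, so
comparison is a special case of reading. -/
theorem sat_le : (le v T).Sat e ↔ (e v).length ≤ termVal e T := by
  simp [le, Sat]

/-- The empty product has the value one, so `[] :: T` stands for the successor of `T`. -/
theorem sat_eqSucc : (eqSucc v T).Sat e ↔ (e v).length = termVal e T + 1 := by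
  simp only [eqSucc, Sat, sat_le, termVal, List.map_cons, List.sum_cons, monoVal, List.map_nil,
    List.prod_nil]
  omega

theorem sat_orAll {l : List (Fm V G)} : (orAll v l).Sat e ↔ ∃ φ ∈ l, φ.Sat e := by
  induction l with
  | nil => simp [orAll, falsum, Sat]
  | cons φ l ih => simp [orAll, sat_or, ih]

end Fm

/-! ### Formulas about automata and their runs -/

instance : Inhabited (AutomatonSymbol Letter) := ⟨.tally⟩

/-- The list of all the symbols. -/
def AutomatonSymbol.all : List (AutomatonSymbol Letter) :=
  [.tally, .accept, .transition, .label none, .label (some .a), .label (some .left),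
    .label (some .right), .label (some .hash)]

theorem AutomatonSymbol.mem_all (g : AutomatonSymbol Letter) : g ∈ AutomatonSymbol.all := by
  rcases g with _ | _ | _ | (_ | (_ | _ | _ | _)) <;> simp [AutomatonSymbol.all]

instance : Fintype (AutomatonSymbol Letter) :=
  ⟨AutomatonSymbol.all.toFinset, fun g => List.mem_toFinset.2 g.mem_all⟩

/-- The variables of the formulas. -/
inductive Var
  | inp | bnd | bnd2 | w
  | Q | X | Y | P | L | F | Z
  | T | t | v | u | u' | i | i' | k | q | q' | x | x' | y | y' | d | m
  deriving DecidableEq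

instance : Fintype Var :=
  ⟨{.inp, .bnd, .bnd2, .w, .Q, .X, .Y, .P, .L, .F, .Z, .T, .t, .v, .u, .u', .i, .i', .k, .q, .q',
    .x, .x', .y, .y', .d, .m}, by intro a; cases a <;> decide⟩

namespace RunFm

open Fm Var AutomatonSymbol Automaton

/-- The symbols of descriptions of automata. -/
abbrev Sym := AutomatonSymbol Letter

/-- Formulas about descriptions of automata. -/
abbrev Formula := Fm Var Sym

/-- The entry of the matrix `f` with `B` columns is marked. -/
def Rel (f : List Sym) (B j n : ℕ) : Prop := f[j * B + n]? = some tally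

/-- The entry of `f` in the row `a` and the column `b` is marked. -/
def rel (f a b : Var) : Formula := get f [[a, bnd], [b]] (some tally)

/-- The entry of `f` in the row after `a` and the column `b` is marked. -/
def relSucc (f a b : Var) : Formula := get f [[a, bnd], [bnd], [b]] (some tally)

/-- Every row of `f` has at most one mark. -/
def func (f : Var) : Formula :=
  allU i bnd <| allU u bnd <| allU u' bnd <| imp (rel f i u) <| imp (rel f i u') <|
    and (le u [[u']]) (le u' [[u]])

/-- The transition `(q, o, q')` stands at the position `k` of the input. -/
def transF (o : Option Letter) : Formula :=
  and (get inp [[k]] (some transition)) <|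
  and (allU i bnd (imp (not (le q [[i]])) (get inp [[k], [], [i]] (some tally)))) <|
  and (get inp [[k], [], [q]] (some (label o))) <|
  and (allU i bnd (imp (not (le q' [[i]])) (get inp [[k], [q], [], [], [i]] (some tally)))) <|
  not (get inp [[k], [q], [], [], [q']] (some tally))

/-- The accepting state `q` stands at the position `k` of the input. -/
def accF : Formula :=
  and (get inp [[k]] (some AutomatonSymbol.accept)) <|
  and (allU i bnd (imp (not (le q [[i]])) (get inp [[k], [], [i]] (some tally)))) <|
  not (get inp [[k], [], [q]] (some tally))

/-- The initial state is `q`. -/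
def startF : Formula :=
  and (allU i bnd (imp (not (le q [[i]])) (get inp [[i]] (some tally)))) <|
  not (get inp [[q]] (some tally))

/-- The changes of a counter. -/
inductive Upd
  | keep | zero | inc

/-- The new value of a counter. -/
def Upd.val (c : ℕ) : Upd → ℕ → ℕ
  | keep, n => n
  | zero, _ => 0
  | inc, n => min (n + 1) c

/-- The counter `b` results from `a`. -/
def Upd.fm (a b : Var) : Upd → Formula
  | keep => and (le a [[b]]) (le b [[a]])
  | zero => le b []
  | inc => or (and (le a [[inp]]) (eqSucc b [[a]])) (and (not (le a [[inp]])) (eqSucc b [[inp]]))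

/-- The moves of the parser: the letter, the old and the new delimiter, and the changes of the
counters. -/
def moves : List (Option Letter × Letter × Letter × Upd × Upd) :=
  [(none, .right, .right, .keep, .keep), (none, .left, .left, .keep, .keep),
    (none, .hash, .hash, .keep, .keep), (none, .a, .a, .keep, .keep),
    (some .left, .right, .left, .zero, .zero), (some .a, .left, .left, .inc, .keep),
    (some .a, .hash, .hash, .keep, .inc), (some .hash, .left, .hash, .keep, .keep),
    (some .right, .hash, .right, .keep, .keep)]

/-- The step function of the parser as a finite table, which becomes a finite disjunction in the
formula. -/
theorem move_eq_some_iff {c : ℕ} {o : Option Letter} {ph ph' : Letter} {x y x' y' : ℕ} :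
    Parser.move c o (ph, x, y) = some (ph', x', y') ↔
      ∃ a b, (o, ph, ph', a, b) ∈ moves ∧ x' = a.val c x ∧ y' = b.val c y := by
  constructor
  · intro h
    rcases o with _ | (_ | _ | _ | _) <;> rcases ph with _ | _ | _ | _ <;>
      simp only [Parser.move, reduceCtorEq, Option.some.injEq, Prod.mk.injEq] at h <;>
      obtain ⟨rfl, rfl, rfl⟩ := h
    all_goals first
      | exact ⟨.keep, .keep, by simp [moves], rfl, rfl⟩
      | exact ⟨.zero, .zero, by simp [moves], rfl, rfl⟩
      | exact ⟨.inc, .keep, by simp [moves], rfl, rfl⟩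
      | exact ⟨.keep, .inc, by simp [moves], rfl, rfl⟩
  · rintro ⟨a, b, h, rfl, rfl⟩
    simp only [moves, List.mem_cons, Prod.mk.injEq, List.not_mem_nil, or_false] at h
    rcases h with h | h | h | h | h | h | h | h | h <;> obtain ⟨rfl, rfl, rfl, rfl, rfl⟩ := h <;> rfl

/-- The step of the run at the time `t` is the given one. -/
def moveF (a : Option Letter × Letter × Letter × Upd × Upd) : Formula :=
  and (get L [[t]] (some (label a.1))) <|
  and (get P [[t]] (some (label (some a.2.1)))) <|
  and (get P [[t], []] (some (label (some a.2.2.1)))) <|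
  and (a.2.2.2.1.fm x x') <| and (a.2.2.2.2.fm y y') (transF a.1)

/-- The run makes a step at the time `t`. -/
def stepF : Formula :=
  exU q bnd <| exU q' bnd <| exU x bnd <| exU x' bnd <| exU y bnd <| exU y' bnd <| exU k bnd <|
    and (rel Q t q) <| and (relSucc Q t q') <| and (rel X t x) <| and (relSucc X t x') <|
    and (rel Y t y) <| and (relSucc Y t y') <| orAll inp (moves.map moveF)

/-- The strings describe an accepting run. -/
def runF : Formula :=
  and (func Q) <| and (func X) <| and (func Y) <|
  and (get X [] (some tally)) <| and (get Y [] (some tally)) <|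
  and (get P [] (some (label (some .right)))) <|
  and (exU q bnd (and (get Q [[q]] (some tally)) startF)) <|
  and (allU t bnd (imp (not (le T [[t]])) stepF)) <|
  and (get P [[T]] (some (label (some .right)))) <|
  exU q bnd <| exU k bnd (and (rel Q T q) accF)

/-- The transitions of the automaton that checks the format. -/
def formatTable : List (Sym × Sym × Sym) :=
  AutomatonSymbol.all.flatMap fun s => AutomatonSymbol.all.filterMap fun g =>
    (formatStep s g).map fun s' => (s, g, s')

/-- The input is a description of an automaton. -/
def formatF : Formula :=
  exS Z bnd <| and (get Z [] (some tally)) <|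
  and (allU i inp (orAll inp (formatTable.map fun a =>
    and (get Z [[i]] (some a.1)) <| and (get inp [[i]] (some a.2.1)) <|
      get Z [[i], []] (some a.2.2)))) <|
  not (get Z [[inp]] (some AutomatonSymbol.accept))

/-- The run reads the pair `(a, b)`. -/
def emitF (a b : Var) : Formula :=
  exU t bnd <| and (not (le T [[t]])) <| and (get L [[t]] (some (label (some .right)))) <|
    and (rel X t a) (rel Y t b)

/-- The run reads a pair that contains `v`. -/
def vertF : Formula := exU u bnd (or (emitF v u) (emitF u v))

/-- The run reads a large number. -/
def bigF : Formula := exU v bnd (and vertF (not (le v [[inp]])))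

/-- The vertices `v` and `b` are adjacent. -/
def adjF (b : Var) : Formula :=
  and (not (and (le v [[b]]) (le b [[v]]))) (or (emitF v b) (emitF b v))

/-- There is a vertex of degree one. -/
def leafF : Formula :=
  exU v bnd <| exU u bnd <| and (adjF u) <|
    allU u' bnd (imp (adjF u') (and (le u [[u']]) (le u' [[u]])))

/-- The degree of `v` is `d`. -/
def degF : Formula :=
  exS F bnd2 <| and (func F) <|
  and (allU i bnd <| allU i' bnd <| allU u bnd <| imp (rel F i u) <| imp (rel F i' u) <|
    and (le i [[i']]) (le i' [[i]])) <|
  and (allU i bnd <| allU u bnd <| imp (rel F i u) <| and (not (le d [[i]])) (adjF u)) <|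
  and (allU i bnd <| imp (not (le d [[i]])) <| exU u bnd (rel F i u)) <|
  allU u bnd <| imp (adjF u) <| exU i bnd (rel F i u)

/-- The number `d` represents a letter of the word `w`. -/
def letterF : Formula :=
  exU i bnd <| or (and (get w [[i]] (some tally)) (eqSucc d [[i], [i], []]))
    (and (get w [[i]] (some AutomatonSymbol.accept)) (eqSucc d [[i], [i], [], []]))

/-- The string `w` is a binary word, not longer than the input, with a padding. -/
def wordF : Formula :=
  exU m bnd <| and (le m [[inp]]) <| allU i bnd <|
    and (imp (not (le m [[i]]))
      (or (get w [[i]] (some tally)) (get w [[i]] (some AutomatonSymbol.accept)))) <|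
    imp (le m [[i]])
      (and (not (get w [[i]] (some tally))) (not (get w [[i]] (some AutomatonSymbol.accept))))

/-- The degree set represents the word `w`. -/
def degsF : Formula :=
  and (allU v bnd <| imp vertF <| exU d bnd <| and degF letterF) <|
  allU d bnd <| imp letterF <| exU v bnd <| and vertF degF

/-- There is an accepting run with the given property. -/
def existsRun (φ : Formula) : Formula :=
  and formatF <| exS Q bnd2 <| exS X bnd2 <| exS Y bnd2 <| exS P bnd <| exS L bnd <| exU T bnd <|
    and runF φ

/-- There is a run that reads a large number or produces a vertex of degree one. -/
def freshF : Formula := existsRun (or bigF leafF)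

/-- There is a run that reads small numbers and a graph with the degree set given by `w`. -/
def codeF : Formula := existsRun (and (not bigF) (and wordF degsF))

/-- The requirements of the evaluator on variables are syntactic and can be checked by computation.
-/
theorem ok_freshF : freshF.Ok = true := by decide

theorem ok_codeF : codeF.Ok = true := by decide

theorem bound_freshF : ∀ a ∈ freshF.bound, a ≠ inp ∧ a ≠ bnd ∧ a ≠ bnd2 := by decide

theorem bound_codeF : ∀ a ∈ codeF.bound, a ≠ inp ∧ a ≠ bnd ∧ a ≠ bnd2 ∧ a ≠ w := by decide

end RunFm


/-! ### Semantics of the formulas -/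

namespace RunFm

open Fm Automaton

variable {e : Var → List Sym}

theorem termVal_nil : termVal e [] = 0 := rfl

theorem termVal_cons (p : List Var) (l : List (List Var)) :
    termVal e (p :: l) = monoVal e p + termVal e l := rfl

theorem monoVal_nil : monoVal e [] = 1 := rfl

theorem monoVal_cons (a : Var) (p : List Var) : monoVal e (a :: p) = (e a).length * monoVal e p :=
  rfl

theorem sat_get {s : Var} {T : List (List Var)} {o : Option Sym} :
    (get s T o).Sat e ↔ (e s)[termVal e T]? = o := Iff.rfl

theorem sat_not {φ : Formula} : φ.not.Sat e ↔ ¬ φ.Sat e := Iff.rfl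

theorem sat_and {φ ψ : Formula} : (φ.and ψ).Sat e ↔ φ.Sat e ∧ ψ.Sat e := Iff.rfl

theorem sat_exU {a b : Var} {φ : Formula} : (exU a b φ).Sat e ↔
    ∃ i < (e b).length, φ.Sat (Function.update e a (List.replicate i default)) := Iff.rfl

theorem sat_exS {a b : Var} {φ : Formula} : (exS a b φ).Sat e ↔
    ∃ l : List Sym, l.length = (e b).length ∧ φ.Sat (Function.update e a l) := Iff.rfl

theorem sat_rel {f a b : Var} : (rel f a b).Sat e ↔ Rel (e f) (e .bnd).length (e a).length
    (e b).length := by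
  simp [rel, sat_get, termVal_cons, termVal_nil, monoVal_cons, monoVal_nil, Rel]

theorem sat_relSucc {f a b : Var} : (relSucc f a b).Sat e ↔ Rel (e f) (e .bnd).length
    ((e a).length + 1) (e b).length := by
  simp [relSucc, sat_get, termVal_cons, termVal_nil, monoVal_cons, monoVal_nil, Rel, add_mul,
    add_assoc]

/-- Every row of the matrix has at most one mark. -/
def Func (f : List Sym) (B : ℕ) : Prop :=
  ∀ j < B, ∀ a < B, ∀ b < B, Rel f B j a → Rel f B j b → a = b

theorem sat_func {f : Var} (h1 : f ≠ .i) (h2 : f ≠ .u) (h3 : f ≠ .u') :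
    (func f).Sat e ↔ Func (e f) (e .bnd).length := by
  simp [func, sat_allU, sat_imp, sat_rel, sat_and, sat_le, termVal_cons, termVal_nil, monoVal_cons,
    monoVal_nil, h1, h2, h3, Func, le_antisymm_iff]

theorem forall_lt_imp_iff {B n : ℕ} (h : n ≤ B) {p : ℕ → Prop} :
    (∀ i < B, i < n → p i) ↔ ∀ i < n, p i :=
  ⟨fun hp i hi => hp i (hi.trans_le h) hi, fun hp i _ hi => hp i hi⟩

theorem sat_transF {o : Option Letter} (h1 : (e .q).length ≤ (e .bnd).length)
    (h2 : (e .q').length ≤ (e .bnd).length) : (transF o).Sat e ↔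
      TransAt (e .inp) (e .k).length (e .q).length o (e .q').length := by
  simp only [transF, sat_allU, sat_imp, sat_not, sat_and, sat_le, sat_get, termVal_cons, termVal_nil,
    monoVal_cons, monoVal_nil, Function.update_apply, reduceCtorEq, if_false, if_true,
    List.length_replicate, mul_one, add_zero, not_le, TransAt, TallyAt]
  rw [forall_lt_imp_iff h1, forall_lt_imp_iff h2]
  simp only [add_assoc, ← add_assoc 1 1, one_add_one_eq_two]

theorem sat_accF (h1 : (e .q).length ≤ (e .bnd).length) : accF.Sat e ↔
      AccAt (e .inp) (e .k).length (e .q).length := by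
  simp only [accF, sat_allU, sat_imp, sat_not, sat_and, sat_le, sat_get, termVal_cons, termVal_nil,
    monoVal_cons, monoVal_nil, Function.update_apply, reduceCtorEq, if_false, if_true,
    List.length_replicate, mul_one, add_zero, not_le, AccAt, TallyAt, add_assoc]
  rw [forall_lt_imp_iff h1]

theorem sat_startF (h1 : (e .q).length ≤ (e .bnd).length) : startF.Sat e ↔
      TallyAt (e .inp) 0 (e .q).length := by
  simp only [startF, sat_allU, sat_imp, sat_not, sat_and, sat_le, sat_get, termVal_cons, termVal_nil,
    monoVal_cons, monoVal_nil, Function.update_apply, reduceCtorEq, if_false, if_true,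
    List.length_replicate, mul_one, add_zero, not_le, TallyAt, zero_add]
  rw [forall_lt_imp_iff h1]

/-- The counters saturate at the length of the input plus one, so comparing the old value with the
input itself decides whether it can still grow. -/
theorem sat_upd {a b : Var} {r : Upd} : (r.fm a b).Sat e ↔
    (e b).length = r.val ((e .inp).length + 1) (e a).length := by
  cases r <;> simp only [Upd.fm, Upd.val, sat_or, sat_and, sat_not, sat_le, sat_eqSucc, termVal_cons, termVal_nil,
    monoVal_cons, monoVal_nil] <;> omega

theorem sat_moveF {a : Option Letter × Letter × Letter × Upd × Upd}
    (h1 : (e .q).length ≤ (e .bnd).length) (h2 : (e .q').length ≤ (e .bnd).length) :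
    (moveF a).Sat e ↔ (e .L)[(e .t).length]? = some (.label a.1) ∧
      (e .P)[(e .t).length]? = some (.label (some a.2.1)) ∧
      (e .P)[(e .t).length + 1]? = some (.label (some a.2.2.1)) ∧
      (e .x').length = a.2.2.2.1.val ((e .inp).length + 1) (e .x).length ∧
      (e .y').length = a.2.2.2.2.val ((e .inp).length + 1) (e .y).length ∧
      TransAt (e .inp) (e .k).length (e .q).length a.1 (e .q').length := by
  simp [moveF, sat_and, sat_get, sat_upd, sat_transF h1 h2, termVal_cons, termVal_nil,
    monoVal_cons, monoVal_nil]

/-- The matrices and strings describe a step of a run at the time `t`. -/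
def StepSem (inp Q X Y P L : List Sym) (B t : ℕ) : Prop :=
  ∃ q < B, ∃ q' < B, ∃ x < B, ∃ x' < B, ∃ y < B, ∃ y' < B, ∃ k < B,
    Rel Q B t q ∧ Rel Q B (t + 1) q' ∧ Rel X B t x ∧ Rel X B (t + 1) x' ∧ Rel Y B t y ∧
    Rel Y B (t + 1) y' ∧ ∃ a ∈ moves, L[t]? = some (.label a.1) ∧
      P[t]? = some (.label (some a.2.1)) ∧ P[t + 1]? = some (.label (some a.2.2.1)) ∧
      x' = a.2.2.2.1.val (inp.length + 1) x ∧ y' = a.2.2.2.2.val (inp.length + 1) y ∧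
      TransAt inp k q a.1 q'

theorem sat_stepF : stepF.Sat e ↔
    StepSem (e .inp) (e .Q) (e .X) (e .Y) (e .P) (e .L) (e .bnd).length (e .t).length := by
  simp only [stepF, sat_exU, sat_and, sat_orAll, List.mem_map, exists_exists_and_eq_and, sat_rel,
    sat_relSucc, StepSem, Function.update_apply, reduceCtorEq, if_false, if_true,
    List.length_replicate]
  refine exists_congr fun q => and_congr_right fun hq => exists_congr fun q' =>
    and_congr_right fun hq' => ?_
  iterate 5 refine exists_congr fun _ => and_congr_right fun _ => ?_
  iterate 6 refine and_congr_right fun _ => ?_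
  refine exists_congr fun a => and_congr_right fun _ => ?_
  rw [sat_moveF (by simpa using hq.le) (by simpa using hq'.le)]
  simp

/-- The strings describe an accepting run of length `T`. -/
def RunSem (inp Q X Y P L : List Sym) (B T : ℕ) : Prop :=
  Func Q B ∧ Func X B ∧ Func Y B ∧ Rel X B 0 0 ∧ Rel Y B 0 0 ∧
    P[0]? = some (.label (some .right)) ∧ (∃ q < B, Rel Q B 0 q ∧ TallyAt inp 0 q) ∧
    (∀ t < B, t < T → StepSem inp Q X Y P L B t) ∧ P[T]? = some (.label (some .right)) ∧
    ∃ q < B, ∃ k < B, Rel Q B T q ∧ AccAt inp k q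

theorem sat_runF : runF.Sat e ↔
    RunSem (e .inp) (e .Q) (e .X) (e .Y) (e .P) (e .L) (e .bnd).length (e .T).length := by
  unfold runF RunSem
  rw [sat_and, sat_and, sat_and, sat_and, sat_and, sat_and, sat_and, sat_and, sat_and,
    sat_func (by decide) (by decide) (by decide), sat_func (by decide) (by decide) (by decide),
    sat_func (by decide) (by decide) (by decide)]
  refine and_congr_right' <| and_congr_right' <| and_congr_right' <| and_congr ?_ <|
    and_congr ?_ <| and_congr ?_ <| and_congr ?_ <| and_congr ?_ <| and_congr ?_ ?_
  · simp [sat_get, Rel, termVal_nil]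
  · simp [sat_get, Rel, termVal_nil]
  · simp [sat_get, termVal_nil]
  · rw [sat_exU]
    refine exists_congr fun q => and_congr_right fun hq => ?_
    rw [sat_and, sat_startF (by simpa using hq.le)]
    simp [sat_get, Rel, termVal_nil, termVal_cons, monoVal_cons, monoVal_nil]
  · rw [sat_allU]
    refine forall_congr' fun t => forall_congr' fun ht => ?_
    rw [sat_imp, sat_not, sat_le, sat_stepF]
    simp [termVal_nil, termVal_cons, monoVal_cons, monoVal_nil]
  · simp [sat_get, termVal_nil, termVal_cons, monoVal_cons, monoVal_nil]
  · rw [sat_exU]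
    refine exists_congr fun q => and_congr_right fun hq => ?_
    rw [sat_exU]
    refine exists_congr fun k => and_congr (by simp) ?_
    rw [sat_and, sat_accF (by simpa using hq.le), sat_rel]
    simp

/-- The string `Z` is a run of the automaton that checks the format. -/
def FormatSem (inp : List Sym) (B : ℕ) : Prop :=
  ∃ Z : List Sym, Z.length = B ∧ Z[0]? = some .tally ∧
    (∀ i < inp.length, ∃ a ∈ formatTable, Z[i]? = some a.1 ∧ inp[i]? = some a.2.1 ∧
      Z[i + 1]? = some a.2.2) ∧ Z[inp.length]? ≠ some .accept

theorem sat_formatF : formatF.Sat e ↔ FormatSem (e .inp) (e .bnd).length := by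
  simp [formatF, FormatSem, sat_exS, sat_and, sat_allU, sat_orAll, sat_not, sat_get, termVal_nil,
    termVal_cons, monoVal_cons, monoVal_nil]

/-- The run reads the pair `(a, b)`. -/
def EmitSem (X Y L : List Sym) (B T a b : ℕ) : Prop :=
  ∃ t < B, t < T ∧ L[t]? = some (.label (some .right)) ∧ Rel X B t a ∧ Rel Y B t b

theorem sat_emitF {a b : Var} (ha : a ≠ .t) (hb : b ≠ .t) : (emitF a b).Sat e ↔
    EmitSem (e .X) (e .Y) (e .L) (e .bnd).length (e .T).length (e a).length (e b).length := by
  simp [emitF, EmitSem, sat_exU, sat_and, sat_not, sat_get, sat_le, sat_rel, termVal_nil,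
    termVal_cons, monoVal_cons, monoVal_nil, ha, hb]

/-- The relation between the numbers below `B` that is described by the strings. -/
def envEmit (e : Var → List Sym) : ℕ → ℕ → Prop :=
  EmitSem (e .X) (e .Y) (e .L) (e .bnd).length (e .T).length

/-- The number `v` occurs in the relation `E` on the numbers below `B`. -/
def VertSem (B : ℕ) (E : ℕ → ℕ → Prop) (v : ℕ) : Prop := ∃ u < B, E v u ∨ E u v

theorem sat_vertF : vertF.Sat e ↔ VertSem (e .bnd).length (envEmit e) (e .v).length := by
  simp [vertF, VertSem, envEmit, sat_exU, sat_or, sat_emitF]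

theorem sat_bigF : bigF.Sat e ↔ ∃ v < (e .bnd).length, VertSem (e .bnd).length (envEmit e) v ∧
    (e .inp).length < v := by
  simp [bigF, sat_exU, sat_and, sat_vertF, envEmit, sat_not, sat_le, termVal_nil,
    termVal_cons, monoVal_cons, monoVal_nil]

/-- The vertices `v` and `u` are adjacent in the graph of `E`. -/
def AdjSem (E : ℕ → ℕ → Prop) (v u : ℕ) : Prop := v ≠ u ∧ (E v u ∨ E u v)

theorem sat_adjF {b : Var} (hb : b ≠ .t) :
    (adjF b).Sat e ↔ AdjSem (envEmit e) (e .v).length (e b).length := by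
  simp [adjF, AdjSem, envEmit, sat_and, sat_or, sat_not, sat_le, termVal_nil,
    termVal_cons, monoVal_cons, monoVal_nil, sat_emitF, hb, ← le_antisymm_iff]

theorem sat_leafF : leafF.Sat e ↔ ∃ v < (e .bnd).length, ∃ u < (e .bnd).length,
    AdjSem (envEmit e) v u ∧ ∀ u' < (e .bnd).length, AdjSem (envEmit e) v u' → u = u' := by
  simp [leafF, sat_exU, sat_allU, sat_imp, sat_and, sat_adjF, envEmit, sat_le, termVal_nil,
    termVal_cons, monoVal_cons, monoVal_nil, ← le_antisymm_iff]

/-- There is a bijection between the numbers below `d` and the neighbours of `v`. -/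
def DegSem (B : ℕ) (E : ℕ → ℕ → Prop) (v d : ℕ) : Prop :=
  ∃ F : List Sym, F.length = B ^ 2 ∧ Func F B ∧
    (∀ i < B, ∀ i' < B, ∀ u < B, Rel F B i u → Rel F B i' u → i = i') ∧
    (∀ i < B, ∀ u < B, Rel F B i u → i < d ∧ AdjSem E v u) ∧
    (∀ i < B, i < d → ∃ u < B, Rel F B i u) ∧
    ∀ u < B, AdjSem E v u → ∃ i < B, Rel F B i u

theorem sat_degF (h : (e .bnd2).length = (e .bnd).length ^ 2) :
    degF.Sat e ↔ DegSem (e .bnd).length (envEmit e) (e .v).length (e .d).length := by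
  simp [degF, DegSem, sat_exS, sat_exU, sat_allU, sat_imp, sat_and, sat_adjF, sat_rel, sat_func,
    envEmit, sat_not, sat_le, termVal_nil, termVal_cons, monoVal_cons, monoVal_nil, ← le_antisymm_iff, h]

/-- The number `d` represents a letter of the word `w`. -/
def LetterSem (B : ℕ) (w : List Sym) (d : ℕ) : Prop :=
  ∃ i < B, (w[i]? = some .tally ∧ d = 2 * i + 2) ∨ (w[i]? = some .accept ∧ d = 2 * i + 3)

theorem sat_letterF : letterF.Sat e ↔ LetterSem (e .bnd).length (e .w) (e .d).length := by
  simp [letterF, LetterSem, sat_exU, sat_or, sat_and, sat_get, sat_eqSucc, termVal_nil,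
    termVal_cons, monoVal_cons, monoVal_nil, two_mul, add_assoc]

/-- The string `w` is a binary word of length at most `n` with a padding. -/
def WordSem (B n : ℕ) (w : List Sym) : Prop :=
  ∃ m < B, m ≤ n ∧ ∀ i < B, (i < m → w[i]? = some .tally ∨ w[i]? = some .accept) ∧
    (m ≤ i → w[i]? ≠ some .tally ∧ w[i]? ≠ some .accept)

theorem sat_wordF : wordF.Sat e ↔ WordSem (e .bnd).length (e .inp).length (e .w) := by
  simp [wordF, WordSem, sat_exU, sat_allU, sat_or, sat_and, sat_imp, sat_not, sat_get, sat_le,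
    termVal_nil, termVal_cons, monoVal_cons, monoVal_nil]

/-- The degree set represents the word `w`. -/
def DegsSem (B : ℕ) (E : ℕ → ℕ → Prop) (w : List Sym) : Prop :=
  (∀ v < B, VertSem B E v → ∃ d < B, DegSem B E v d ∧ LetterSem B w d) ∧
    ∀ d < B, LetterSem B w d → ∃ v < B, VertSem B E v ∧ DegSem B E v d

theorem sat_degsF (h : (e .bnd2).length = (e .bnd).length ^ 2) :
    degsF.Sat e ↔ DegsSem (e .bnd).length (envEmit e) (e .w) := by
  simp [degsF, DegsSem, sat_exU, sat_allU, sat_imp, sat_and, sat_vertF, sat_degF, sat_letterF, h,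
    envEmit]

/-- The input describes an automaton with an accepting run which reads a relation with the
property `p`. -/
def ExistsRunSem (inp : List Sym) (B : ℕ) (p : (ℕ → ℕ → Prop) → Prop) : Prop :=
  FormatSem inp B ∧ ∃ Q : List Sym, Q.length = B ^ 2 ∧ ∃ X : List Sym, X.length = B ^ 2 ∧
    ∃ Y : List Sym, Y.length = B ^ 2 ∧ ∃ P : List Sym, P.length = B ∧
    ∃ L : List Sym, L.length = B ∧ ∃ T < B, RunSem inp Q X Y P L B T ∧ p (EmitSem X Y L B T)

theorem sat_freshF (h : (e .bnd2).length = (e .bnd).length ^ 2) :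
    freshF.Sat e ↔ ExistsRunSem (e .inp) (e .bnd).length fun E =>
      (∃ v < (e .bnd).length, VertSem (e .bnd).length E v ∧ (e .inp).length < v) ∨
      ∃ v < (e .bnd).length, ∃ u < (e .bnd).length, AdjSem E v u ∧
        ∀ u' < (e .bnd).length, AdjSem E v u' → u = u' := by
  simp [freshF, existsRun, ExistsRunSem, sat_and, sat_or, sat_exS, sat_exU, sat_formatF, sat_runF,
    sat_bigF, sat_leafF, envEmit, h]

theorem sat_codeF (h : (e .bnd2).length = (e .bnd).length ^ 2) :
    codeF.Sat e ↔ ExistsRunSem (e .inp) (e .bnd).length fun E =>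
      (¬ ∃ v < (e .bnd).length, VertSem (e .bnd).length E v ∧ (e .inp).length < v) ∧
      WordSem (e .bnd).length (e .inp).length (e .w) ∧ DegsSem (e .bnd).length E (e .w) := by
  simp [codeF, existsRun, ExistsRunSem, sat_and, sat_not, sat_exS, sat_exU, sat_formatF, sat_runF,
    sat_bigF, sat_wordF, sat_degsF, envEmit, h]

end RunFm


/-! ### The meaning of the formulas -/

namespace RunFm

open Automaton

theorem exists_string (B : ℕ) (f : ℕ → Sym) :
    ∃ l : List Sym, l.length = B ∧ ∀ i < B, l[i]? = some (f i) :=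
  ⟨(List.range B).map f, by simp, fun i hi => by simp [hi]⟩

/-- The entry in row `j` and column `n` is stored at the position `j * B + n`; division with
remainder recovers it. Any symbol other than `tally` would do for an absent mark. -/
theorem exists_matrix (B : ℕ) (R : ℕ → ℕ → Prop) :
    ∃ l : List Sym, l.length = B ^ 2 ∧ ∀ j < B, ∀ n < B, Rel l B j n ↔ R j n := by
  classical
  obtain ⟨l, hl, h⟩ := exists_string (B ^ 2)
    fun i => if R (i / B) (i % B) then AutomatonSymbol.tally else .accept
  refine ⟨l, hl, fun j hj n hn => ?_⟩
  rw [Rel, h _ (by nlinarith), show (j * B + n) / B = j by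
    rw [mul_comm, Nat.mul_add_div (by omega), Nat.div_eq_of_lt hn, add_zero],
    show (j * B + n) % B = n by rw [mul_comm, Nat.mul_add_mod, Nat.mod_eq_of_lt hn]]
  split_ifs with hR <;> simp [hR]

theorem mem_formatTable {s g s' : Sym} : (s, g, s') ∈ formatTable ↔ formatStep s g = some s' := by
  simp only [formatTable, List.mem_flatMap, List.mem_filterMap, Option.map_eq_some_iff,
    Prod.mk.injEq]
  constructor
  · rintro ⟨s, -, g, -, s', h, rfl, rfl, rfl⟩
    exact h
  · intro h
    exact ⟨s, s.mem_all, g, g.mem_all, s', h, rfl, rfl, rfl⟩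

/-- The string `Z` lists the states of the format automaton. The assumption `hB` leaves room for the
state after the last symbol. -/
theorem formatSem_iff {inp : List Sym} {B : ℕ} (hB : inp.length < B) :
    FormatSem inp B ↔ ∃ A : Automaton Letter, A.encode = inp := by
  rw [exists_encode_eq_iff, formatOk_iff]
  constructor
  · rintro ⟨Z, hZ, h0, h1, h2⟩
    refine ⟨fun i => Z[i]?.getD default, by simp [h0], fun i g hi => ?_, ?_⟩
    · obtain ⟨⟨s, g', s'⟩, ha, h3, h4, h5⟩ := h1 i (getElem?_some_lt hi)
      have : g = g' := by simpa [hi] using h4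
      subst this
      simpa [h3, h5] using mem_formatTable.1 ha
    · rw [List.getElem?_eq_getElem (by omega)] at h2
      simpa [List.getElem?_eq_getElem (hZ ▸ hB : inp.length < Z.length)] using h2
  · rintro ⟨Z, h0, h1, h2⟩
    obtain ⟨l, hl, h⟩ := exists_string B Z
    refine ⟨l, hl, by rw [h 0 (by omega), h0], fun i hi => ?_, by rw [h _ hB]; simpa using h2⟩
    exact ⟨(Z i, inp[i], Z (i + 1)), mem_formatTable.2 (h1 i _ (List.getElem?_eq_getElem hi)),
      h i (by omega), List.getElem?_eq_getElem hi, h _ (by omega)⟩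

open Classical in
/-- The column of a mark in a row. -/
noncomputable def valOf (f : List Sym) (B j : ℕ) : ℕ :=
  if h : ∃ n < B, Rel f B j n then h.choose else 0

theorem Func.valOf_eq {f : List Sym} {B j n : ℕ} (h : Func f B) (hj : j < B) (hn : n < B)
    (hr : Rel f B j n) : valOf f B j = n := by
  have hex : ∃ n < B, Rel f B j n := ⟨n, hn, hr⟩
  rw [valOf, dif_pos hex]
  exact h j hj _ hex.choose_spec.1 _ hn hex.choose_spec.2 hr

/-- The finite relation `S` is described by `E` on the numbers below `B`. -/
def Agree (B : ℕ) (S : Finset (ℕ × ℕ)) (E : ℕ → ℕ → Prop) : Prop :=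
  (∀ p ∈ S, p.1 < B ∧ p.2 < B) ∧ ∀ a < B, ∀ b < B, (a, b) ∈ S ↔ E a b

/-- From strings to a run. The step condition guarantees marks at all times before `T`, and `Func`
makes them unique, so `valOf` yields the states and the counters. Nothing is known or needed about
later rows. -/
theorem RunSem.exists_isRun {A : Automaton Letter} {Q X Y P L : List Sym} {B T : ℕ} (hT : T < B)
    (h : RunSem A.encode Q X Y P L B T) :
    ∃ st cfg lb, IsRun A (A.encode.length + 1) T st cfg lb ∧
      Agree B (emitted cfg lb T) (EmitSem X Y L B T) := by
  obtain ⟨hQ, hX, hY, hX0, hY0, hP0, ⟨q₀, hq₀, hQ0, hstart⟩, hstep, hPT, q₁, hq₁, k, -, hQT,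
    hacc⟩ := h
  -- Before the time `T` the strings `L` and `P` contain labels of the right kind, so the default
  -- values are never used there.
  let lb : ℕ → Option Letter := fun t => match L[t]? with
    | some (.label o) => o
    | _ => none
  let ph : ℕ → Letter := fun t => match P[t]? with
    | some (.label (some l)) => l
    | _ => .right
  let cfg : ℕ → Parser.Cfg := fun t => (ph t, valOf X B t, valOf Y B t)
  have key : ∀ t < T, (valOf Q B t, lb t, valOf Q B (t + 1)) ∈ A.transitions ∧
      Parser.move (A.encode.length + 1) (lb t) (cfg t) = some (cfg (t + 1)) ∧
      (∃ o, L[t]? = some (.label o)) ∧ (valOf X B t < B ∧ Rel X B t (valOf X B t)) ∧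
      (valOf Y B t < B ∧ Rel Y B t (valOf Y B t)) := by
    intro t ht
    obtain ⟨q, hq, q', hq', x, hx, x', hx', y, hy, y', hy', k, -, r1, r2, r3, r4, r5, r6,
      ⟨o, p, p', a, b⟩, hm, hL, hP, hP', e1, e2, htr⟩ := hstep t (by omega) ht
    have hlb : lb t = o := by simp [lb, hL]
    have hph : ph t = p := by simp [ph, hP]
    have hph' : ph (t + 1) = p' := by simp [ph, hP']
    simp only [cfg, hlb, hph, hph', hQ.valOf_eq (by omega) hq r1, hQ.valOf_eq (by omega) hq' r2,
      hX.valOf_eq (by omega) hx r3, hX.valOf_eq (by omega) hx' r4, hY.valOf_eq (by omega) hy r5,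
      hY.valOf_eq (by omega) hy' r6]
    exact ⟨A.mem_transitions_iff.2 ⟨k, htr⟩, move_eq_some_iff.2 ⟨a, b, hm, e1, e2⟩, ⟨o, hL⟩,
      ⟨hx, r3⟩, hy, r5⟩
  have hlbR : ∀ t < T, lb t = some .right ↔ L[t]? = some (.label (some .right)) := by
    intro t ht
    obtain ⟨-, -, ⟨o, ho⟩, -⟩ := key t ht
    simp [lb, ho]
  refine ⟨valOf Q B, cfg, lb, ⟨?_, ?_, fun t ht => (key t ht).1, fun t ht => (key t ht).2.1, ?_, ?_⟩,
    ?_, ?_⟩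
  · rw [hQ.valOf_eq (by omega) hq₀ hQ0]
    exact A.eq_start_iff.2 hstart
  · simp [cfg, ph, hP0, hX.valOf_eq (by omega) (by omega) hX0,
      hY.valOf_eq (by omega) (by omega) hY0]
  · rw [hQ.valOf_eq hT hq₁ hQT]
    exact A.mem_accept_iff.2 ⟨k, hacc⟩
  · simp [cfg, ph, hPT]
  · intro p hp
    obtain ⟨t, ht, -, rfl⟩ := mem_emitted.1 hp
    obtain ⟨-, -, -, h1, h2⟩ := key t ht
    exact ⟨h1.1, h2.1⟩
  · intro a ha b hb
    rw [mem_emitted]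
    constructor
    · rintro ⟨t, ht, h1, h2⟩
      obtain ⟨-, -, -, h3, h4⟩ := key t ht
      obtain ⟨rfl, rfl⟩ := Prod.mk.injEq _ _ _ _ ▸ h2
      exact ⟨t, by omega, ht, (hlbR t ht).1 h1, h3.2, h4.2⟩
    · rintro ⟨t, ht, htT, h1, h2, h3⟩
      refine ⟨t, htT, (hlbR t htT).2 h1, ?_⟩
      simp [cfg, hX.valOf_eq ht ha h2, hY.valOf_eq ht hb h3]

/-- From a run to strings. Everything fits below `B`: states are bounded by the length of the
description, counters by their saturation value, times by `T`, and positions by the length of the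
input. -/
theorem exists_runSem {A : Automaton Letter} {T B : ℕ} {st : ℕ → ℕ} {cfg : ℕ → Parser.Cfg}
    {lb : ℕ → Option Letter} (h : IsRun A (A.encode.length + 1) T st cfg lb) (hT : T < B)
    (hB : A.encode.length + 1 < B) :
    ∃ Q X Y P L : List Sym, Q.length = B ^ 2 ∧ X.length = B ^ 2 ∧ Y.length = B ^ 2 ∧
      P.length = B ∧ L.length = B ∧ RunSem A.encode Q X Y P L B T ∧
      Agree B (emitted cfg lb T) (EmitSem X Y L B T) := by
  obtain ⟨Q, lQ, hQ⟩ := exists_matrix B fun t n => st t = n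
  obtain ⟨X, lX, hX⟩ := exists_matrix B fun t n => (cfg t).2.1 = n
  obtain ⟨Y, lY, hY⟩ := exists_matrix B fun t n => (cfg t).2.2 = n
  obtain ⟨P, lP, hP⟩ := exists_string B fun t => .label (some (cfg t).1)
  obtain ⟨L, lL, hL⟩ := exists_string B fun t => .label (lb t)
  have hst : ∀ t ≤ T, st t < B := fun t ht => by have := h.st_le ht; omega
  have hcfg : ∀ t ≤ T, (cfg t).2.1 < B ∧ (cfg t).2.2 < B := fun t ht => by
    have := cfg_le h.cfg_zero h.move ht; omega
  refine ⟨Q, X, Y, P, L, lQ, lX, lY, lP, lL, ⟨?_, ?_, ?_, ?_, ?_, ?_, ?_, ?_, ?_, ?_⟩, ?_, ?_⟩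
  · intro j hj a ha b hb h1 h2
    exact ((hQ j hj a ha).1 h1).symm.trans ((hQ j hj b hb).1 h2)
  · intro j hj a ha b hb h1 h2
    exact ((hX j hj a ha).1 h1).symm.trans ((hX j hj b hb).1 h2)
  · intro j hj a ha b hb h1 h2
    exact ((hY j hj a ha).1 h1).symm.trans ((hY j hj b hb).1 h2)
  · exact (hX 0 (by omega) 0 (by omega)).2 (by rw [h.cfg_zero])
  · exact (hY 0 (by omega) 0 (by omega)).2 (by rw [h.cfg_zero])
  · rw [hP 0 (by omega), h.cfg_zero]
  · exact ⟨st 0, hst 0 (by omega), (hQ 0 (by omega) _ (hst 0 (by omega))).2 rfl,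
      A.eq_start_iff.1 h.st_zero⟩
  · intro t ht htT
    obtain ⟨k, hk⟩ := A.mem_transitions_iff.1 (h.step t htT)
    obtain ⟨a, b, hm, e1, e2⟩ := move_eq_some_iff.1 (h.move t htT)
    have c1 := hcfg t htT.le
    have c2 := hcfg (t + 1) htT
    have s1 := hst t htT.le
    have s2 := hst (t + 1) htT
    have hkB : k < B := by have := getElem?_some_lt hk.1; omega
    exact ⟨_, s1, _, s2, _, c1.1, _, c2.1, _, c1.2, _, c2.2, k, hkB, (hQ _ ht _ s1).2 rfl,
      (hQ _ (by omega) _ s2).2 rfl, (hX _ ht _ c1.1).2 rfl, (hX _ (by omega) _ c2.1).2 rfl,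
      (hY _ ht _ c1.2).2 rfl, (hY _ (by omega) _ c2.2).2 rfl, _, hm, hL t ht, hP t ht,
      hP _ (by omega), e1, e2, hk⟩
  · rw [hP T hT, h.complete]
  · obtain ⟨k, hk⟩ := A.mem_accept_iff.1 h.accept
    have hkB : k < B := by have := getElem?_some_lt hk.1; omega
    exact ⟨_, hst T le_rfl, k, hkB, (hQ T hT _ (hst T le_rfl)).2 rfl, hk⟩
  · intro p hp
    obtain ⟨t, ht, -, rfl⟩ := mem_emitted.1 hp
    exact hcfg t ht.le
  · intro a ha b hb
    rw [mem_emitted]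
    refine ⟨?_, ?_⟩
    · rintro ⟨t, ht, h1, h2⟩
      refine ⟨t, by omega, ht, by rw [hL t (by omega), h1], (hX t (by omega) a ha).2 (by rw [h2]),
        (hY t (by omega) b hb).2 (by rw [h2])⟩
    · rintro ⟨t, ht, htT, h1, h2, h3⟩
      refine ⟨t, htT, ?_, Prod.ext ((hX t ht a ha).1 h2) ((hY t ht b hb).1 h3)⟩
      rw [hL t ht] at h1
      simpa using h1

/-! ### Vertices, degrees and words below the bound -/

section Degrees

variable {B n : ℕ} {S : Finset (ℕ × ℕ)} {E : ℕ → ℕ → Prop}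

theorem Agree.isVert_lt (h : Agree B S E) {v : ℕ} (hv : IsVert S v) : v < B := by
  obtain ⟨p, hp, rfl | rfl⟩ := hv
  · exact (h.1 p hp).1
  · exact (h.1 p hp).2

theorem Agree.vertSem_iff (h : Agree B S E) {v : ℕ} (hv : v < B) : VertSem B E v ↔ IsVert S v := by
  constructor
  · rintro ⟨u, hu, he | he⟩
    · exact ⟨_, (h.2 v hv u hu).2 he, Or.inl rfl⟩
    · exact ⟨_, (h.2 u hu v hv).2 he, Or.inr rfl⟩
  · rintro ⟨⟨a, b⟩, hp, rfl | rfl⟩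
    · exact ⟨b, (h.1 _ hp).2, Or.inl ((h.2 _ hv _ (h.1 _ hp).2).1 hp)⟩
    · exact ⟨a, (h.1 _ hp).1, Or.inr ((h.2 _ (h.1 _ hp).1 _ hv).1 hp)⟩

theorem isVert_of_mem_nbrs {u v : ℕ} (hu : u ∈ nbrs S v) : IsVert S u := by
  rcases hu.2 with h | h
  · exact ⟨_, h, Or.inr rfl⟩
  · exact ⟨_, h, Or.inl rfl⟩

theorem isVert_of_mem_nbrs' {u v : ℕ} (hu : u ∈ nbrs S v) : IsVert S v := by
  rcases hu.2 with h | h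
  · exact ⟨_, h, Or.inl rfl⟩
  · exact ⟨_, h, Or.inr rfl⟩

theorem Agree.adjSem_iff (h : Agree B S E) {u v : ℕ} (hu : u < B) (hv : v < B) :
    AdjSem E v u ↔ u ∈ nbrs S v := by
  simp only [AdjSem, nbrs, Set.mem_ofPred_eq, h.2 v hv u hu, h.2 u hu v hv]

theorem nbrs_finite (S : Finset (ℕ × ℕ)) (v : ℕ) : (nbrs S v).Finite := by
  refine ((S.image Prod.fst ∪ S.image Prod.snd).finite_toSet).subset fun u hu => ?_
  obtain ⟨p, hp, rfl | rfl⟩ := isVert_of_mem_nbrs hu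
  · exact Finset.mem_coe.2 (Finset.mem_union_left _ (Finset.mem_image_of_mem _ hp))
  · exact Finset.mem_coe.2 (Finset.mem_union_right _ (Finset.mem_image_of_mem _ hp))

/-- Counting by a quantified matrix: `F` is the graph of a bijection between the numbers below `d`
and the neighbours of `v`. -/
theorem Agree.degSem_iff (h : Agree B S E) {v d : ℕ} (hv : v < B) (hd : d < B) :
    DegSem B E v d ↔ (nbrs S v).ncard = d := by
  constructor
  · rintro ⟨F, -, h1, h2, h3, h4, h5⟩
    have hval : ∀ i < d, valOf F B i < B ∧ Rel F B i (valOf F B i) := by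
      intro i hi
      obtain ⟨u, hu, hr⟩ := h4 i (by omega) hi
      rw [h1.valOf_eq (by omega) hu hr]
      exact ⟨hu, hr⟩
    refine Set.ncard_eq_of_bijective (fun i _ => valOf F B i) ?_ ?_ ?_
    · intro u hu
      have huB := h.isVert_lt (isVert_of_mem_nbrs hu)
      obtain ⟨i, hi, hr⟩ := h5 u huB ((h.adjSem_iff huB hv).2 hu)
      exact ⟨i, (h3 i hi u huB hr).1, h1.valOf_eq hi huB hr⟩
    · intro i hi
      obtain ⟨h6, h7⟩ := hval i hi
      exact (h.adjSem_iff h6 hv).1 (h3 i (by omega) _ h6 h7).2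
    · intro i j hi hj heq
      obtain ⟨h6, h7⟩ := hval i hi
      obtain ⟨h8, h9⟩ := hval j hj
      exact h2 i (by omega) j (by omega) _ h6 h7 (heq ▸ h9)
  · intro hcard
    set s := (nbrs_finite S v).toFinset with hs
    have hcs : s.card = d := by rw [← hcard, Set.ncard_eq_toFinset_card _ (nbrs_finite S v)]
    have hms : ∀ u, u ∈ s ↔ u ∈ nbrs S v := fun u => Set.Finite.mem_toFinset _
    -- An arbitrary enumeration of the neighbours supplies the rows of the matrix.
    let f := s.equivFin
    obtain ⟨F, lF, hF⟩ := exists_matrix B fun i u => ∃ hu : u ∈ s, (f ⟨u, hu⟩ : ℕ) = i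
    refine ⟨F, lF, ?_, ?_, ?_, ?_, ?_⟩
    · intro j hj a ha b hb h1 h2
      obtain ⟨h3, h4⟩ := (hF j hj a ha).1 h1
      obtain ⟨h5, h6⟩ := (hF j hj b hb).1 h2
      have := f.injective (Fin.ext (h4.trans h6.symm))
      exact congrArg Subtype.val this
    · intro j hj j' hj' a ha h1 h2
      obtain ⟨h3, h4⟩ := (hF j hj a ha).1 h1
      obtain ⟨h5, h6⟩ := (hF j' hj' a ha).1 h2
      exact h4.symm.trans h6
    · intro j hj a ha h1
      obtain ⟨h3, h4⟩ := (hF j hj a ha).1 h1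
      refine ⟨?_, (h.adjSem_iff ha hv).2 ((hms a).1 h3)⟩
      rw [← h4, ← hcs]
      exact (f ⟨a, h3⟩).2
    · intro j hj hjd
      have hm := (f.symm ⟨j, hcs.symm ▸ hjd⟩).2
      have hlt := h.isVert_lt (isVert_of_mem_nbrs ((hms _).1 hm))
      exact ⟨_, hlt, (hF j hj _ hlt).2 ⟨hm, by simp⟩⟩
    · intro a ha hadj
      have hm := (hms a).2 ((h.adjSem_iff ha hv).1 hadj)
      have hlt : (f ⟨a, hm⟩ : ℕ) < B := lt_trans (f ⟨a, hm⟩).2 (by rw [hcs]; exact hd)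
      exact ⟨_, hlt, (hF _ hlt a ha).2 ⟨hm, rfl⟩⟩

theorem Agree.big_iff (h : Agree B S E) :
    (∃ v < B, VertSem B E v ∧ n < v) ↔ ∃ p ∈ S, n < p.1 ∨ n < p.2 := by
  constructor
  · rintro ⟨v, hv, h1, h2⟩
    obtain ⟨p, hp, rfl | rfl⟩ := (h.vertSem_iff hv).1 h1
    · exact ⟨p, hp, Or.inl h2⟩
    · exact ⟨p, hp, Or.inr h2⟩
  · rintro ⟨p, hp, h1 | h1⟩
    · exact ⟨p.1, (h.1 p hp).1, (h.vertSem_iff (h.1 p hp).1).2 ⟨p, hp, Or.inl rfl⟩, h1⟩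
    · exact ⟨p.2, (h.1 p hp).2, (h.vertSem_iff (h.1 p hp).2).2 ⟨p, hp, Or.inr rfl⟩, h1⟩

theorem Agree.leaf_iff (h : Agree B S E) :
    (∃ v < B, ∃ u < B, AdjSem E v u ∧ ∀ u' < B, AdjSem E v u' → u = u') ↔
      1 ∈ (graphOf S).degs := by
  rw [degs_graphOf]
  constructor
  · rintro ⟨v, hv, u, hu, h1, h2⟩
    have hmem := (h.adjSem_iff hu hv).1 h1
    refine ⟨v, isVert_of_mem_nbrs' hmem, Set.ncard_eq_one.2 ⟨u, ?_⟩⟩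
    ext u'
    rw [Set.mem_singleton_iff]
    constructor
    · intro hu'
      have hlt := h.isVert_lt (isVert_of_mem_nbrs hu')
      exact (h2 u' hlt ((h.adjSem_iff hlt hv).2 hu')).symm
    · rintro rfl
      exact hmem
  · rintro ⟨v, hv, hc⟩
    obtain ⟨u, hu⟩ := Set.ncard_eq_one.1 hc
    have hvB := h.isVert_lt hv
    have hmem : u ∈ nbrs S v := hu ▸ Set.mem_singleton u
    have huB := h.isVert_lt (isVert_of_mem_nbrs hmem)
    refine ⟨v, hvB, u, huB, (h.adjSem_iff huB hvB).2 hmem, fun u' hu' hadj => ?_⟩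
    have := (h.adjSem_iff hu' hvB).1 hadj
    rw [hu] at this
    exact (Set.mem_singleton_iff.1 this).symm

/-- The neighbours are among the n + 1 numbers up to n, and `v` is not one of them. -/
theorem ncard_nbrs_le (hS : ∀ p ∈ S, p.1 ≤ n ∧ p.2 ≤ n) {v : ℕ} (hv : IsVert S v) :
    (nbrs S v).ncard ≤ n := by
  have hle : ∀ u, IsVert S u → u ≤ n := by
    rintro u ⟨p, hp, rfl | rfl⟩
    · exact (hS p hp).1
    · exact (hS p hp).2
  have hsub : nbrs S v ⊆ ((Finset.range (n + 1)).erase v : Finset ℕ) := by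
    intro u hu
    have h1 := hle u (isVert_of_mem_nbrs hu)
    simp only [Finset.coe_erase, Finset.coe_range, Set.mem_sdiff, Set.mem_Iio,
      Set.mem_singleton_iff]
    exact ⟨by omega, hu.1.symm⟩
  have := Set.ncard_le_ncard hsub (Finset.finite_toSet _)
  rw [Set.ncard_coe_finset, Finset.card_erase_of_mem, Finset.card_range] at this
  · omega
  · have := hle v hv
    simp
    omega

/-- The bit that a symbol represents. -/
def bitOf : Sym → Option Bool
  | .tally => some false
  | .accept => some true
  | _ => none

/-- The symbols that represent bits form an initial segment, so dropping the other ones does not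
shift positions. -/
theorem getElem?_filterMap_bitOf {m : ℕ} {w : List Sym}
    (h1 : ∀ i < m, w[i]? = some .tally ∨ w[i]? = some .accept)
    (h2 : ∀ i, m ≤ i → w[i]? ≠ some .tally ∧ w[i]? ≠ some .accept) (i : ℕ) (b : Bool) :
    (w.filterMap bitOf)[i]? = some b ↔ w[i]? = some (if b then .accept else .tally) := by
  induction w generalizing m i with
  | nil => simp
  | cons g w ih =>
    cases m with
    | zero =>
      have hnil : (g :: w).filterMap bitOf = [] := by
        rw [List.filterMap_eq_nil_iff]
        intro a ha
        obtain ⟨j, hj⟩ := List.getElem?_of_mem ha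
        have := h2 j (by omega)
        rw [hj] at this
        cases a <;> simp_all [bitOf]
      rw [hnil]
      have := h2 i (by omega)
      cases b <;> simp [this]
    | succ m =>
      have h0 := h1 0 (by omega)
      have h1' : ∀ i < m, w[i]? = some .tally ∨ w[i]? = some .accept := fun i hi => by
        simpa using h1 (i + 1) (by omega)
      have h2' : ∀ i, m ≤ i → w[i]? ≠ some .tally ∧ w[i]? ≠ some .accept := fun i hi => by
        simpa using h2 (i + 1) (by omega)
      simp only [List.getElem?_cons_zero, Option.some.injEq] at h0
      obtain ⟨c, hc⟩ : ∃ c, bitOf g = some c ∧ g = if c then .accept else .tally := by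
        rcases h0 with rfl | rfl
        · exact ⟨false, rfl, rfl⟩
        · exact ⟨true, rfl, rfl⟩
      rw [List.filterMap_cons_some hc.1]
      cases i with
      | zero =>
        rw [hc.2]
        cases b <;> cases c <;> simp
      | succ i => simpa using ih h1' h2' i

theorem WordSem.letterSem_iff {w : List Sym} (hw : w.length = B) (h : WordSem B n w) (d : ℕ) :
    LetterSem B w d ↔ d ∈ wordDegs (w.filterMap bitOf) := by
  obtain ⟨m, hm, -, h⟩ := h
  have key := getElem?_filterMap_bitOf (m := m) (w := w) (fun i hi => (h i (by omega)).1 hi)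
    (fun i hi => by
      by_cases hiB : i < B
      · exact (h i hiB).2 hi
      · rw [List.getElem?_eq_none (by omega)]; simp)
  constructor
  · rintro ⟨i, -, ⟨h1, rfl⟩ | ⟨h1, rfl⟩⟩
    · exact ⟨i, false, (key i false).2 (by simpa using h1), rfl⟩
    · exact ⟨i, true, (key i true).2 (by simpa using h1), rfl⟩
  · rintro ⟨i, b, h1, rfl⟩
    have h2 := (key i b).1 h1
    refine ⟨i, hw ▸ getElem?_some_lt h2, ?_⟩
    cases b
    · exact Or.inl ⟨by simpa using h2, rfl⟩
    · exact Or.inr ⟨by simpa using h2, rfl⟩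

/-- Letters stand at positions below n and hence represent numbers of at most 2(n - 1) + 3. Without
this bound the formula, which sees only numbers below `B`, could miss degrees. -/
theorem WordSem.lt {w : List Sym} (h : WordSem B n w) (hB : 2 * n + 1 < B) {d : ℕ}
    (hd : LetterSem B w d) : d < B := by
  obtain ⟨m, hm, hmn, h⟩ := h
  obtain ⟨i, hi, hd⟩ := hd
  have him : i < m := by
    by_contra hc
    have := (h i hi).2 (by omega)
    rcases hd with ⟨h1, -⟩ | ⟨h1, -⟩
    · exact this.1 h1
    · exact this.2 h1
  omega

theorem Agree.degsSem_iff (h : Agree B S E) {w : List Sym} (hlen : w.length = B)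
    (hw : WordSem B n w) (hB : 2 * n + 1 < B) (hS : ∀ p ∈ S, p.1 ≤ n ∧ p.2 ≤ n) :
    DegsSem B E w ↔ (graphOf S).degs = wordDegs (w.filterMap bitOf) := by
  have hlt : ∀ v, IsVert S v → (nbrs S v).ncard < B := fun v hv => by
    have := ncard_nbrs_le hS hv
    omega
  rw [degs_graphOf]
  constructor
  · rintro ⟨h1, h2⟩
    ext d
    rw [← hw.letterSem_iff hlen, Set.mem_ofPred_eq]
    constructor
    · rintro ⟨v, hv, rfl⟩
      have hvB := h.isVert_lt hv
      obtain ⟨d, hd, h3, h4⟩ := h1 v hvB ((h.vertSem_iff hvB).2 hv)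
      rw [(h.degSem_iff hvB hd).1 h3]
      exact h4
    · intro hd
      have hdB := hw.lt hB hd
      obtain ⟨v, hv, h3, h4⟩ := h2 d hdB hd
      exact ⟨v, (h.vertSem_iff hv).1 h3, (h.degSem_iff hv hdB).1 h4⟩
  · intro heq
    refine ⟨fun v hv hvert => ?_, fun d hd hl => ?_⟩
    · have hvert' := (h.vertSem_iff hv).1 hvert
      refine ⟨_, hlt v hvert', (h.degSem_iff hv (hlt v hvert')).2 rfl, ?_⟩
      rw [hw.letterSem_iff hlen, ← heq]
      exact ⟨v, hvert', rfl⟩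
    · rw [hw.letterSem_iff hlen, ← heq] at hl
      obtain ⟨v, hvert, hc⟩ := hl
      have hv := h.isVert_lt hvert
      exact ⟨v, hv, (h.vertSem_iff hv).2 hvert, (h.degSem_iff hv hd).2 hc⟩

/-- The search variable has the fixed length `B`, so a shorter word is padded with a symbol that
`bitOf` ignores. -/
theorem exists_wordSem {q : List Bool} (hq : q.length ≤ n) (hB : n < B) :
    ∃ w : List Sym, w.length = B ∧ WordSem B n w ∧ w.filterMap bitOf = q := by
  refine ⟨q.map (fun b => if b then .accept else .tally) ++
    List.replicate (B - q.length) .transition, by simp; omega, ⟨q.length, by omega, hq, ?_⟩, ?_⟩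
  · intro i hi
    constructor
    · intro hiq
      rw [List.getElem?_append_left (by simpa using hiq)]
      cases hb : q[i] <;> simp [hiq, hb]
    · intro hiq
      rw [List.getElem?_append_right (by simpa using hiq)]
      simp [List.getElem?_replicate]
  · rw [List.filterMap_append, List.filterMap_map]
    have h1 : (bitOf ∘ fun b : Bool => if b then AutomatonSymbol.accept else .tally) = some := by
      funext b
      cases b <;> rfl
    have h2 : (List.replicate (B - q.length) (AutomatonSymbol.transition : Sym)).filterMap bitOf = []
        := by
      rw [List.filterMap_eq_nil_iff]
      intro a ha
      rw [(List.mem_replicate.1 ha).2]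
      rfl
    rw [h1, h2, List.filterMap_some, List.append_nil]

end Degrees

end RunFm


/-! ### The reduction of the regular realizability problem -/

namespace RunFm

open Automaton

/-- Since strings and runs describe the same relation, a property of the strings may be traded for a
property of the set of pairs that are read. -/
theorem existsRunSem_iff {inp : List Sym} {B : ℕ} (hB : inp.length + 1 < B)
    {p : (ℕ → ℕ → Prop) → Prop} {p' : Finset (ℕ × ℕ) → Prop}
    (hp : ∀ S E, Agree B S E → (p E ↔ p' S)) :
    ExistsRunSem inp B p ↔ ∃ A : Automaton Letter, A.encode = inp ∧ ∃ T < B, ∃ st cfg lb,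
      IsRun A (inp.length + 1) T st cfg lb ∧ p' (emitted cfg lb T) := by
  unfold ExistsRunSem
  rw [formatSem_iff (by omega)]
  constructor
  · rintro ⟨⟨A, rfl⟩, Q, -, X, -, Y, -, P, -, L, -, T, hT, hrun, hE⟩
    obtain ⟨st, cfg, lb, h1, h2⟩ := hrun.exists_isRun hT
    exact ⟨A, rfl, T, hT, st, cfg, lb, h1, (hp _ _ h2).1 hE⟩
  · rintro ⟨A, rfl, T, hT, st, cfg, lb, h1, hS⟩
    obtain ⟨Q, X, Y, P, L, lQ, lX, lY, lP, lL, h2, h3⟩ := exists_runSem h1 hT hB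
    exact ⟨⟨A, rfl⟩, Q, lQ, X, lX, Y, lY, P, lP, L, lL, T, hT, h2, (hp _ _ h3).2 hS⟩

/-- A letter at position n would have a code of at least 2n + 2. -/
theorem length_le_of_wordDegs {q : List Bool} {n : ℕ} (h : ∀ d ∈ wordDegs q, d ≤ n) :
    q.length ≤ n := by
  by_contra hc
  have := h (2 * n + 2 + (q[n]'(by omega)).toNat) ⟨n, _, List.getElem?_eq_getElem (by omega), rfl⟩
  omega

theorem two_mul_add_one_lt_pow (n : ℕ) : 2 * n + 1 < (n + 4) ^ 8 :=
  calc 2 * n + 1 < (n + 4) ^ 2 := by nlinarith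
    _ ≤ _ := Nat.pow_le_pow_right (by omega) (by norm_num)

/-- The element `w₀` is the query that answers yes whenever membership is certain without consulting
X: it is asked if some run reads a large number or yields a vertex of degree one. All the other
queries are words coded by degree sets of runs with small numbers. -/
theorem polySpaceDttReducible_degGraphs (X : Language Bool) (hX : ∃ w, w ∈ X) :
    PolySpaceDttReducible (NRR (graphLanguage (degGraphs X))) X := by
  obtain ⟨w₀, hw₀⟩ := hX
  obtain ⟨f, hf, hq⟩ := Cmd.exists_searchProg_computable bitOf (inp := Var.inp) (bnd := Var.bnd)
    (bnd2 := Var.bnd2) (w := Var.w) w₀ (by decide) (by decide) (by decide) (by decide) (by decide)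
    (by decide) ok_codeF ok_freshF bound_codeF bound_freshF
  refine ⟨f, hf, fun x => ?_⟩
  rw [mem_NRR_degGraphs_iff]
  simp only [hq]
  have hB := two_mul_add_one_lt_pow x.length
  have hn1 : x.length + 1 < (x.length + 4) ^ 8 :=
    lt_of_lt_of_le (by omega) (Nat.le_self_pow (by norm_num) _)
  -- From here on `B` is used only through the two inequalities `hB` and `hn1`.
  generalize (x.length + 4) ^ 8 = B at hB hn1 ⊢
  have e1 : (Cmd.baseEnv Var.inp .bnd .bnd2 B x) .inp = x := by simp [Cmd.baseEnv]
  have e2 : ((Cmd.baseEnv Var.inp .bnd .bnd2 B x) .bnd).length = B := by simp [Cmd.baseEnv]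
  have e3 : ((Cmd.baseEnv Var.inp .bnd .bnd2 B x) .bnd2).length = B ^ 2 := by simp [Cmd.baseEnv]
  have hfresh : freshF.Sat (Cmd.baseEnv Var.inp .bnd .bnd2 B x) ↔
      ∃ A : Automaton Letter, A.encode = x ∧ ∃ T < B, ∃ st cfg lb,
        IsRun A (x.length + 1) T st cfg lb ∧
        ((∃ p ∈ emitted cfg lb T, x.length < p.1 ∨ x.length < p.2) ∨
          1 ∈ (graphOf (emitted cfg lb T)).degs) := by
    rw [sat_freshF (by rw [e2, e3]), e1, e2]
    refine existsRunSem_iff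
      (p' := fun S => (∃ p ∈ S, x.length < p.1 ∨ x.length < p.2) ∨ 1 ∈ (graphOf S).degs) hn1 ?_
    intro S E h
    rw [h.big_iff, h.leaf_iff]
  have hcode : ∀ l : List Sym, l.length = B →
      (codeF.Sat (Function.update (Cmd.baseEnv Var.inp .bnd .bnd2 B x) .w l) ↔
      ∃ A : Automaton Letter, A.encode = x ∧ ∃ T < B, ∃ st cfg lb,
        IsRun A (x.length + 1) T st cfg lb ∧
        ((∀ p ∈ emitted cfg lb T, p.1 ≤ x.length ∧ p.2 ≤ x.length) ∧ WordSem B x.length l ∧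
          (graphOf (emitted cfg lb T)).degs = wordDegs (l.filterMap bitOf))) := by
    intro l hl
    rw [sat_codeF (by simp [e2, e3])]
    simp only [ne_eq, reduceCtorEq, not_false_eq_true, Function.update_of_ne, Function.update_self,
      e1, e2]
    refine existsRunSem_iff (p' := fun S => (∀ p ∈ S, p.1 ≤ x.length ∧ p.2 ≤ x.length) ∧
      WordSem B x.length l ∧ (graphOf S).degs = wordDegs (l.filterMap bitOf)) hn1 ?_
    intro S E h
    rw [h.big_iff]
    push Not
    refine and_congr_right fun hS => and_congr_right fun hw => ?_
    exact h.degsSem_iff hl hw hB hS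
  constructor
  · rintro ⟨A, hA, T, hT, st, cfg, lb, hrun, h | ⟨hS, q, hqX, hdeg⟩⟩
    · exact ⟨w₀, Or.inr ⟨hfresh.2 ⟨A, hA, T, hT, st, cfg, lb, hrun, h⟩, rfl⟩, hw₀⟩
    -- All the degrees are at most n, which bounds the coded word and lets the search find it.
    · have hlen : q.length ≤ x.length := by
        refine length_le_of_wordDegs fun d hd => ?_
        rw [← hdeg, degs_graphOf] at hd
        obtain ⟨v, hv, rfl⟩ := hd
        exact ncard_nbrs_le hS hv
      obtain ⟨l, hl, hw, rfl⟩ := exists_wordSem hlen (by omega : x.length < B)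
      exact ⟨_, Or.inl ⟨l, hl, (hcode l hl).2 ⟨A, hA, T, hT, st, cfg, lb, hrun, hS, hw, hdeg⟩, rfl⟩,
        hqX⟩
  · rintro ⟨q, ⟨l, hl, hsat, rfl⟩ | ⟨hsat, rfl⟩, hqX⟩
    · obtain ⟨A, hA, T, hT, st, cfg, lb, hrun, hS, -, hdeg⟩ := (hcode l hl).1 hsat
      exact ⟨A, hA, T, hT, st, cfg, lb, hrun, Or.inr ⟨hS, _, hqX, hdeg⟩⟩
    · obtain ⟨A, hA, T, hT, st, cfg, lb, hrun, h⟩ := hfresh.1 hsat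
      exact ⟨A, hA, T, hT, st, cfg, lb, hrun, Or.inl h⟩

end RunFm


/-! ### Automata that accept a single word -/

/-- The transitions of the automaton that accepts the single word `u`; the state is the number of
letters that remain to be read. -/
def pathTransitions {α : Type} : List α → List (ℕ × Option α × ℕ)
  | [] => []
  | l :: u => (u.length + 1, some l, u.length) :: pathTransitions u

/-- The automaton that accepts the single word `u`. -/
def pathAutomaton {α : Type} (u : List α) : Automaton α := ⟨u.length, [0], pathTransitions u⟩

theorem mem_pathTransitions {α : Type} {u : List α} {p q : ℕ} {o : Option α} :
    (p, o, q) ∈ pathTransitions u ↔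
      ∃ l u', (l :: u') <:+ u ∧ p = u'.length + 1 ∧ o = some l ∧ q = u'.length := by
  induction u with
  | nil => simp [pathTransitions]
  | cons a u ih =>
    simp only [pathTransitions, List.mem_cons, ih, List.suffix_cons_iff, Prod.mk.injEq]
    constructor
    · rintro (⟨rfl, rfl, rfl⟩ | ⟨l, u', h⟩)
      · exact ⟨a, u, Or.inl rfl, rfl, rfl, rfl⟩
      · exact ⟨l, u', Or.inr h.1, h.2⟩
    · rintro ⟨l, u', h | h, h'⟩
      · cases h
        exact Or.inl h'
      · exact Or.inr ⟨l, u', h, h'⟩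

theorem isPath_pathAutomaton {u u' : List Letter} (h : u' <:+ u) :
    (pathAutomaton u).toεNFA.IsPath u'.length 0 (u'.map some) := by
  induction u' with
  | nil => simp
  | cons l u' ih =>
    refine .cons u'.length _ _ _ _ ?_ (ih ((List.suffix_cons l u').trans h))
    exact mem_pathTransitions.2 ⟨l, u', h, rfl, rfl, rfl⟩

/-- A state is the length of the suffix that remains to be read, and a suffix of `u` is determined
by its length. -/
theorem eq_of_isPath_pathAutomaton {u : List Letter} {l : List (Option Letter)} {p q : ℕ}
    (hl : (pathAutomaton u).toεNFA.IsPath p q l) (hq : q = 0) {u' : List Letter} (h : u' <:+ u)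
    (hp : p = u'.length) : l.reduceOption = u' := by
  induction hl generalizing u' with
  | nil s =>
    subst hq
    exact (List.length_eq_zero_iff.1 hp.symm).symm
  | cons t s v o l hstep _ ih =>
    obtain ⟨b, u'', h1, h2, rfl, h3⟩ := mem_pathTransitions.1 hstep
    have : u' = b :: u'' := List.IsSuffix.eq_of_length (List.suffix_of_suffix_length_le h h1
      (by simp [← hp, h2])) (by simp [← hp, h2])
    rw [this, List.reduceOption_cons_of_some, ih hq ((List.suffix_cons b u'').trans h1) h3]

theorem mem_language_pathAutomaton {u w : List Letter} :
    w ∈ (pathAutomaton u).language ↔ w = u := by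
  rw [Automaton.mem_language_iff]
  constructor
  · rintro ⟨q, hq, l, rfl, hl⟩
    exact eq_of_isPath_pathAutomaton hl (by simpa [pathAutomaton] using hq) List.suffix_rfl rfl
  · rintro rfl
    refine ⟨0, by simp [pathAutomaton], w.map some, ?_, isPath_pathAutomaton List.suffix_rfl⟩
    simp [List.reduceOption]

theorem replicate_append_cons_inj {α : Type} {a c c' : α} (hc : c ≠ a) (hc' : c' ≠ a) {x y : ℕ}
    {l l' : List α} (h : List.replicate x a ++ c :: l = List.replicate y a ++ c' :: l') :
    x = y ∧ l = l' := by
  induction x generalizing y with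
  | zero =>
    cases y with
    | zero => simpa using (List.cons.inj h).2
    | succ y => exact absurd (List.cons.inj h).1 hc
  | succ x ih =>
    cases y with
    | zero => exact absurd (List.cons.inj h).1.symm hc'
    | succ y =>
      obtain ⟨h1, h2⟩ := ih (List.cons.inj h).2
      exact ⟨by rw [h1], h2⟩

/-- Unique decoding: the two blocks of letters `a` are ended by the delimiters `hash` and `right`.
-/
theorem flatMap_block_injective {xs ys : List (ℕ × ℕ)} (h : xs.flatMap block = ys.flatMap block) :
    xs = ys := by
  induction xs generalizing ys with
  | nil =>
    cases ys with
    | nil => rfl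
    | cons p ys => simp [block] at h
  | cons p xs ih =>
    cases ys with
    | nil => simp [block] at h
    | cons q ys =>
      simp only [List.flatMap_cons, block, List.cons_append, List.append_assoc, List.cons.injEq,
        true_and] at h
      obtain ⟨h1, h2⟩ := replicate_append_cons_inj (by simp) (by simp) h
      obtain ⟨h3, h4⟩ := replicate_append_cons_inj (by simp) (by simp) h2
      rw [Prod.ext h1 h3, ih h4]

/-! ### Disjoint unions of cliques -/

namespace Cliques

/-- Add the pairs `(o + r, o + s)` for all `s < j`. -/
def row (o r : ℕ) (ps : List (ℕ × ℕ)) : ℕ → List (ℕ × ℕ)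
  | 0 => ps
  | j + 1 => (o + r, o + j) :: row o r ps j

/-- Add the pairs `(o + r, o + s)` for all `r < j` and `s < k`. -/
def rows (o k : ℕ) (ps : List (ℕ × ℕ)) : ℕ → List (ℕ × ℕ)
  | 0 => ps
  | j + 1 => row o j (rows o k ps j) k

/-- The size of the clique of the letter number `i`. -/
def size (w : List Bool) (i : ℕ) : ℕ := 2 * i + 3 + (w[i]?.getD false).toNat

/-- The least vertex of the clique of the letter number `i`. -/
def offset (w : List Bool) : ℕ → ℕ
  | 0 => 0
  | i + 1 => offset w i + size w i

/-- The pairs of the cliques of the first `n` letters. -/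
def pairs (w : List Bool) : ℕ → List (ℕ × ℕ)
  | 0 => []
  | i + 1 => rows (offset w i) (size w i) (pairs w i) (size w i)

theorem mem_row {o r j : ℕ} {ps : List (ℕ × ℕ)} {p : ℕ × ℕ} :
    p ∈ row o r ps j ↔ p ∈ ps ∨ ∃ s < j, p = (o + r, o + s) := by
  induction j with
  | zero => simp [row]
  | succ j ih =>
    rw [row, List.mem_cons, ih]
    constructor
    · rintro (rfl | h | ⟨s, hs, rfl⟩)
      · exact Or.inr ⟨j, by omega, rfl⟩
      · exact Or.inl h
      · exact Or.inr ⟨s, by omega, rfl⟩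
    · rintro (h | ⟨s, hs, rfl⟩)
      · exact Or.inr (Or.inl h)
      · rcases Nat.lt_succ_iff_lt_or_eq.1 hs with hs | rfl
        · exact Or.inr (Or.inr ⟨s, hs, rfl⟩)
        · exact Or.inl rfl

theorem mem_rows {o k j : ℕ} {ps : List (ℕ × ℕ)} {p : ℕ × ℕ} :
    p ∈ rows o k ps j ↔ p ∈ ps ∨ ∃ r < j, ∃ s < k, p = (o + r, o + s) := by
  induction j with
  | zero => simp [rows]
  | succ j ih =>
    rw [rows, mem_row, ih]
    constructor
    · rintro ((h | ⟨r, hr, h⟩) | h)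
      · exact Or.inl h
      · exact Or.inr ⟨r, by omega, h⟩
      · exact Or.inr ⟨j, by omega, h⟩
    · rintro (h | ⟨r, hr, h⟩)
      · exact Or.inl (Or.inl h)
      · rcases Nat.lt_succ_iff_lt_or_eq.1 hr with hr | rfl
        · exact Or.inl (Or.inr ⟨r, hr, h⟩)
        · exact Or.inr h

theorem mem_pairs {w : List Bool} {n : ℕ} {p : ℕ × ℕ} : p ∈ pairs w n ↔
    ∃ i < n, ∃ r < size w i, ∃ s < size w i, p = (offset w i + r, offset w i + s) := by
  induction n with
  | zero => simp [pairs]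
  | succ n ih =>
    rw [pairs, mem_rows, ih]
    constructor
    · rintro (⟨i, hi, h⟩ | h)
      · exact ⟨i, by omega, h⟩
      · exact ⟨n, by omega, h⟩
    · rintro ⟨i, hi, h⟩
      rcases Nat.lt_succ_iff_lt_or_eq.1 hi with hi | rfl
      · exact Or.inl ⟨i, hi, h⟩
      · exact Or.inr h

theorem offset_mono (w : List Bool) : Monotone (offset w) :=
  monotone_nat_of_le_succ fun i => by simp [offset]

/-- The cliques occupy disjoint consecutive intervals of numbers. -/
theorem eq_of_offset_add {w : List Bool} {i j r s : ℕ} (hr : r < size w i) (hs : s < size w j)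
    (h : offset w i + r = offset w j + s) : i = j ∧ r = s := by
  have key : ∀ i j r s, r < size w i → i < j → offset w i + r < offset w j + s := by
    intro i j r s hr hij
    have := offset_mono w hij
    rw [Nat.succ_eq_add_one, offset] at this
    omega
  rcases lt_trichotomy i j with hlt | rfl | hlt
  · have := key i j r s hr hlt
    omega
  · exact ⟨rfl, by omega⟩
  · have := key j i s r hs hlt
    omega

theorem isVert_pairs {w : List Bool} {n v : ℕ} :
    IsVert (pairs w n).toFinset v ↔ ∃ i < n, ∃ r < size w i, v = offset w i + r := by
  constructor
  · rintro ⟨p, hp, h⟩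
    obtain ⟨i, hi, r, hr, s, hs, rfl⟩ := mem_pairs.1 (List.mem_toFinset.1 hp)
    rcases h with rfl | rfl
    · exact ⟨i, hi, r, hr, rfl⟩
    · exact ⟨i, hi, s, hs, rfl⟩
  · rintro ⟨i, hi, r, hr, rfl⟩
    exact ⟨_, List.mem_toFinset.2 (mem_pairs.2 ⟨i, hi, r, hr, r, hr, rfl⟩), Or.inl rfl⟩

/-- The pairs include the diagonal, which contributes no edges, so a vertex is adjacent to all the
other vertices of its interval. -/
theorem nbrs_pairs {w : List Bool} {n i r : ℕ} (hi : i < n) (hr : r < size w i) :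
    nbrs (pairs w n).toFinset (offset w i + r) =
      (((Finset.range (size w i)).erase r).image (offset w i + ·) : Finset ℕ) := by
  ext u
  simp only [nbrs, Set.mem_ofPred_eq, List.mem_toFinset, mem_pairs, Finset.coe_image,
    Finset.coe_erase, Finset.coe_range, Set.mem_image, Set.mem_sdiff, Set.mem_Iio,
    Set.mem_singleton_iff, Prod.mk.injEq]
  constructor
  · rintro ⟨hne, ⟨j, -, r', hr', s', hs', h1, rfl⟩ | ⟨j, -, r', hr', s', hs', rfl, h1⟩⟩
    · obtain ⟨rfl, rfl⟩ := eq_of_offset_add hr hr' h1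
      exact ⟨s', ⟨hs', by omega⟩, rfl⟩
    · obtain ⟨rfl, rfl⟩ := eq_of_offset_add hr hs' h1
      exact ⟨r', ⟨hr', by omega⟩, rfl⟩
  · rintro ⟨s, ⟨hs, hne⟩, rfl⟩
    exact ⟨by omega, Or.inl ⟨i, hi, r, hr, s, hs, rfl, rfl⟩⟩

/-- A clique with 2i + 3 + b vertices is regular of degree 2i + 2 + b, the code of the letter b at
position i. -/
theorem degs_pairs (w : List Bool) :
    (graphOf (pairs w w.length).toFinset).degs = wordDegs w := by
  have hcard : ∀ i r, i < w.length → r < size w i →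
      (nbrs (pairs w w.length).toFinset (offset w i + r)).ncard = size w i - 1 := by
    intro i r hi hr
    rw [nbrs_pairs hi hr, Set.ncard_coe_finset, Finset.card_image_of_injective _
      (add_right_injective _), Finset.card_erase_of_mem (Finset.mem_range.2 hr), Finset.card_range]
  rw [degs_graphOf]
  ext d
  simp only [Set.mem_ofPred_eq, isVert_pairs]
  constructor
  · rintro ⟨v, ⟨i, hi, r, hr, rfl⟩, rfl⟩
    refine ⟨i, w[i], List.getElem?_eq_getElem hi, ?_⟩
    rw [hcard i r hi hr, size, List.getElem?_eq_getElem hi, Option.getD_some]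
    omega
  · rintro ⟨i, b, hb, rfl⟩
    have hi : i < w.length := by
      by_contra hc
      rw [List.getElem?_eq_none (by omega)] at hb
      cases hb
    have h0 : 0 < size w i := by simp [size]
    refine ⟨offset w i + 0, ⟨i, hi, 0, h0, rfl⟩, ?_⟩
    rw [hcard i 0 hi h0, size, hb, Option.getD_some]
    omega

/-- The encoding of the union of cliques. -/
def word (w : List Bool) : List Letter := (pairs w w.length).flatMap block

/-- The automaton accepts one word only, and this word determines its list of pairs. The realized
graph is therefore the union of cliques; it has no vertex of degree one, and its degree set codes no
other word. -/
theorem mem_iff_encode_mem_NRR (X : Language Bool) (w : List Bool) :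
    w ∈ X ↔ (pathAutomaton (word w)).encode ∈ NRR (graphLanguage (degGraphs X)) := by
  rw [mem_NRR_iff]
  constructor
  · intro hw
    exact ⟨_, rfl, pairs w w.length, mem_language_pathAutomaton.2 rfl,
      Or.inr ⟨w, hw, degs_pairs w⟩⟩
  · rintro ⟨A, hA, xs, hxs, hG⟩
    rw [Automaton.language_eq_of_encode_eq hA, mem_language_pathAutomaton] at hxs
    rw [flatMap_block_injective hxs] at hG
    rcases hG with h | ⟨w', hw', h⟩
    · rw [degs_pairs] at h
      exact absurd h (one_notMem_wordDegs w)
    · rw [degs_pairs] at h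
      rw [wordDegs_injective h]
      exact hw'

end Cliques


/-! ### A program that writes down unions of cliques -/

open Automaton

/-- The variables of the program. -/
inductive CVar
  | w | off | k | k' | r | s | cnt
  deriving DecidableEq

instance : Fintype CVar := ⟨{.w, .off, .k, .k', .r, .s, .cnt}, by intro a; cases a <;> decide⟩

namespace Cliques

open Cmd

/-- Programs that write automata. -/
abbrev Prog := Cmd (Idx CVar) Bool (AutomatonSymbol Letter)

/-- The contents of the stacks. -/
abbrev Stks := Idx CVar → List Bool

/-- A number in unary. -/
def un (n : ℕ) : List Bool := List.replicate n false

theorem length_un (n : ℕ) : (un n).length = n := by simp [un]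

/-- The part of the output that describes the transitions for the word `u`. -/
def outOf (u : List Letter) : List (AutomatonSymbol Letter) :=
  (pathTransitions u).flatMap encodeTransition

/-- Store the length of the word `u` in the counter. -/
def withCnt (S : Stks) (u : List Letter) : Stks := Function.update S (.val .cnt) (un u.length)

/-- Increment a variable. -/
def incr (a : CVar) : Prog := .push (.val a) fun _ => false

/-- Write the counter. -/
def tallies : Prog := forEach .cnt (.pushOut fun _ => .tally)

/-- Add the letter `l` in front of the word. -/
def emit (l : Letter) : Prog :=
  .seq tallies <| .seq (.pushOut fun _ => .label (some l)) <| .seq (incr .cnt) <|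
    .seq tallies (.pushOut fun _ => .transition)

variable {S : Stks} {f : Bool × Bool} {ρ : Option Bool} {o : List (AutomatonSymbol Letter)}
  {u : List Letter} {M : ℕ}

theorem run_incr (a : CVar) {n : ℕ} (h : S (.val a) = un n) (x : Reg Bool) :
    Run ⊤ 1 (incr a) ⟨x, S, o⟩ ⟨x, Function.update S (.val a) (un (n + 1)), o⟩ := by
  have := Run.push (b := ⊤) (O := AutomatonSymbol Letter) (i := Idx.val a)
    (f := fun _ : Reg Bool => false) (s := ⟨x, S, o⟩) le_top
  simp only [h] at this
  exact this

theorem run_tallies {n : ℕ} (h : S (.val .cnt) = un n) (ht : S (.tmp .cnt) = []) :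
    Run ⊤ ((8 * n + 4 : ℕ) : ℕ∞) tallies ⟨(ρ, f), S, o⟩
      ⟨(none, f), S, List.replicate n .tally ++ o⟩ := by
  have := Run.forEach (b := ⊤) (n := 1) (c := (.pushOut fun _ => .tally : Prog)) (v := .cnt)
    (l := un n) (fun _ => S) (fun j => List.replicate j .tally ++ o) ρ f le_top
    (fun _ _ => h) (fun _ _ => ht) (fun j _ l₁ l₂ _ => by
      simpa [List.replicate_succ] using Run.pushOut (b := ⊤) (f := fun _ : Reg Bool =>
        (AutomatonSymbol.tally : AutomatonSymbol Letter))
        (s := ⟨(none, f), setVar S .cnt l₁ l₂, List.replicate j .tally ++ o⟩))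
  rw [length_un] at this
  refine this.mono ?_
  norm_cast
  omega

/-- The first letter of a word gives the first transition of the description, so a word that grows
at its front matches an output that grows at its head. The counter holds the target state, and after
the increment the source state. -/
theorem run_emit (l : Letter) (ht : S (.tmp .cnt) = []) (hM : u.length + 1 ≤ M) :
    Run ⊤ ((35 * M : ℕ) : ℕ∞) (emit l) ⟨(ρ, f), withCnt S u, outOf u⟩
      ⟨(none, f), withCnt S (l :: u), outOf (l :: u)⟩ := by
  have h1 := run_tallies (S := withCnt S u) (f := f) (ρ := ρ) (o := outOf u) (n := u.length)
    (by simp [withCnt]) (by simp [withCnt, ht])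
  have h2 := Run.pushOut (b := ⊤) (f := fun _ : Reg Bool =>
    (AutomatonSymbol.label (some l) : AutomatonSymbol Letter))
    (s := ⟨(none, f), withCnt S u, List.replicate u.length .tally ++ outOf u⟩)
  have h3 := run_incr (S := withCnt S u) (o := .label (some l) ::
    (List.replicate u.length .tally ++ outOf u)) .cnt (n := u.length) (by simp [withCnt]) (none, f)
  have h4 := run_tallies (S := withCnt S (l :: u)) (f := f) (ρ := none) (o := .label (some l) ::
    (List.replicate u.length .tally ++ outOf u)) (n := u.length + 1)
    (by simp [withCnt]) (by simp [withCnt, ht])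
  have h5 := Run.pushOut (b := ⊤) (f := fun _ : Reg Bool =>
    (AutomatonSymbol.transition : AutomatonSymbol Letter))
    (s := ⟨(none, f), withCnt S (l :: u), List.replicate (u.length + 1) .tally ++
      (.label (some l) :: (List.replicate u.length .tally ++ outOf u))⟩)
  have h34 : Function.update (withCnt S u) (.val .cnt) (un (u.length + 1)) = withCnt S (l :: u) := by
    simp [withCnt]
  rw [h34] at h3
  refine ((h1.seq (h2.seq (h3.seq (h4.seq h5)))).mono ?_).congr rfl ?_
  · norm_cast
    omega
  · simp [outOf, pathTransitions, encodeTransition]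

theorem setVar_update {a b : CVar} (ha : a ≠ b) (S : Stks) (l₁ l₂ l : List Bool) :
    setVar (Function.update S (.val b) l) a l₁ l₂ =
      Function.update (setVar S a l₁ l₂) (.val b) l := by
  unfold setVar
  rw [Function.update_comm (a := Idx.val b) (b := .val a) (by simpa using ha.symm),
    Function.update_comm (a := Idx.val b) (b := .tmp a) (by simp)]

theorem setVar_withCnt {a : CVar} (ha : a ≠ .cnt) (S : Stks) (u : List Letter) (l₁ l₂ : List Bool) :
    setVar (withCnt S u) a l₁ l₂ = withCnt (setVar S a l₁ l₂) u := by
  exact setVar_update ha S l₁ l₂ _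

theorem setVar_val {a b : CVar} (h : b ≠ a) (S : Stks) (l₁ l₂ : List Bool) :
    setVar S a l₁ l₂ (.val b) = S (.val b) := by
  simp [setVar, h]

theorem setVar_tmp {a b : CVar} (h : b ≠ a) (S : Stks) (l₁ l₂ : List Bool) :
    setVar S a l₁ l₂ (.tmp b) = S (.tmp b) := by
  simp [setVar, h]

/-- Bookkeeping for nested loops: each level raises the exponent by one and the coefficient by 11,
that is, 7 per round and 4 for the whole loop. -/
theorem loop_time {m a e : ℕ} (hm : m ≤ M) (h1 : 1 ≤ M) :
    ((m : ℕ) : ℕ∞) * (((a * M ^ e : ℕ) : ℕ∞) + 7) + 4 ≤ (((a + 11) * M ^ (e + 1) : ℕ) : ℕ∞) := by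
  have he : 1 ≤ M ^ e := Nat.one_le_pow _ _ h1
  have : m * (a * M ^ e + 7) + 4 ≤ (a + 11) * M ^ (e + 1) :=
    calc m * (a * M ^ e + 7) + 4 ≤ M * (a * M ^ e + 7 * M ^ e) + 4 * (M ^ e * M) := by
          gcongr
          · omega
          · nlinarith
      _ = _ := by ring
  exact_mod_cast this

/-- Add as many letters `a` as the value of a variable. -/
def emitAs (a : CVar) : Prog := forEach a (emit .a)

theorem run_emitAs {a : CVar} {m : ℕ} (ha : a ≠ .cnt) (hv : S (.val a) = un m)
    (htv : S (.tmp a) = []) (ht : S (.tmp .cnt) = []) (h1 : 1 ≤ M)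
    (hM : (List.replicate m Letter.a ++ u).length ≤ M) :
    Run ⊤ ((46 * M ^ 2 : ℕ) : ℕ∞) (emitAs a) ⟨(ρ, f), withCnt S u, outOf u⟩
      ⟨(none, f), withCnt S (List.replicate m .a ++ u), outOf (List.replicate m .a ++ u)⟩ := by
  rw [List.length_append, List.length_replicate] at hM
  have := Run.forEach (b := ⊤) (n := ((35 * M ^ 1 : ℕ) : ℕ∞)) (c := emit .a) (v := a) (l := un m)
    (fun j => withCnt S (List.replicate j .a ++ u)) (fun j => outOf (List.replicate j .a ++ u)) ρ f
    le_top (fun _ _ => by simpa [withCnt, ha] using hv) (fun _ _ => by simpa [withCnt] using htv)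
    (fun j hj l₁ l₂ _ => by
      rw [length_un] at hj
      rw [setVar_withCnt ha, setVar_withCnt ha, pow_one]
      exact run_emit .a (by rw [setVar_tmp ha.symm, ht]) (by simp; omega))
  rw [length_un] at this
  exact this.mono (loop_time (by omega) h1)

/-- Add a block. -/
def emitBlock : Prog :=
  .seq (emit .right) <| .seq (emitAs .s) <| .seq (emitAs .off) <| .seq (emit .hash) <|
    .seq (emitAs .r) <| .seq (emitAs .off) (emit .left)

/-- The block is written from right to left. Each component is a sum, written as an offset inside
the clique followed by the least vertex of the clique. -/
theorem run_emitBlock {x r s : ℕ} (ho : S (.val .off) = un x) (hr : S (.val .r) = un r)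
    (hs : S (.val .s) = un s) (ht : ∀ a : CVar, a = .off ∨ a = .r ∨ a = .s ∨ a = .cnt →
      S (.tmp a) = []) (h1 : 1 ≤ M) (hM : (block (x + r, x + s) ++ u).length ≤ M) :
    Run ⊤ ((300 * M ^ 2 : ℕ) : ℕ∞) emitBlock ⟨(ρ, f), withCnt S u, outOf u⟩
      ⟨(none, f), withCnt S (block (x + r, x + s) ++ u), outOf (block (x + r, x + s) ++ u)⟩ := by
  simp only [block, List.length_append, List.length_cons, List.length_replicate,
    List.length_nil] at hM
  have tc := ht .cnt (by simp)
  have e1 := run_emit (S := S) (f := f) (ρ := ρ) (u := u) (M := M) .right tc (by omega)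
  have e2 := run_emitAs (S := S) (f := f) (ρ := none) (u := .right :: u) (M := M) (a := .s)
    (by decide) hs (ht _ (by simp)) tc h1 (by simp; omega)
  have e3 := run_emitAs (S := S) (f := f) (ρ := none) (u := List.replicate s .a ++ .right :: u)
    (M := M) (a := .off) (by decide) ho (ht _ (by simp)) tc h1 (by simp; omega)
  have e4 := run_emit (S := S) (f := f) (ρ := none)
    (u := List.replicate x .a ++ (List.replicate s .a ++ .right :: u)) (M := M) .hash tc
    (by simp; omega)
  have e5 := run_emitAs (S := S) (f := f) (ρ := none)
    (u := .hash :: (List.replicate x .a ++ (List.replicate s .a ++ .right :: u))) (M := M) (a := .r)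
    (by decide) hr (ht _ (by simp)) tc h1 (by simp; omega)
  have e6 := run_emitAs (S := S) (f := f) (ρ := none)
    (u := List.replicate r .a ++ .hash ::
      (List.replicate x .a ++ (List.replicate s .a ++ .right :: u))) (M := M) (a := .off)
    (by decide) ho (ht _ (by simp)) tc h1 (by simp; omega)
  have e7 := run_emit (S := S) (f := f) (ρ := none)
    (u := List.replicate x .a ++ (List.replicate r .a ++ .hash ::
      (List.replicate x .a ++ (List.replicate s .a ++ .right :: u)))) (M := M) .left tc
    (by simp; omega)
  have hb : block (x + r, x + s) ++ u = .left :: (List.replicate x .a ++ (List.replicate r .a ++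
      .hash :: (List.replicate x .a ++ (List.replicate s .a ++ .right :: u)))) := by
    simp only [block, List.replicate_add, List.cons_append, List.append_assoc, List.nil_append]
  rw [hb]
  refine (e1.seq (e2.seq (e3.seq (e4.seq (e5.seq (e6.seq e7)))))).mono ?_
  have : M ≤ M ^ 2 := Nat.le_self_pow (by norm_num) _
  norm_cast
  omega

/-- The word of a list of pairs. -/
def flat (ps : List (ℕ × ℕ)) : List Letter := ps.flatMap block

theorem flat_cons (p : ℕ × ℕ) (ps : List (ℕ × ℕ)) : flat (p :: ps) = block p ++ flat ps := by
  simp [flat]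

/-- Intermediate words are no longer than the final one, so the single bound `M` serves all the
loops; the next two lemmas do the same for the outer levels. -/
theorem length_row_mono (x r : ℕ) (ps : List (ℕ × ℕ)) :
    Monotone fun j => (flat (row x r ps j)).length :=
  monotone_nat_of_le_succ fun j => by simp [row, flat_cons]

theorem length_rows_mono (x k : ℕ) (ps : List (ℕ × ℕ)) :
    Monotone fun j => (flat (rows x k ps j)).length :=
  monotone_nat_of_le_succ fun j => by
    simpa [rows, row] using length_row_mono x j (rows x k ps j) (Nat.zero_le k)

theorem length_pairs_mono (w : List Bool) : Monotone fun i => (flat (pairs w i)).length :=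
  monotone_nat_of_le_succ fun i => by
    simpa [pairs, rows] using
      length_rows_mono (offset w i) (size w i) (pairs w i) (Nat.zero_le (size w i))

/-- Add a row of blocks. -/
def rowProg : Prog := .seq (forEach .k' (.seq emitBlock (incr .s))) (.seq (clear (.val .s)) (incr .r))

/-- The second copy `k'` of the size is needed because this program runs inside a loop over `k`,
whose symbols are then partly on its auxiliary stack. For this reason `ht` does not require `.tmp
.k` to be empty. -/
theorem run_rowProg {x r k : ℕ} {ps : List (ℕ × ℕ)} (ho : S (.val .off) = un x)
    (hr : S (.val .r) = un r) (hs : S (.val .s) = []) (hk : S (.val .k') = un k)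
    (ht : ∀ a : CVar, a ≠ .k → S (.tmp a) = []) (h1 : 1 ≤ M) (hkM : k ≤ M)
    (hM : (flat (row x r ps k)).length ≤ M) :
    Run ⊤ ((320 * M ^ 3 : ℕ) : ℕ∞) rowProg ⟨(ρ, f), withCnt S (flat ps), outOf (flat ps)⟩
      ⟨(none, f), withCnt (Function.update S (.val .r) (un (r + 1))) (flat (row x r ps k)),
        outOf (flat (row x r ps k))⟩ := by
  have hloop := Run.forEach (b := ⊤) (n := ((301 * M ^ 2 : ℕ) : ℕ∞)) (c := .seq emitBlock (incr .s))
    (v := .k') (l := un k)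
    (fun j => withCnt (Function.update S (.val .s) (un j)) (flat (row x r ps j)))
    (fun j => outOf (flat (row x r ps j))) ρ f
    le_top (fun _ _ => by simpa [withCnt] using hk)
    (fun _ _ => by simpa [withCnt] using ht .k' (by decide))
    (fun j hj l₁ l₂ _ => by
      rw [length_un] at hj
      rw [setVar_withCnt (by decide), setVar_withCnt (by decide), setVar_update (by decide),
        setVar_update (by decide)]
      have e1 := run_emitBlock (S := Function.update (setVar S .k' l₁ l₂) (.val .s) (un j)) (f := f)
        (ρ := none) (u := flat (row x r ps j)) (M := M) (x := x) (r := r) (s := j)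
        (by simpa [setVar] using ho) (by simpa [setVar] using hr) (by simp)
        (by
          rintro a (rfl | rfl | rfl | rfl) <;> simpa [setVar] using ht _ (by decide)) h1
        (by
          rw [← flat_cons]
          exact (length_row_mono x r ps (show j + 1 ≤ k by omega)).trans hM)
      rw [← flat_cons] at e1
      have e2 := run_incr (S := withCnt (Function.update (setVar S .k' l₁ l₂) (.val .s) (un j))
        (flat (row x r ps (j + 1)))) (o := outOf (flat (row x r ps (j + 1)))) .s (n := j)
        (by simp [withCnt]) (none, f)
      refine ((e1.seq e2).mono ?_).congr rfl ?_
      · have : 1 ≤ M ^ 2 := Nat.one_le_pow _ _ h1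
        norm_cast
        omega
      · congr 1
        unfold withCnt
        rw [Function.update_comm (by simp), Function.update_idem])
  rw [length_un] at hloop
  have hclear := Run.clear (b := ⊤) (i := Idx.val CVar.s) none f
    (withCnt (Function.update S (.val .s) (un k)) (flat (row x r ps k)))
    (outOf (flat (row x r ps k)))
  have hlen : (withCnt (Function.update S (.val .s) (un k)) (flat (row x r ps k))
      (.val .s)).length = k := by simp [withCnt, length_un]
  have e0 : Function.update (withCnt (Function.update S (.val .s) (un k)) (flat (row x r ps k)))
      (.val .s) [] = withCnt S (flat (row x r ps k)) := by
    unfold withCnt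
    rw [Function.update_comm (by simp), Function.update_idem, ← hs, Function.update_eq_self]
  rw [e0] at hclear
  have hincr := run_incr (S := withCnt S (flat (row x r ps k)))
    (o := outOf (flat (row x r ps k))) .r (n := r) (by simpa [withCnt] using hr) (none, f)
  have e1 : withCnt (Function.update S (.val .s) (un 0)) (flat (row x r ps 0)) =
      withCnt S (flat ps) := by
    have : Function.update S (.val .s) (un 0) = S := by
      rw [show un 0 = S (.val .s) from hs.symm, Function.update_eq_self]
    rw [this]
    rfl
  refine ((hloop.mono (loop_time hkM h1)).seq (hclear.seq hincr)).mono ?_ |>.congr ?_ ?_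
  · have : M ≤ M ^ 3 := Nat.le_self_pow (by norm_num) _
    norm_cast
    rw [hlen, show 2 + 1 = 3 from rfl]
    omega
  · rw [e1]
    rfl
  · congr 1
    unfold withCnt
    rw [Function.update_comm (by simp)]

/-- Add a clique. -/
def cliqueProg : Prog := .seq (forEach .k rowProg) (clear (.val .r))

theorem run_cliqueProg {x k : ℕ} {ps : List (ℕ × ℕ)} (ho : S (.val .off) = un x)
    (hr : S (.val .r) = []) (hs : S (.val .s) = []) (hk : S (.val .k) = un k)
    (hk' : S (.val .k') = un k) (ht : ∀ a : CVar, S (.tmp a) = []) (h1 : 1 ≤ M) (hkM : k ≤ M)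
    (hM : (flat (rows x k ps k)).length ≤ M) :
    Run ⊤ ((340 * M ^ 4 : ℕ) : ℕ∞) cliqueProg ⟨(ρ, f), withCnt S (flat ps), outOf (flat ps)⟩
      ⟨(none, f), withCnt S (flat (rows x k ps k)), outOf (flat (rows x k ps k))⟩ := by
  have hloop := Run.forEach (b := ⊤) (n := ((320 * M ^ 3 : ℕ) : ℕ∞)) (c := rowProg)
    (v := .k) (l := un k)
    (fun j => withCnt (Function.update S (.val .r) (un j)) (flat (rows x k ps j)))
    (fun j => outOf (flat (rows x k ps j))) ρ f
    le_top (fun _ _ => by simpa [withCnt] using hk) (fun _ _ => by simpa [withCnt] using ht .k)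
    (fun j hj l₁ l₂ _ => by
      rw [length_un] at hj
      rw [setVar_withCnt (by decide), setVar_withCnt (by decide), setVar_update (by decide),
        setVar_update (by decide)]
      have e1 := run_rowProg (S := Function.update (setVar S .k l₁ l₂) (.val .r) (un j)) (f := f)
        (ρ := none) (ps := rows x k ps j) (M := M) (x := x) (r := j) (k := k)
        (by simpa [setVar] using ho) (by simp) (by simpa [setVar] using hs)
        (by simpa [setVar] using hk') (by
          intro a ha
          simpa [setVar, ha] using ht a) h1 hkM
        ((length_rows_mono x k ps (show j + 1 ≤ k by omega)).trans hM)
      rwa [Function.update_idem] at e1)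
  rw [length_un] at hloop
  have hclear := Run.clear (b := ⊤) (i := Idx.val CVar.r) none f
    (withCnt (Function.update S (.val .r) (un k)) (flat (rows x k ps k)))
    (outOf (flat (rows x k ps k)))
  have hlen : (withCnt (Function.update S (.val .r) (un k)) (flat (rows x k ps k))
      (.val .r)).length = k := by simp [withCnt, length_un]
  have e0 : Function.update (withCnt (Function.update S (.val .r) (un k)) (flat (rows x k ps k)))
      (.val .r) [] = withCnt S (flat (rows x k ps k)) := by
    unfold withCnt
    rw [Function.update_comm (by simp), Function.update_idem, ← hr, Function.update_eq_self]
  rw [e0] at hclear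
  have e1 : withCnt (Function.update S (.val .r) (un 0)) (flat (rows x k ps 0)) =
      withCnt S (flat ps) := by
    have : Function.update S (.val .r) (un 0) = S := by
      rw [show un 0 = S (.val .r) from hr.symm, Function.update_eq_self]
    rw [this]
    rfl
  refine ((hloop.mono (loop_time hkM h1)).seq hclear).mono ?_ |>.congr ?_ rfl
  · have : M ≤ M ^ 4 := Nat.le_self_pow (by norm_num) _
    norm_cast
    rw [hlen, show 3 + 1 = 4 from rfl]
    omega
  · rw [e1]
    rfl

end Cliques


/-! ### The program for a whole word -/

open Automaton

namespace Cliques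

open Cmd

/-- The contents of the stacks between two letters. -/
def mem (l : List Bool) (x k : ℕ) (u : List Letter) : Stks
  | .val .w => l
  | .val .off => un x
  | .val .k => un k
  | .val .k' => un k
  | .val .cnt => un u.length
  | _ => []

variable {l : List Bool} {x k : ℕ} {f : Bool × Bool} {ρ : Option Bool}
  {o : List (AutomatonSymbol Letter)} {u : List Letter} {ps : List (ℕ × ℕ)} {M : ℕ}

theorem withCnt_mem (u' : List Letter) : withCnt (mem l x k u') u = mem l x k u := by
  funext i
  rcases i with a | a | _
  · cases a <;> simp [withCnt, mem]
  · simp [withCnt, mem]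
  · simp [withCnt, mem]

theorem update_w_mem (l' : List Bool) : Function.update (mem l x k u) (.val .w) l' =
    mem l' x k u := by
  funext i
  rcases i with a | a | _
  · cases a <;> simp [mem]
  · simp [mem]
  · simp [mem]

/-- Increment both copies of the size. -/
def incrSize : Prog := .seq (incr .k) (incr .k')

theorem run_incrSize (y : Reg Bool) : Run ⊤ 2 incrSize ⟨y, mem l x k u, o⟩
    ⟨y, mem l x (k + 1) u, o⟩ := by
  have h1 := run_incr (S := mem l x k u) (o := o) .k (n := k) rfl y
  have h2 := run_incr (S := Function.update (mem l x k u) (.val .k) (un (k + 1))) (o := o) .k'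
    (n := k) rfl y
  refine ((h1.seq h2).congr rfl ?_).mono (by norm_num)
  congr 1
  funext i
  rcases i with a | a | _
  · cases a <;> simp [mem]
  · simp [mem]
  · simp [mem]

/-- Add the size to the offset. -/
def shift : Prog := forEach .k (incr .off)

theorem run_shift (h1 : 1 ≤ M) (hk : k ≤ M) : Run ⊤ ((12 * M : ℕ) : ℕ∞) shift
    ⟨(ρ, f), mem l x k u, o⟩ ⟨(none, f), mem l (x + k) k u, o⟩ := by
  have := Run.forEach (b := ⊤) (n := ((1 * M ^ 0 : ℕ) : ℕ∞)) (c := incr .off) (v := .k) (l := un k)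
    (fun j => mem l (x + j) k u) (fun _ => o) ρ f le_top (fun _ _ => rfl) (fun _ _ => rfl)
    (fun j _ l₁ l₂ _ => by
      have := run_incr (S := setVar (mem l (x + j) k u) .k l₁ l₂) (o := o) .off (n := x + j)
        (by rw [setVar_val (by decide)]; rfl) (none, f)
      refine (this.congr rfl ?_).mono (by simp)
      congr 1
      rw [← setVar_update (by decide)]
      congr 1
      funext i
      rcases i with a | a | _
      · cases a <;> simp [mem, add_assoc]
      · simp [mem]
      · simp [mem])
  rw [length_un] at this
  exact this.mono ((loop_time hk h1).trans (by simp))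

/-- Process a letter. -/
def letterProg : Prog :=
  .seq (.load fun r => (none, r.1.getD false, false)) <|
  .seq (.ite (fun r => r.2.1) incrSize (.load id)) <| .seq cliqueProg <| .seq shift <|
  .seq (.ite (fun r => r.2.1) incrSize (.seq incrSize incrSize)) <|
  .load fun _ => (none, false, false)

/-- On entry `k` is the size of the clique for the letter 0. The bit is kept in a flag: it first
raises `k` by its value, and after the clique and the shift of the offset, one or two increments
bring `k` to its initial value plus 2, ready for the next position. -/
theorem run_letterProg (g : Bool) (h1 : 1 ≤ M) (hk : k + 1 ≤ M)
    (hM : (flat (rows x (k + g.toNat) ps (k + g.toNat))).length ≤ M) :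
    Run ⊤ ((370 * M ^ 4 : ℕ) : ℕ∞) letterProg
      ⟨(some g, false, false), mem l x k (flat ps), outOf (flat ps)⟩
      ⟨(none, false, false), mem l (x + (k + g.toNat)) (k + 2)
        (flat (rows x (k + g.toNat) ps (k + g.toNat))),
        outOf (flat (rows x (k + g.toNat) ps (k + g.toNat)))⟩ := by
  have hg := Bool.toNat_le g
  have hM4 : M ≤ M ^ 4 := Nat.le_self_pow (by norm_num) _
  have e1 := Run.load (b := ⊤) (f := fun r : Reg Bool => (none, r.1.getD false, false))
    (s := (⟨(some g, false, false), mem l x k (flat ps), outOf (flat ps)⟩ :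
      Store (Idx CVar) Bool (AutomatonSymbol Letter)))
  have e2 : Run ⊤ 3 (.ite (fun r => r.2.1) incrSize (.load id) : Prog)
      ⟨(none, g, false), mem l x k (flat ps), outOf (flat ps)⟩
      ⟨(none, g, false), mem l x (k + g.toNat) (flat ps), outOf (flat ps)⟩ := by
    cases g
    · exact (Run.iteFalse rfl Run.load).mono (by norm_num)
    · exact (Run.iteTrue rfl (run_incrSize _)).mono (by norm_num)
  have e3 := run_cliqueProg (S := mem l x (k + g.toNat) []) (f := (g, false)) (ρ := none) (M := M)
    (x := x) (k := k + g.toNat) (ps := ps) rfl rfl rfl rfl rfl (fun _ => rfl) h1 (by omega) hM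
  rw [withCnt_mem, withCnt_mem] at e3
  set u' := flat (rows x (k + g.toNat) ps (k + g.toNat)) with hu'
  have e4 := run_shift (l := l) (x := x) (u := u') (o := outOf u') (ρ := none) (f := (g, false))
    h1 (show k + g.toNat ≤ M by omega)
  have e5 : Run ⊤ 5 (.ite (fun r => r.2.1) incrSize (.seq incrSize incrSize) : Prog)
      ⟨(none, g, false), mem l (x + (k + g.toNat)) (k + g.toNat) u', outOf u'⟩
      ⟨(none, g, false), mem l (x + (k + g.toNat)) (k + 2) u', outOf u'⟩ := by
    cases g
    · exact (Run.iteFalse rfl ((run_incrSize _).seq (run_incrSize _))).mono (by norm_num)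
    · exact (Run.iteTrue rfl (run_incrSize _)).mono (by norm_num)
  have e6 := Run.load (b := ⊤) (f := fun _ : Reg Bool => ((none, false, false) : Reg Bool))
    (s := (⟨(none, g, false), mem l (x + (k + g.toNat)) (k + 2) u', outOf u'⟩ :
      Store (Idx CVar) Bool (AutomatonSymbol Letter)))
  refine (e1.seq (e2.seq (e3.seq (e4.seq (e5.seq e6))))).mono ?_
  norm_cast
  omega

/-- The program that maps a word to the automaton of the corresponding union of cliques. -/
def prog : Prog :=
  .seq (.seq incrSize (.seq incrSize incrSize)) <| .seq (drain (.val .w) letterProg) <|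
  .seq (.pushOut fun _ => .accept) <| .seq tallies <| .seq (clear (.val .off)) <|
  .seq (clear (.val .k)) <| .seq (clear (.val .k')) (clear (.val .cnt))

theorem size_eq {w p : List Bool} {g : Bool} (h : w = p ++ g :: l) :
    size w p.length = 2 * p.length + 3 + g.toNat := by
  subst h
  simp [size]

theorem run_drain (w : List Bool) (h1 : 1 ≤ M) (hk : 2 * w.length + 4 ≤ M)
    (hM : (word w).length ≤ M) :
    Run ⊤ ((374 * M ^ 5 : ℕ) : ℕ∞) (drain (.val .w) letterProg)
      ⟨(none, false, false), mem w 0 3 [], []⟩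
      ⟨(none, false, false), mem [] (offset w w.length) (2 * w.length + 3) (word w),
        outOf (word w)⟩ := by
  have := Run.drain (b := ⊤) (n := ((370 * M ^ 4 : ℕ) : ℕ∞)) (c := letterProg) (i := .val .w)
    -- When the suffix `l` remains, `w.length - l.length` letters have been processed.
    (fun l => mem l (offset w (w.length - l.length)) (2 * (w.length - l.length) + 3)
      (flat (pairs w (w.length - l.length))))
    (fun l => outOf (flat (pairs w (w.length - l.length)))) (fun _ => (false, false)) w
    (fun _ _ => rfl) (fun g l hl => by
      obtain ⟨p, hp⟩ := hl
      have hlen : w.length = p.length + (l.length + 1) := by rw [← hp]; simp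
      have e1 : w.length - (g :: l).length = p.length := by simp [hlen]
      have e2 : w.length - l.length = p.length + 1 := by omega
      have hs := size_eq hp.symm
      refine ⟨none, ?_⟩
      rw [e1, e2, update_w_mem]
      have hstep := run_letterProg (M := M) (l := l) (x := offset w p.length)
        (k := 2 * p.length + 3) (ps := pairs w p.length) g h1 (by omega) (by
          rw [← hs]
          exact (length_pairs_mono w (show p.length + 1 ≤ w.length by omega)).trans hM)
      rw [← hs] at hstep
      exact hstep) none
  simp only [List.length_nil, Nat.sub_self, Nat.sub_zero] at this
  refine this.mono ?_
  have h4 : 1 ≤ M ^ 4 := Nat.one_le_pow _ _ h1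
  have h5 : 1 ≤ M ^ 5 := Nat.one_le_pow _ _ h1
  have : w.length * (370 * M ^ 4 + 2) + 2 ≤ 374 * M ^ 5 :=
    calc w.length * (370 * M ^ 4 + 2) + 2 ≤ M * (370 * M ^ 4 + 2 * M ^ 4) + 2 * M ^ 5 := by
          gcongr
          · omega
          · omega
          · omega
      _ = _ := by ring
  exact_mod_cast this

theorem encode_pathAutomaton (u : List Letter) : (pathAutomaton u).encode =
    List.replicate u.length .tally ++ .accept :: outOf u := by
  simp [encode_eq, pathAutomaton, encodeAccept, outOf]

/-- The three initial increments set the size for position 0. The output is completed at its head by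
the accepting state 0, which is a bare marker, and by the initial state, which is the length of the
word and hence the value of the counter. -/
theorem run_prog (w : List Bool) (h1 : 1 ≤ M) (hk : 2 * w.length + 4 ≤ M)
    (ho : offset w w.length ≤ M) (hM : (word w).length ≤ M) :
    Run ⊤ ((424 * M ^ 5 : ℕ) : ℕ∞) prog (init (.val .w) w)
      (final (pathAutomaton (word w)).encode) := by
  have hM5 : M ≤ M ^ 5 := Nat.le_self_pow (by norm_num) _
  have hinit : (init (.val .w) w : Store (Idx CVar) Bool (AutomatonSymbol Letter)) =
      ⟨(none, false, false), mem w 0 0 [], []⟩ := by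
    unfold init
    congr 1
    funext i
    rcases i with a | a | _
    · cases a <;> simp [mem, un]
    · simp [mem]
    · simp [mem]
  rw [hinit]
  have hsize := (run_incrSize (l := w) (x := 0) (k := 0) (u := []) (o := [])
    (none, false, false)).seq ((run_incrSize (none, false, false)).seq
      (run_incrSize (none, false, false)))
  have hdrain := run_drain w h1 hk hM
  set u := word w with hu
  have hacc := Run.pushOut (b := ⊤) (f := fun _ : Reg Bool =>
    (AutomatonSymbol.accept : AutomatonSymbol Letter))
    (s := ⟨(none, false, false), mem [] (offset w w.length) (2 * w.length + 3) u, outOf u⟩)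
  have htal := run_tallies (S := mem [] (offset w w.length) (2 * w.length + 3) u)
    (f := (false, false)) (ρ := none) (o := .accept :: outOf u) (n := u.length) rfl rfl
  rw [← encode_pathAutomaton] at htal
  set y := (pathAutomaton u).encode with hy
  set S := mem [] (offset w w.length) (2 * w.length + 3) u with hS
  have c1 := Run.clear (b := ⊤) (i := Idx.val CVar.off) none (false, false) S y
  set S₁ := Function.update S (.val .off) [] with hS₁
  have c2 := Run.clear (b := ⊤) (i := Idx.val CVar.k) none (false, false) S₁ y
  set S₂ := Function.update S₁ (.val .k) [] with hS₂
  have c3 := Run.clear (b := ⊤) (i := Idx.val CVar.k') none (false, false) S₂ y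
  set S₃ := Function.update S₂ (.val .k') [] with hS₃
  have c4 := Run.clear (b := ⊤) (i := Idx.val CVar.cnt) none (false, false) S₃ y
  have l1 : (S (.val .off)).length = offset w w.length := length_un _
  have l2 : (S₁ (.val .k)).length = 2 * w.length + 3 := length_un _
  have l3 : (S₂ (.val .k')).length = 2 * w.length + 3 := length_un _
  have l4 : (S₃ (.val .cnt)).length = u.length := length_un _
  rw [l1] at c1
  rw [l2] at c2
  rw [l3] at c3
  rw [l4] at c4
  have hfin : Function.update S₃ (.val .cnt) [] = fun _ => [] := by
    funext i
    rcases i with a | a | _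
    · cases a <;> simp [hS₃, hS₂, hS₁, hS, mem]
    · simp [hS₃, hS₂, hS₁, hS, mem]
    · simp [hS₃, hS₂, hS₁, hS, mem]
  rw [hfin] at c4
  refine (hsize.seq (hdrain.seq (hacc.seq (htal.seq (c1.seq (c2.seq (c3.seq c4))))))).mono ?_
  norm_cast
  omega

/-! ### Length of the encoding of the union of cliques -/

theorem size_le (w : List Bool) {i : ℕ} (hi : i < w.length) : size w i ≤ 2 * w.length + 5 := by
  have := Bool.toNat_le (w[i]?.getD false)
  unfold size
  omega

theorem offset_le (w : List Bool) {i : ℕ} (hi : i ≤ w.length) :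
    offset w i ≤ i * (2 * w.length + 5) := by
  induction i with
  | zero => simp [offset]
  | succ i ih =>
    rw [offset, add_mul, one_mul]
    exact add_le_add (ih (by omega)) (size_le w hi)

theorem length_row_le {x r K : ℕ} {ps : List (ℕ × ℕ)} {j : ℕ} (hr : r < K) (hj : j ≤ K) :
    (flat (row x r ps j)).length ≤ (flat ps).length + j * (2 * (x + K) + 3) := by
  induction j with
  | zero => simp [row]
  | succ j ih =>
    have := ih (by omega)
    rw [row, flat_cons, List.length_append, add_mul, one_mul]
    simp only [block, List.length_append, List.length_cons, List.length_replicate, List.length_nil]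
    omega

theorem length_rows_le {x k K : ℕ} {ps : List (ℕ × ℕ)} {j : ℕ} (hk : k ≤ K) (hj : j ≤ K) :
    (flat (rows x k ps j)).length ≤ (flat ps).length + j * (K * (2 * (x + K) + 3)) := by
  induction j with
  | zero => simp [rows]
  | succ j ih =>
    have h1 := ih (by omega)
    have h2 := length_row_le (x := x) (r := j) (K := K) (ps := rows x k ps j) (j := k) (by omega) hk
    have h3 : k * (2 * (x + K) + 3) ≤ K * (2 * (x + K) + 3) := Nat.mul_le_mul_right _ hk
    rw [rows, add_mul, one_mul]
    omega

/-- With K = 2|w| + 5 a clique has at most K vertices and hence at most K ^ 2 pairs, and a block has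
length at most K ^ 2. -/
theorem length_pairs_le (w : List Bool) {i : ℕ} (hi : i ≤ w.length) :
    (flat (pairs w i)).length ≤ i * (2 * w.length + 5) ^ 4 := by
  induction i with
  | zero => simp [pairs, flat]
  | succ i ih =>
    have h1 := ih (by omega)
    set K := 2 * w.length + 5 with hK
    have hs : size w i ≤ K := size_le w hi
    have ho : offset w i ≤ i * K := offset_le w (by omega)
    have h2 := length_rows_le (x := offset w i) (K := K) (ps := pairs w i) hs hs
    -- With |w| = n + 1 and i ≤ n the left-hand side is at most (2n + 2) K + 3, while K = 2n + 7.
    have h3 : 2 * (offset w i + K) + 3 ≤ K ^ 2 := by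
      have : i * K ≤ (w.length - 1) * K := Nat.mul_le_mul_right _ (by omega)
      obtain ⟨n, hn⟩ : ∃ n, w.length = n + 1 := ⟨w.length - 1, by omega⟩
      have hKn : K = 2 * n + 7 := by omega
      have : i * K ≤ n * K := Nat.mul_le_mul_right _ (by omega)
      rw [hKn] at this ho ⊢
      nlinarith
    have h4 : size w i * (K * (2 * (offset w i + K) + 3)) ≤ K ^ 4 :=
      calc _ ≤ K * (K * K ^ 2) := by gcongr
        _ = _ := by ring
    rw [pairs, add_mul, one_mul]
    omega

theorem polyTimeManyOneReducible_degGraphs (X : Language Bool) :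
    PolyTimeManyOneReducible X (NRR (graphLanguage (degGraphs X))) := by
  refine ⟨fun w => (pathAutomaton (word w)).encode, ?_, mem_iff_encode_mem_NRR X⟩
  refine computableInPolyTime prog (.val .w) _
    -- The inner fifth power is the bound `M` for the length of the encoding, and `run_prog` takes
    -- at most 424 M ^ 5 steps.
    (424 * ((2 * Polynomial.X + 5) ^ 5) ^ 5 : Polynomial ℕ) fun w => ?_
  have heval : Polynomial.eval w.length (424 * ((2 * Polynomial.X + 5) ^ 5) ^ 5 : Polynomial ℕ) =
      424 * ((2 * w.length + 5) ^ 5) ^ 5 := by simp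
  rw [heval]
  have hp : 2 * w.length + 5 ≤ (2 * w.length + 5) ^ 5 := Nat.le_self_pow (by norm_num) _
  refine run_prog w (by omega) (by omega) ?_ ?_
  · calc offset w w.length ≤ w.length * (2 * w.length + 5) := offset_le w le_rfl
      _ ≤ (2 * w.length + 5) * (2 * w.length + 5) := by gcongr; omega
      _ = (2 * w.length + 5) ^ 2 := by ring
      _ ≤ _ := Nat.pow_le_pow_right (by omega) (by norm_num)
  · calc (word w).length ≤ w.length * (2 * w.length + 5) ^ 4 := length_pairs_le w le_rfl
      _ ≤ (2 * w.length + 5) * (2 * w.length + 5) ^ 4 := by gcongr; omega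
      _ = _ := by ring

end Cliques


/-! ### The theorem -/

theorem theorem2 (X : Language Bool) (hX : ∃ w, w ∈ X) :
    ∃ 𝒢 : Set NatGraph, IsoClosed 𝒢 ∧
      PolyTimeManyOneReducible X (NRR (graphLanguage 𝒢)) ∧
      PolySpaceDttReducible (NRR (graphLanguage 𝒢)) X :=
  ⟨degGraphs X, isoClosed_degGraphs X, Cliques.polyTimeManyOneReducible_degGraphs X,
    RunFm.polySpaceDttReducible_degGraphs X hX⟩
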